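/- Let $n\ge 1$ be an integer, $\alpha>0$, $b>0$, $\mu\in\{1,-1\}$, and put $r_0=\frac{nb}{2\alpha}$. For $t>0$ let $S_\alpha(t)=e^{-t(-\Delta)^\alpha}$ be convolution on $\mathbb R^n$ with the kernel $K_t$ whose Fourier multiplier is $e^{-t|\xi|^{2\alpha}}$, and let $S_\alpha(0)$ be the identity. Consider (for real- or complex-valued functions) the Cauchy problem $$u_t+(-\Delta)^\alpha u=\mu|u|^bu,\qquad u(0)=\varphi\in L^r(\mathbb R^n).$$ A triplet $(q,p,r)$ is a *generalized admissible triplet* if $\frac1q=\frac n{2\alpha}\left(\frac1r-\frac1p\right)$, $1<r\le p<\infty$, and $p<\frac{nr}{n-2\alpha r}$ in the case $n>2\alpha r$. For an interval $I=[0,T)$, $0<T\le\infty$, let $Y(I)=C_b(I;L^r)\cap\dot{\mathcal C}_q(I;L^p)$, where $C_b$ denotes bounded continuous functions and $\dot{\mathcal C}_q(I;L^p)$ is the space of $w$ that are continuous from $I\setminus\{0\}$ to $L^p$ with $\sup_{t\in I,\,t>0}t^{1/q}\|w(t)\|_{L^p}<\infty$ and $\lim_{t\to0^+}t^{1/q}\|w(t)\|_{L^p}=0$.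 A *mild solution* in $Y(I)$ is a $u\in Y(I)$ such that $|u(\tau)|^bu(\tau)$ belongs to some $L^m$, $1\le m\le\infty$, for every $0<\tau\in I$ (automatic if $p\ge b+1$), and $$u(t)=S_\alpha(t)\varphi+\int_0^tS_\alpha(t-\tau)\,\mu|u(\tau)|^bu(\tau)\,d\tau\qquad(t\in I),$$ with an $L^r$-valued Bochner integral. **Theorem 4.2.** Let $1<r_0\le r$, and let $(q,p,r)$ be a generalized admissible triplet with $r<p$ (i.e. $q<\infty$). (i) For every $\varphi\in L^r(\mathbb R^n)$ there are $T>0$ and a mild solution $u\in Y([0,T))$. If $r>r_0$, then $T$ can be chosen depending (for fixed $n,\alpha,b,\mu,q,p,r$) only on an upper bound for $\|\varphi\|_{L^r}$; if $r=r_0$, $T$ may depend on $\varphi$ itself. If $p\ge b+1$, then for every $T\in(0,\infty]$ there is at most one mild solution in $Y([0,T))$. (ii) If $r=r_0$, then for every $\varepsilon>0$ there is $\delta>0$ such that for every $\varphi$ with $\|\varphi\|_{L^{r_0}}\le\delta$ there is a global mild solution $u\in Y([0,\infty))$, and it can be chosen with $\|u(t)\|_{L^{r_0}}\le\varepsilon$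 for all $t\ge0$ and $t^{1/q}\|u(t)\|_{L^p}\le\varepsilon$ for all $t>0$. (iii) If $r>r_0$, there is a constant $C>0$, independent of $\varphi$, $u$, $T^*$ and $s$, with the following property. Let $[0,T^*)$ with $0<T^*<\infty$ be the maximal existence interval of $u$, that is, $u$ is a mild solution in $Y([0,T))$ for every $0<T<T^*$, and for no $T>T^*$ does the problem with the same $\varphi$ have a mild solution in $Y([0,T))$. Then $$\|u(s)\|_{L^r}\ge\frac{C}{(T^*-s)^{\frac1b-\frac n{2r\alpha}}}\qquad\text{for all }0\le s<T^*.$$ -/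

import Mathlib

open MeasureTheory Set Filter Topology
open scoped ENNReal FourierTransform

noncomputable section

/-- The symbol `ξ ↦ exp (-t |2πξ|^{2α})` of `exp (-t (-Δ)^α)`; the factor `2π` is due to Mathlib's
Fourier transform, whose phase is `exp (2πi x·ξ)`. -/
def fracHeatSymbol (n : ℕ) (α t : ℝ) (ξ : EuclideanSpace ℝ (Fin n)) : ℂ :=
  ((Real.exp (-(t * (2 * Real.pi * ‖ξ‖) ^ (2 * α))) : ℝ) : ℂ)

/-- The fractional heat kernel `K_t`, the inverse Fourier transform of the symbol. It is a real
valued function, see `ofReal_fracHeatKernel`. -/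
def fracHeatKernel (n : ℕ) (α t : ℝ) (x : EuclideanSpace ℝ (Fin n)) : ℝ :=
  ((𝓕⁻ (fracHeatSymbol n α t)) x).re

/-- Taking the real part in the definition of the kernel discards nothing. -/
theorem ofReal_fracHeatKernel (n : ℕ) (α t : ℝ) (x : EuclideanSpace ℝ (Fin n)) :
    ((fracHeatKernel n α t x : ℝ) : ℂ) = (𝓕⁻ (fracHeatSymbol n α t)) x := by
  unfold fracHeatKernel
  rw [← Complex.conj_eq_iff_re, Real.fourierInv_eq', ← integral_conj,
    ← integral_neg_eq_self (μ := (volume : Measure (EuclideanSpace ℝ (Fin n))))]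
  refine integral_congr_ae (Eventually.of_forall fun ξ => ?_)
  have h2 : (starRingEnd ℂ) 2 = 2 := Complex.conj_ofNat 2
  simp [fracHeatSymbol, ← Complex.exp_conj, h2]

/-- The semigroup `S_α(t) = exp (-t (-Δ)^α)`: convolution with `K_t` for `t > 0`, the identity for
`t = 0` (negative times are not used). -/
def fracHeatSemigroup {𝕜 : Type*} [RCLike 𝕜] {n : ℕ} (α t : ℝ)
    (φ : EuclideanSpace ℝ (Fin n) → 𝕜) : EuclideanSpace ℝ (Fin n) → 𝕜 :=
  if 0 < t then fun x => ∫ y, fracHeatKernel n α t (x - y) • φ y else φ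

/-- The nonlinearity `f(z) = μ |z|^b z`; the sign `μ` is `1` or `-1`. -/
def powerNonlinearity {𝕜 : Type*} [RCLike 𝕜] (μ b : ℝ) (z : 𝕜) : 𝕜 :=
  (μ * ‖z‖ ^ b) • z

/-- The time interval `[0, T)`, for `T` finite or `T = ⊤`. -/
def timeInterval (T : EReal) : Set ℝ := {t : ℝ | 0 ≤ t ∧ (t : EReal) < T}

/-- `(q, p, r)` is a generalized admissible triplet:
`1/q = n/(2α) (1/r - 1/p)`, `1 < r ≤ p < ∞`, and `p < n r / (n - 2 α r)` if `n > 2 r α`.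
Here `q ∈ (0, ∞]`, and `q = ∞` exactly when `p = r`. -/
structure IsGenAdmissible (n : ℕ) (α : ℝ) (q : ℝ≥0∞) (p r : ℝ) : Prop where
  inv_q : q⁻¹ = ENNReal.ofReal ((n : ℝ) / (2 * α) * (1 / r - 1 / p))
  one_lt : 1 < r
  le : r ≤ p
  lt : 2 * r * α < (n : ℝ) → p < (n : ℝ) * r / ((n : ℝ) - 2 * α * r)

/-- `u ∈ C_b(I; B)`. -/
def MemCb {B : Type*} [NormedAddCommGroup B] (I : Set ℝ) (u : ℝ → B) : Prop :=
  ContinuousOn u I ∧ ∃ M : ℝ, ∀ t ∈ I, ‖u t‖ ≤ M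

/-- `w ∈ 𝒞_σ(I; B)`: `w` is continuous at the positive times of `I`, and
`sup t^{1/σ} ‖w(t)‖` over these times is finite. (The value at `t = 0` plays no role.) -/
def MemWeighted {B : Type*} [NormedAddCommGroup B] (σ : ℝ≥0∞) (I : Set ℝ) (w : ℝ → B) : Prop :=
  ContinuousOn w (I ∩ Ioi 0) ∧ ∃ M : ℝ, ∀ t ∈ I, 0 < t → t ^ (σ⁻¹).toReal * ‖w t‖ ≤ M

/-- `w` belongs to the homogeneous space `𝒞̇_σ(I; B)`: moreover `t^{1/σ} ‖w(t)‖ → 0` as `t → 0+`. -/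
def MemWeightedDot {B : Type*} [NormedAddCommGroup B] (σ : ℝ≥0∞) (I : Set ℝ) (w : ℝ → B) : Prop :=
  MemWeighted σ I w ∧ Tendsto (fun t : ℝ => t ^ (σ⁻¹).toReal * ‖w t‖) (𝓝[>] 0) (𝓝 0)

/-- `u ∈ Y(I) = C_b(I; L^r) ∩ 𝒞̇_q(I; L^p)`. The curve `w` is `u` itself, regarded as
`L^p`-valued at positive times. -/
def MemY {𝕜 : Type*} [RCLike 𝕜] {n : ℕ} (q p : ℝ≥0∞) {r : ℝ≥0∞} [Fact (1 ≤ p)] [Fact (1 ≤ r)]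
    (I : Set ℝ) (u : ℝ → Lp 𝕜 r (volume : Measure (EuclideanSpace ℝ (Fin n)))) : Prop :=
  MemCb I u ∧
    ∃ w : ℝ → Lp 𝕜 p (volume : Measure (EuclideanSpace ℝ (Fin n))),
      (∀ t ∈ I, 0 < t → ⇑(w t) =ᵐ[volume] ⇑(u t)) ∧ MemWeightedDot q I w

/-- `u` is a mild solution on `I` of `u_t + (-Δ)^α u = μ |u|^b u`, `u(0) = φ`:
`u(t) = S_α(t) φ + ∫_0^t S_α(t-τ) f(u(τ)) dτ` for all `t ∈ I`, with a Bochner integral in `L^r`.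
At every positive time `f(u(τ))` has to lie in some `L^m` with `1 ≤ m ≤ ∞`, so that
`S_α(t-τ)` can be applied to it. -/
structure IsMildSolution {𝕜 : Type*} [RCLike 𝕜] {n : ℕ} (α b μ : ℝ) {r : ℝ≥0∞} [Fact (1 ≤ r)]
    (φ : Lp 𝕜 r (volume : Measure (EuclideanSpace ℝ (Fin n)))) (I : Set ℝ)
    (u : ℝ → Lp 𝕜 r (volume : Measure (EuclideanSpace ℝ (Fin n)))) : Prop where
  forcing_memLp : ∀ τ ∈ I, 0 < τ →
    ∃ m : ℝ≥0∞, 1 ≤ m ∧ MemLp (fun x => powerNonlinearity μ b (u τ x)) m volume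
  integral_eq : ∀ t ∈ I,
    ∃ g : ℝ → Lp 𝕜 r (volume : Measure (EuclideanSpace ℝ (Fin n))),
      (∀ᵐ τ : ℝ, τ ∈ Ioo 0 t →
        ⇑(g τ) =ᵐ[volume]
          fracHeatSemigroup α (t - τ) (fun x => powerNonlinearity μ b (u τ x))) ∧
      IntervalIntegrable g volume 0 t ∧
      ⇑(u t) =ᵐ[volume] fun x => fracHeatSemigroup α t (⇑φ) x + (∫ τ in (0 : ℝ)..t, g τ) x

/-- `u` is a mild solution in the class `Y([0, T))`. -/
def IsYSolution {𝕜 : Type*} [RCLike 𝕜] {n : ℕ} (α b μ : ℝ) (q p : ℝ≥0∞) {r : ℝ≥0∞}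
    [Fact (1 ≤ p)] [Fact (1 ≤ r)]
    (φ : Lp 𝕜 r (volume : Measure (EuclideanSpace ℝ (Fin n)))) (T : EReal)
    (u : ℝ → Lp 𝕜 r (volume : Measure (EuclideanSpace ℝ (Fin n)))) : Prop :=
  MemY q p (timeInterval T) u ∧ IsMildSolution α b μ φ (timeInterval T) u

/-- `[0, Tmax)`, with `Tmax` finite, is the maximal existence interval of the solution `u`:
`u` solves the problem in `Y([0, T))` for every `T < Tmax`, and the problem has no solution in
`Y([0, T))` for any `T > Tmax`. -/
def IsMaximalYSolution {𝕜 : Type*} [RCLike 𝕜] {n : ℕ} (α b μ : ℝ) (q p : ℝ≥0∞) {r : ℝ≥0∞}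
    [Fact (1 ≤ p)] [Fact (1 ≤ r)]
    (φ : Lp 𝕜 r (volume : Measure (EuclideanSpace ℝ (Fin n)))) (Tmax : ℝ)
    (u : ℝ → Lp 𝕜 r (volume : Measure (EuclideanSpace ℝ (Fin n)))) : Prop :=
  0 < Tmax ∧
    (∀ T : ℝ, 0 < T → T < Tmax → IsYSolution α b μ q p φ (T : EReal) u) ∧
    ∀ T : ℝ, Tmax < T → ¬ ∃ v : ℝ → Lp 𝕜 r (volume : Measure (EuclideanSpace ℝ (Fin n))),
      IsYSolution α b μ q p φ (T : EReal) v

end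

/-! Write `r₀ = nb/(2α)`, `θ = 1 - r₀/r ≥ 0` and `e(m, ρ) = n/(2α) (1/m - 1/ρ)`, which is
`heatDecay`.

The linear input is that `exp(-|ξ|^{2α})` is the Fourier transform of an integrable function. Away
from the origin the symbol is smooth and rapidly decaying. At the origin `|ξ|^{2α}` is singular but
homogeneous: cut off, it is a geometric series of dilates of one smooth annular function
(`exists_isFourierL1_rpow_mul_smoothBump`), and its exponential is a power series in the algebra of
such transforms. Scaling turns the integrability of `K₁` into the bound `C t^{-e(m, ρ)}` for `S(t) :
L^m → L^ρ`, together with strong continuity.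

The nonlinear part is Kato's method in an auxiliary exponent `P` with `r < P < r(b+1)` and `b + 1 ≤
P`. The nonlinearity maps `L^P` to `L^{P/(b+1)}`, and `S` brings this back to `L^P`. In the norm
`sup t^{e(r,P)} ‖w(t)‖_P` the Duhamel term costs a beta integral and gains `t^θ`, whatever `P` is,
so it is a contraction on the ball of radius `R` once `K Λ R^b ≤ 1`, where `Λ` bounds `t^θ`
(`exists_mildSolution_of_small`). The exponent `p` plays no part in the fixed point: the forcing `F
= f(u)` in `L^{P/(b+1)}` determines the solution, and its `L^r` and `L^p` bounds are read off from
the Duhamel formula. This needs `e(P/(b+1), p) < 1`, which holds for `P` near `r(b+1)` because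
admissibility of `p` means `e(r, p) < 1`.

For `r > r₀` the choice `Λ = T^θ`, `R ~ ‖φ‖` gives existence as long as `T^θ ‖φ‖^b ≤ c`. For `r =
r₀` there is no power of `T` to gain; smallness comes from `t^e ‖S(t)φ‖_P → 0` as `t → 0`, or,
globally, from small data.

For uniqueness, `p ≥ b + 1` allows `P ≤ p`, so interpolation between `L^r` and `L^p` places every
solution in the weighted `L^P` class (`IsYSolution.exists_forcing`). Two solutions agree near `0`
because their weighted norms vanish there, and afterwards by steps of fixed length
(`eqOn_of_duhamel`).

The lower bound (iii) is continuation: if `‖u(s)‖` were too small, the problem restarted from `u(s)`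
would live for time `2(T* - s)`, and gluing would extend the solution beyond `T*`. The glued curve
is continuous in `L^p` at time `s` since a solution with data in `L^r ∩ L^p` stays bounded in `L^p`
down to its initial time. -/

/-! ### The algebra of Fourier transforms of integrable functions -/

/-- `f` is pointwise the Fourier transform of an integrable function of `L¹` norm at most `C`. -/
def IsFourierL1 {V : Type*} [NormedAddCommGroup V] [InnerProductSpace ℝ V] [FiniteDimensional ℝ V]
    [MeasurableSpace V] [BorelSpace V] (f : V → ℂ) (C : ℝ) : Prop :=
  ∃ h : V → ℂ, Integrable h ∧ ∫ x, ‖h x‖ ≤ C ∧ ∀ ξ, 𝓕 h ξ = f ξ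

namespace IsFourierL1

variable {V : Type*} [NormedAddCommGroup V] [InnerProductSpace ℝ V] [FiniteDimensional ℝ V]
    [MeasurableSpace V] [BorelSpace V] {f g : V → ℂ} {C D : ℝ}

theorem nonneg (hf : IsFourierL1 f C) : 0 ≤ C := by
  obtain ⟨h, -, hC, -⟩ := hf
  exact (integral_nonneg fun _ => norm_nonneg _).trans hC

theorem congr (hf : IsFourierL1 f C) (h : ∀ ξ, f ξ = g ξ) : IsFourierL1 g C := by
  rwa [← funext h]

theorem of_schwartz (F : SchwartzMap V ℂ) : ∃ C, IsFourierL1 F C := by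
  let H : SchwartzMap V ℂ := 𝓕⁻ F
  have hH : 𝓕 H = F := FourierTransform.fourier_fourierInv_eq F
  refine ⟨_, H, H.integrable, le_rfl, fun ξ => ?_⟩
  exact congrArg (fun G : SchwartzMap V ℂ => G ξ) hH

/-- Convolve the two preimages: the bounds multiply, so powers and power series of multipliers can
be controlled. -/
theorem mul (hf : IsFourierL1 f C) (hg : IsFourierL1 g D) :
    IsFourierL1 (fun ξ => f ξ * g ξ) (C * D) := by
  have hC := hf.nonneg
  obtain ⟨h, hi, hC', hh⟩ := hf
  obtain ⟨k, ki, kC, kk⟩ := hg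
  refine ⟨convolution h k (ContinuousLinearMap.mul ℂ ℂ) volume, ?_, ?_, fun ξ => ?_⟩
  · exact hi.integrable_convolution _ ki
  · calc ∫ x, ‖convolution h k (ContinuousLinearMap.mul ℂ ℂ) volume x‖
        ≤ ∫ x, convolution (fun x => ‖h x‖) (fun x => ‖k x‖) (ContinuousLinearMap.mul ℝ ℝ)
            volume x := by
          refine integral_mono (hi.integrable_convolution _ ki).norm
            (hi.norm.integrable_convolution _ ki.norm) fun x => ?_
          refine (norm_integral_le_integral_norm _).trans (le_of_eq ?_)
          simp [convolution]
      _ = (∫ x, ‖h x‖) * ∫ x, ‖k x‖ := by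
          have := integral_convolution (ContinuousLinearMap.mul ℝ ℝ) hi.norm ki.norm
          simpa using this
      _ ≤ C * D := mul_le_mul hC' kC (integral_nonneg fun _ => norm_nonneg _) hC
  · rw [Real.fourier_mul_convolution_eq hi ki, hh, kk]

/-- The preimages have summable `L¹` norms, so their series converges absolutely almost everywhere
and may be Fourier transformed term by term. Dyadic sums and exponential series of multipliers rest
on this. -/
theorem hasSum {F : ℕ → V → ℂ} {c : ℕ → ℝ} {S : ℝ}
    (hF : ∀ i, IsFourierL1 (F i) (c i)) (hc : HasSum c S)
    (hf : ∀ ξ, HasSum (fun i => F i ξ) (f ξ)) : IsFourierL1 f S := by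
  have hc0 : ∀ i, 0 ≤ c i := fun i => (hF i).nonneg
  choose h hi hC hh using hF
  have hs : Summable fun i => ∫ x, ‖h i x‖ :=
    hc.summable.of_nonneg_of_le (fun i => integral_nonneg fun _ => norm_nonneg _) hC
  have hfin : ∑' i, ∫⁻ x, ‖h i x‖ₑ ≠ ∞ := by
    have : ∀ i, ∫⁻ x, ‖h i x‖ₑ = ENNReal.ofReal (∫ x, ‖h i x‖) := fun i =>
      (ofReal_integral_norm_eq_lintegral_enorm (hi i)).symm
    simp_rw [this]
    exact hs.tsum_ofReal_ne_top
  have hae : ∀ᵐ x, Summable fun i => ‖h i x‖ :=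
    summable_norm_of_tsum_eLpNorm_ne_top le_rfl (fun i => (hi i).1)
      (by simpa [eLpNorm_one_eq_lintegral_enorm] using hfin)
  have hlt : ∫⁻ x, ∑' i, ‖h i x‖ₑ ≠ ∞ := by
    rwa [lintegral_tsum fun i => (hi i).1.enorm]
  have hmeas : AEStronglyMeasurable (fun x => ∑' i, h i x) (volume : Measure V) := by
    refine aestronglyMeasurable_of_tendsto_ae atTop
      (fun N => Finset.aestronglyMeasurable_fun_sum (Finset.range N) fun i _ => (hi i).1) ?_
    filter_upwards [hae] with x hx
    exact hx.of_norm.hasSum.tendsto_sum_nat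
  have hint : Integrable fun x => ∑' i, h i x := by
    refine ⟨hmeas, lt_of_le_of_lt (lintegral_mono_ae ?_) hlt.lt_top⟩
    filter_upwards [hae] with x hx
    exact enorm_tsum_le_tsum_enorm
  refine ⟨fun x => ∑' i, h i x, hint, ?_, fun ξ => ?_⟩
  · have h1 := hasSum_integral_of_summable_integral_norm (F := fun i x => ‖h i x‖)
      (fun i => (hi i).norm) (by simpa using hs)
    calc ∫ x, ‖∑' i, h i x‖ ≤ ∫ x, ∑' i, ‖h i x‖ := by
          refine integral_mono_ae hint.norm ?_ ?_
          · refine ⟨aestronglyMeasurable_of_tendsto_ae atTop (fun N =>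
              Finset.aestronglyMeasurable_fun_sum (Finset.range N) fun i _ => (hi i).1.norm) ?_,
              lt_of_le_of_lt (lintegral_mono_ae ?_) hlt.lt_top⟩
            · filter_upwards [hae] with x hx
              exact hx.hasSum.tendsto_sum_nat
            · filter_upwards [hae] with x hx
              exact enorm_tsum_le_tsum_enorm.trans (by simp)
          · filter_upwards [hae] with x hx
            exact norm_tsum_le_tsum_norm hx
      _ ≤ S := hasSum_le hC h1 hc
  · have h1 := hasSum_integral_of_summable_integral_norm
      (F := fun i x => Real.fourierChar (-inner ℝ x ξ) • h i x)
      (fun i => by simpa using hi i) (by simpa [Circle.norm_smul] using hs)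
    have h2 : ∀ i, ∫ x, Real.fourierChar (-inner ℝ x ξ) • h i x = F i ξ := fun i => by
      rw [← hh i ξ, Real.fourier_eq]
    simp_rw [h2] at h1
    rw [(hf ξ).unique h1, Real.fourier_eq]
    refine integral_congr_ae ?_
    filter_upwards [hae] with x hx
    exact (hx.of_norm.hasSum.const_smul (Real.fourierChar (-inner ℝ x ξ))).tsum_eq.symm

/-- The preimage becomes `c^{-d} h(x/c)`, whose `L¹` norm is that of `h`. That the bound does not
depend on `c` is what makes dyadic sums of dilates converge. -/
theorem comp_smul (hf : IsFourierL1 f C) {c : ℝ} (hc : 0 < c) :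
    IsFourierL1 (fun ξ => f (c • ξ)) C := by
  obtain ⟨h, hi, hC, hh⟩ := hf
  have e : ∀ {G : Type} [NormedAddCommGroup G] [NormedSpace ℝ G] (u : V → G),
      ∫ x, u (c⁻¹ • x) = c ^ (Module.finrank ℝ V) • ∫ x, u x := by
    intro G _ _ u
    rw [Measure.integral_comp_smul]
    congr 1
    rw [inv_pow, inv_inv, abs_of_pos (by positivity)]
  have hcn : (c ^ (Module.finrank ℝ V)) ≠ 0 := by positivity
  refine ⟨fun x => (c ^ (Module.finrank ℝ V))⁻¹ • h (c⁻¹ • x), ?_, ?_, fun ξ => ?_⟩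
  · exact (hi.comp_smul (inv_ne_zero hc.ne')).smul (c ^ (Module.finrank ℝ V))⁻¹
  · simp_rw [norm_smul]
    rw [integral_const_mul, e (fun x => ‖h x‖), smul_eq_mul, ← mul_assoc]
    rw [Real.norm_of_nonneg (by positivity), inv_mul_cancel₀ hcn, one_mul]
    exact hC
  · simp only
    rw [← hh, Real.fourier_eq, Real.fourier_eq]
    have := e (fun x => Real.fourierChar (-inner ℝ x (c • ξ)) • h x)
    rw [← inv_smul_eq_iff₀ hcn] at this
    rw [← this, ← integral_smul]
    refine integral_congr_ae (Eventually.of_forall fun x => ?_)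
    simp only
    rw [smul_comm, inner_smul_left, inner_smul_right]
    simp [← mul_assoc, inv_mul_cancel₀ hc.ne']

/-- If an integrable function is the Fourier transform of an `L¹` function, its inverse Fourier
transform is in `L¹`. -/
theorem integrable_fourierInv (hf : IsFourierL1 f C) (hfi : Integrable f) :
    Integrable (𝓕⁻ f) := by
  obtain ⟨h, hi, hC, hh⟩ := hf
  have hcont : Continuous (𝓕⁻ f) := by
    exact VectorFourier.fourierIntegral_continuous Real.continuous_fourierChar
      (by simp; fun_prop) hfi
  refine hi.congr ?_
  -- Duality: for a test function `φ = 𝓕 Ψ`, moving the transform across shows that the pairings of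
  -- `φ` with `h` and with `𝓕⁻ f` both equal `∫ f · 𝓕⁻ φ`.
  refine ae_eq_of_integral_contDiff_smul_eq hi.locallyIntegrable hcont.locallyIntegrable
    fun φ hφ hφc => ?_
  have hφ2 : HasCompactSupport (fun x => (φ x : ℂ)) := hφc.comp_left (g := Complex.ofReal) rfl
  let Φ : SchwartzMap V ℂ := hφ2.toSchwartzMap (Complex.ofRealCLM.contDiff.comp hφ)
  let Ψ : SchwartzMap V ℂ := 𝓕⁻ Φ
  have hΨ : ∀ x, 𝓕 (Ψ : V → ℂ) x = φ x := fun x => by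
    have : 𝓕 Ψ = Φ := FourierTransform.fourier_fourierInv_eq Φ
    exact congrArg (fun G : SchwartzMap V ℂ => G x) this
  have hΨ' : ∀ x, Ψ x = 𝓕⁻ (Φ : V → ℂ) x := fun x =>
    congrFun (SchwartzMap.fourierInv_coe Φ) x
  have h1 := VectorFourier.integral_fourierIntegral_smul_eq_flip (μ := volume) (ν := volume)
    (L := innerₗ V) Real.continuous_fourierChar continuous_inner hi Ψ.integrable
  have h2 := VectorFourier.integral_fourierIntegral_smul_eq_flip (μ := volume) (ν := volume)
    (L := -innerₗ V) Real.continuous_fourierChar (by simp; fun_prop) hfi Φ.integrable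
  rw [flip_innerₗ] at h1
  have h3 : (-innerₗ V).flip = -innerₗ V := by
    ext x y
    simp [real_inner_comm]
  rw [h3] at h2
  calc ∫ x, φ x • h x = ∫ x, h x • 𝓕 (Ψ : V → ℂ) x := by
        simp_rw [hΨ, Complex.real_smul, smul_eq_mul, mul_comm]
    _ = ∫ x, 𝓕 h x • Ψ x := h1.symm
    _ = ∫ x, f x • 𝓕⁻ (Φ : V → ℂ) x := by simp_rw [hh, hΨ']
    _ = ∫ x, 𝓕⁻ f x • Φ x := h2.symm
    _ = ∫ x, φ x • 𝓕⁻ f x := by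
        refine integral_congr_ae (Eventually.of_forall fun x => ?_)
        have : Φ x = φ x := rfl
        simp only [this, Complex.real_smul, smul_eq_mul, mul_comm]

end IsFourierL1

namespace IsFourierL1

variable {V : Type*} [NormedAddCommGroup V] [InnerProductSpace ℝ V] [FiniteDimensional ℝ V]
    [MeasurableSpace V] [BorelSpace V] {f g : V → ℂ} {C D : ℝ}

theorem add (hf : IsFourierL1 f C) (hg : IsFourierL1 g D) :
    IsFourierL1 (fun ξ => f ξ + g ξ) (C + D) := by
  obtain ⟨h, hi, hC, hh⟩ := hf
  obtain ⟨k, ki, kC, kk⟩ := hg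
  refine ⟨h + k, hi.add ki, ?_, fun ξ => ?_⟩
  · calc ∫ x, ‖(h + k) x‖ ≤ ∫ x, (‖h x‖ + ‖k x‖) :=
          integral_mono (hi.add ki).norm (hi.norm.add ki.norm) fun x => norm_add_le _ _
      _ ≤ C + D := by
          rw [integral_add hi.norm ki.norm]
          exact add_le_add hC kC
  · simp only
    rw [← hh, ← kk]
    simp only [Real.fourier_eq, Pi.add_apply, smul_add]
    exact integral_add (by simpa using hi) (by simpa using ki)

theorem const_mul (hf : IsFourierL1 f C) {c : ℝ} (hc : 0 ≤ c) :
    IsFourierL1 (fun ξ => (c : ℂ) * f ξ) (c * C) := by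
  obtain ⟨h, hi, hC, hh⟩ := hf
  refine ⟨fun x => (c : ℂ) * h x, hi.const_mul _, ?_, fun ξ => ?_⟩
  · simp_rw [norm_mul, Complex.norm_real, Real.norm_of_nonneg hc]
    rw [integral_const_mul]
    exact mul_le_mul_of_nonneg_left hC hc
  · simp only
    rw [← hh]
    simp only [Real.fourier_eq, Circle.smul_def, smul_eq_mul]
    rw [← integral_const_mul]
    congr 1
    ext x
    ring

end IsFourierL1

/-! ### High frequencies: the symbol away from the origin is Schwartz -/

/-- A smooth function with bounded derivatives that vanishes on `(-∞, 1)`. -/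
structure IsSmoothStep (θ : ℝ → ℝ) : Prop where
  contDiff : ContDiff ℝ (⊤ : ℕ∞) θ
  eq_zero : ∀ s < 1, θ s = 0
  bdd : ∀ j, ∃ C, ∀ s, |iteratedDeriv j θ s| ≤ C

theorem IsSmoothStep.deriv {θ : ℝ → ℝ} (h : IsSmoothStep θ) : IsSmoothStep (deriv θ) where
  contDiff := (contDiff_infty_iff_deriv.1 h.contDiff).2
  eq_zero s hs := by
    have : θ =ᶠ[𝓝 s] fun _ => 0 := by
      filter_upwards [Iio_mem_nhds hs] with x hx using h.eq_zero x hx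
    rw [this.deriv_eq, deriv_const]
  bdd j := by
    obtain ⟨C, hC⟩ := h.bdd (j + 1)
    exact ⟨C, fun s => by rw [← iteratedDeriv_succ']; exact hC s⟩

theorem exists_bound_iteratedDeriv_of_hasCompactSupport {f : ℝ → ℝ} (hf : ContDiff ℝ (⊤ : ℕ∞) f)
    (hc : HasCompactSupport f) (j : ℕ) : ∃ C, ∀ s, |iteratedDeriv j f s| ≤ C := by
  obtain ⟨C, hC⟩ := (hc.toSchwartzMap hf).decay' 0 j
  refine ⟨C, fun s => ?_⟩
  have := hC s
  rw [pow_zero, one_mul, norm_iteratedFDeriv_eq_norm_iteratedDeriv] at this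
  exact this

/-- A smooth transition from `0` on `(-∞, 1]` to `1` on `[2, ∞)`. -/
noncomputable def smoothCutoff (s : ℝ) : ℝ := Real.smoothTransition (s - 1)

theorem contDiff_smoothCutoff : ContDiff ℝ (⊤ : ℕ∞) smoothCutoff :=
  Real.smoothTransition.contDiff.comp (contDiff_id.sub contDiff_const)

theorem smoothCutoff_of_le {s : ℝ} (hs : s ≤ 1) : smoothCutoff s = 0 :=
  Real.smoothTransition.zero_of_nonpos (by linarith)

theorem smoothCutoff_of_ge {s : ℝ} (hs : 2 ≤ s) : smoothCutoff s = 1 :=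
  Real.smoothTransition.one_of_one_le (by linarith)

theorem isSmoothStep_smoothCutoff : IsSmoothStep smoothCutoff where
  contDiff := contDiff_smoothCutoff
  eq_zero s hs := smoothCutoff_of_le hs.le
  bdd j := by
    rcases j with _ | j
    · refine ⟨1, fun s => ?_⟩
      rw [iteratedDeriv_zero, smoothCutoff, abs_of_nonneg (Real.smoothTransition.nonneg _)]
      exact Real.smoothTransition.le_one _
    · rw [iteratedDeriv_succ']
      refine exists_bound_iteratedDeriv_of_hasCompactSupport
        (contDiff_infty_iff_deriv.1 contDiff_smoothCutoff).2
        (HasCompactSupport.intro (isCompact_Icc (a := 1) (b := 2)) fun s hs => ?_) j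
      rw [mem_Icc, not_and_or, not_le, not_le] at hs
      rcases hs with hs | hs
      · have : smoothCutoff =ᶠ[𝓝 s] fun _ => 0 := by
          filter_upwards [Iio_mem_nhds hs] with x hx using smoothCutoff_of_le (le_of_lt hx)
        rw [this.deriv_eq, deriv_const]
      · have : smoothCutoff =ᶠ[𝓝 s] fun _ => 1 := by
          filter_upwards [Ioi_mem_nhds hs] with x hx using smoothCutoff_of_ge (le_of_lt hx)
        rw [this.deriv_eq, deriv_const]

/-- A single term of the exponential series suffices: `exp x ≥ x^M / M!` at `x = s^α`, with `M ≥
β/α`. -/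
theorem exists_rpow_le_mul_exp {α : ℝ} (hα : 0 < α) (β : ℝ) :
    ∃ C, 0 ≤ C ∧ ∀ s : ℝ, 1 ≤ s → s ^ β * Real.exp (-s ^ α) ≤ C := by
  obtain ⟨M, hM⟩ := exists_nat_ge (β / α)
  refine ⟨M.factorial, by positivity, fun s hs => ?_⟩
  have h1 : s ^ β ≤ (s ^ α) ^ M := by
    rw [← Real.rpow_natCast, ← Real.rpow_mul (by linarith)]
    refine Real.rpow_le_rpow_of_exponent_le hs ?_
    rwa [div_le_iff₀ hα, mul_comm] at hM
  have h2 := Real.pow_div_factorial_le_exp (s ^ α) (by positivity) M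
  rw [div_le_iff₀ (by positivity)] at h2
  rw [Real.exp_neg, ← div_eq_mul_inv, div_le_iff₀ (Real.exp_pos _), mul_comm]
  linarith

section
variable {α : ℝ} {θ : ℝ → ℝ}

theorem IsSmoothStep.contDiff_mul_rpow_mul_exp (h : IsSmoothStep θ) (α γ : ℝ) :
    ContDiff ℝ (⊤ : ℕ∞) fun s : ℝ => θ s * (s ^ γ * Real.exp (-s ^ α)) := by
  rw [contDiff_iff_contDiffAt]
  intro s
  rcases lt_or_ge s 1 with hs | hs
  · refine (contDiffAt_const (c := (0 : ℝ))).congr_of_eventuallyEq ?_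
    filter_upwards [Iio_mem_nhds hs] with x hx
    rw [h.eq_zero x hx, zero_mul]
  · have h0 : s ≠ 0 := by linarith
    exact h.contDiff.contDiffAt.mul ((Real.contDiffAt_rpow_const_of_ne h0).mul
      (Real.contDiffAt_rpow_const_of_ne h0).neg.exp)

theorem IsSmoothStep.deriv_mul_rpow_mul_exp (h : IsSmoothStep θ) (α γ : ℝ) :
    _root_.deriv (fun s : ℝ => θ s * (s ^ γ * Real.exp (-s ^ α))) = fun s =>
      _root_.deriv θ s * (s ^ γ * Real.exp (-s ^ α)) +
        (γ * (θ s * (s ^ (γ - 1) * Real.exp (-s ^ α))) -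
        α * (θ s * (s ^ (γ + (α - 1)) * Real.exp (-s ^ α)))) := by
  ext s
  rcases lt_or_ge s 1 with hs | hs
  · have : (fun s : ℝ => θ s * (s ^ γ * Real.exp (-s ^ α))) =ᶠ[𝓝 s] fun _ => 0 := by
      filter_upwards [Iio_mem_nhds hs] with x hx
      rw [h.eq_zero x hx, zero_mul]
    rw [this.deriv_eq, deriv_const, h.eq_zero s hs, h.deriv.eq_zero s hs]
    ring
  · have h0 : 0 < s := by linarith
    have h1 := (h.contDiff.differentiable (by simp)).differentiableAt (x := s) |>.hasDerivAt
    have h2 := h1.mul ((Real.hasDerivAt_rpow_const (p := γ) (Or.inl h0.ne')).mul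
      (Real.hasDerivAt_rpow_const (p := α) (Or.inl h0.ne')).neg.exp)
    refine h2.deriv.trans ?_
    simp only [Pi.neg_apply, Pi.mul_apply]
    rw [Real.rpow_add h0]
    ring

/-- The derivative of `θ s^γ exp(-s^α)` is a combination of three functions of the same shape, with
`θ'` for `θ` or with shifted `γ`. Hence the induction on `k` is for all `γ` and `θ` at once. -/
theorem IsSmoothStep.exists_decay (hα : 0 < α) (N k : ℕ) :
    ∀ (γ : ℝ) (θ : ℝ → ℝ), IsSmoothStep θ → ∃ C, ∀ s : ℝ, |s| ^ N *
      |iteratedDeriv k (fun s : ℝ => θ s * (s ^ γ * Real.exp (-s ^ α))) s| ≤ C := by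
  induction k with
  | zero =>
    intro γ θ h
    obtain ⟨C, hC0, hC⟩ := exists_rpow_le_mul_exp hα (N + γ)
    obtain ⟨D, hD⟩ := h.bdd 0
    refine ⟨D * C, fun s => ?_⟩
    have hD0 : 0 ≤ D := (abs_nonneg _).trans (hD 0)
    rw [iteratedDeriv_zero]
    rcases lt_or_ge s 1 with hs | hs
    · simp [h.eq_zero s hs]; positivity
    · have h0 : 0 < s := by linarith
      have := hC s hs
      rw [Real.rpow_add h0, Real.rpow_natCast] at this
      have hD' := hD s
      rw [iteratedDeriv_zero] at hD'
      rw [abs_mul, abs_of_pos h0, abs_of_pos (by positivity : 0 < s ^ γ * Real.exp (-s ^ α))]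
      calc s ^ N * (|θ s| * (s ^ γ * Real.exp (-s ^ α)))
          = |θ s| * (s ^ N * s ^ γ * Real.exp (-s ^ α)) := by ring
        _ ≤ D * C := mul_le_mul hD' this (by positivity) hD0
  | succ k ih =>
    intro γ θ h
    obtain ⟨C₁, h₁⟩ := ih γ _ h.deriv
    obtain ⟨C₂, h₂⟩ := ih (γ - 1) _ h
    obtain ⟨C₃, h₃⟩ := ih (γ + (α - 1)) _ h
    refine ⟨C₁ + (|γ| * C₂ + |α| * C₃), fun s => ?_⟩
    have c1 := (h.deriv.contDiff_mul_rpow_mul_exp α γ).contDiffAt (x := s)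
    have c2 := (h.contDiff_mul_rpow_mul_exp α (γ - 1)).contDiffAt (x := s)
    have c3 := (h.contDiff_mul_rpow_mul_exp α (γ + (α - 1))).contDiffAt (x := s)
    have hk : ((k : ℕ∞) : WithTop ℕ∞) ≤ ((⊤ : ℕ∞) : WithTop ℕ∞) := by exact_mod_cast le_top
    have d2 := (contDiffAt_const (c := γ)).mul (c2.of_le hk)
    have d3 := (contDiffAt_const (c := α)).mul (c3.of_le hk)
    rw [iteratedDeriv_succ', h.deriv_mul_rpow_mul_exp,
      iteratedDeriv_fun_add (c1.of_le hk) (d2.sub d3), iteratedDeriv_fun_sub d2 d3,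
      iteratedDeriv_const_mul_field, iteratedDeriv_const_mul_field]
    refine (mul_le_mul_of_nonneg_left ((abs_add_le _ _).trans
      (add_le_add_right (abs_sub _ _) _)) (by positivity)).trans ?_
    rw [abs_mul, abs_mul]
    have e2 := mul_le_mul_of_nonneg_left (h₂ s) (abs_nonneg γ)
    have e3 := mul_le_mul_of_nonneg_left (h₃ s) (abs_nonneg α)
    linarith [h₁ s]

theorem exists_schwartz_smoothCutoff_mul_exp (hα : 0 < α) :
    ∃ F : SchwartzMap ℝ ℂ, ∀ s : ℝ, F s = (smoothCutoff s * Real.exp (-s ^ α) : ℝ) := by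
  have h := isSmoothStep_smoothCutoff
  let F : SchwartzMap ℝ ℝ :=
    { toFun := fun s => smoothCutoff s * (s ^ (0 : ℝ) * Real.exp (-s ^ α))
      smooth' := h.contDiff_mul_rpow_mul_exp α 0
      decay' := fun N k => by
        obtain ⟨C, hC⟩ := IsSmoothStep.exists_decay hα N k 0 _ h
        refine ⟨C, fun s => ?_⟩
        rw [norm_iteratedFDeriv_eq_norm_iteratedDeriv]
        exact hC s }
  refine ⟨SchwartzMap.postcompCLM Complex.ofRealCLM F, fun s => ?_⟩
  rw [SchwartzMap.postcompCLM_apply]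
  have : F s = smoothCutoff s * (s ^ (0 : ℝ) * Real.exp (-s ^ α)) := rfl
  rw [this, Real.rpow_zero, one_mul]
  rfl

end

/-! ### Low frequencies: the singularity of the symbol at the origin -/

/-- A smooth even bump, equal to `1` on `[-1, 1]` and to `0` outside `[-2, 2]`. -/
noncomputable def smoothBump (s : ℝ) : ℝ := (1 - smoothCutoff s) * (1 - smoothCutoff (-s))

theorem contDiff_smoothBump : ContDiff ℝ (⊤ : ℕ∞) smoothBump :=
  (contDiff_const.sub contDiff_smoothCutoff).mul
    (contDiff_const.sub (contDiff_smoothCutoff.comp contDiff_neg))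

theorem smoothBump_of_nonneg {s : ℝ} (hs : 0 ≤ s) : smoothBump s = 1 - smoothCutoff s := by
  rw [smoothBump, smoothCutoff_of_le (s := -s) (by linarith), sub_zero, mul_one]

theorem smoothBump_of_abs_le {s : ℝ} (hs : |s| ≤ 1) : smoothBump s = 1 := by
  rw [abs_le] at hs
  rw [smoothBump, smoothCutoff_of_le hs.2, smoothCutoff_of_le (by linarith)]
  norm_num

theorem smoothBump_of_le_abs {s : ℝ} (hs : 2 ≤ |s|) : smoothBump s = 0 := by
  rw [smoothBump]
  rcases le_abs.1 hs with h | h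
  · rw [smoothCutoff_of_ge h, sub_self, zero_mul]
  · rw [smoothCutoff_of_ge h, sub_self, mul_zero]

theorem hasCompactSupport_of_eq_zero {f : ℝ → ℝ} (R : ℝ) (h : ∀ s, R ≤ |s| → f s = 0) :
    HasCompactSupport f :=
  HasCompactSupport.intro (isCompact_Icc (a := -R) (b := R)) fun s hs => h s <| by
    by_contra hc
    exact hs (abs_le.1 (not_le.1 hc).le)

section
variable {V : Type*} [NormedAddCommGroup V] [InnerProductSpace ℝ V] [FiniteDimensional ℝ V]
    [MeasurableSpace V] [BorelSpace V]

/-- Radial multipliers are written in the variable `|ξ|²` since, unlike `|ξ|`, it is smooth at the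
origin; composition with it preserves Schwartz functions. -/
theorem IsFourierL1.of_schwartz_norm_sq (H : SchwartzMap ℝ ℂ) :
    ∃ C, IsFourierL1 (fun ξ : V => H (‖ξ‖ ^ 2)) C := by
  have hg : ∃ (k : ℕ) (C : ℝ), ∀ x : V, ‖x‖ ≤ C * (1 + ‖‖x‖ ^ 2‖) ^ k := by
    refine ⟨1, 1, fun x => ?_⟩
    rw [one_mul, pow_one, Real.norm_of_nonneg (by positivity)]
    nlinarith [sq_nonneg (‖x‖ - 1)]
  obtain ⟨C, hC⟩ := IsFourierL1.of_schwartz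
    (SchwartzMap.compCLM ℂ (Function.hasTemperateGrowth_norm_sq V) hg H)
  exact ⟨C, hC⟩

theorem IsFourierL1.of_smooth_norm_sq {f : ℝ → ℝ} (hf : ContDiff ℝ (⊤ : ℕ∞) f)
    (hc : HasCompactSupport f) : ∃ C, IsFourierL1 (fun ξ : V => (f (‖ξ‖ ^ 2) : ℂ)) C := by
  have hc' : HasCompactSupport (fun x => (f x : ℂ)) := hc.comp_left (g := Complex.ofReal) rfl
  exact IsFourierL1.of_schwartz_norm_sq
    (hc'.toSchwartzMap (Complex.ofRealCLM.contDiff.comp hf))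

/-- The difference of the two bumps vanishes for `|s| < 1`, which removes the singularity of `s^α`.
-/
theorem contDiff_rpow_mul_smoothBump_sub (α : ℝ) :
    ContDiff ℝ (⊤ : ℕ∞) fun s : ℝ => s ^ α * (smoothBump (s / 2) - smoothBump s) := by
  rw [contDiff_iff_contDiffAt]
  intro s
  by_cases h0 : s = 0
  · refine (contDiffAt_const (c := (0 : ℝ))).congr_of_eventuallyEq ?_
    have : Metric.ball (0 : ℝ) 1 ∈ 𝓝 s := by
      rw [h0]
      exact Metric.ball_mem_nhds _ one_pos
    filter_upwards [this] with x hx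
    rw [mem_ball_zero_iff, Real.norm_eq_abs] at hx
    rw [smoothBump_of_abs_le hx.le, smoothBump_of_abs_le, sub_self, mul_zero]
    rw [abs_div, abs_two]
    linarith
  · exact (Real.contDiffAt_rpow_const_of_ne h0).mul
      ((contDiff_smoothBump.comp (contDiff_id.div_const 2)).contDiffAt.sub
        contDiff_smoothBump.contDiffAt)

/-- With `χ = smoothBump` and the smooth annular piece `g(ξ) = |ξ|^{2α} (χ(|ξ|²/2) - χ(|ξ|²))`,
homogeneity makes `∑ 2^{-αj} g(2^{j/2} ξ)` telescope to `|ξ|^{2α} χ(|ξ|²/2)`. All dilates have the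
same bound, so `∑ 2^{-αj}` gives convergence. -/
theorem exists_isFourierL1_rpow_mul_smoothBump {α : ℝ} (hα : 0 < α) :
    ∃ C, IsFourierL1 (fun ξ : V => (((‖ξ‖ ^ 2) ^ α * smoothBump (‖ξ‖ ^ 2 / 2) : ℝ) : ℂ)) C := by
  obtain ⟨C, hC⟩ := IsFourierL1.of_smooth_norm_sq (V := V) (contDiff_rpow_mul_smoothBump_sub α)
    (hasCompactSupport_of_eq_zero 4 fun s hs => by
      rw [smoothBump_of_le_abs (s := s) (by linarith), smoothBump_of_le_abs (s := s / 2)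
        (by rw [abs_div, abs_two]; linarith), sub_self, mul_zero])
  have hρ0 : (0 : ℝ) < 2 ^ (-α) := by positivity
  have hρ1 : (2 : ℝ) ^ (-α) < 1 := Real.rpow_lt_one_of_one_lt_of_neg one_lt_two (by linarith)
  refine ⟨_, IsFourierL1.hasSum (fun j : ℕ =>
    (hC.comp_smul (c := √2 ^ j) (by positivity)).const_mul (c := (2 ^ (-α)) ^ j) (by positivity))
    ((hasSum_geometric_of_lt_one hρ0.le hρ1).mul_right C) fun ξ => ?_⟩
  have hterm : ∀ j : ℕ, (((2 : ℝ) ^ (-α)) ^ j) * ((‖√2 ^ j • ξ‖ ^ 2) ^ α *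
      (smoothBump (‖√2 ^ j • ξ‖ ^ 2 / 2) - smoothBump (‖√2 ^ j • ξ‖ ^ 2))) =
      (‖ξ‖ ^ 2) ^ α * (smoothBump (2 ^ j * (‖ξ‖ ^ 2 / 2)) -
        smoothBump (2 ^ (j + 1) * (‖ξ‖ ^ 2 / 2))) := fun j => by
    have e1 : ‖√2 ^ j • ξ‖ ^ 2 = 2 ^ j * ‖ξ‖ ^ 2 := by
      rw [norm_smul, mul_pow, Real.norm_of_nonneg (by positivity), ← pow_mul, mul_comm j,
        pow_mul, Real.sq_sqrt (by norm_num)]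
    have e2 : ((2 : ℝ) ^ (-α)) ^ j * (2 ^ j) ^ α = 1 := by
      rw [← Real.rpow_natCast, ← Real.rpow_natCast, ← Real.rpow_mul (by norm_num),
        ← Real.rpow_mul (by norm_num), ← Real.rpow_add (by norm_num)]
      rw [show -α * j + j * α = 0 by ring, Real.rpow_zero]
    rw [e1, Real.mul_rpow (by positivity) (by positivity), mul_div_assoc]
    rw [show (2 : ℝ) ^ (j + 1) * (‖ξ‖ ^ 2 / 2) = 2 ^ j * ‖ξ‖ ^ 2 by ring]
    linear_combination (‖ξ‖ ^ 2) ^ α * (smoothBump (2 ^ j * (‖ξ‖ ^ 2 / 2)) -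
        smoothBump (2 ^ j * ‖ξ‖ ^ 2)) * e2
  have hsum : HasSum (fun j : ℕ => (‖ξ‖ ^ 2) ^ α * (smoothBump (2 ^ j * (‖ξ‖ ^ 2 / 2)) -
        smoothBump (2 ^ (j + 1) * (‖ξ‖ ^ 2 / 2)))) ((‖ξ‖ ^ 2) ^ α * smoothBump (‖ξ‖ ^ 2 / 2)) := by
    rcases eq_or_ne (‖ξ‖ ^ 2) 0 with h0 | h0
    · simp [h0, Real.zero_rpow hα.ne', hasSum_zero]
    have hpos : 0 < ‖ξ‖ ^ 2 / 2 := by positivity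
    obtain ⟨J, hJ⟩ := pow_unbounded_of_one_lt (2 / (‖ξ‖ ^ 2 / 2)) one_lt_two
    rw [div_lt_iff₀ hpos] at hJ
    have hz : ∀ j, J ≤ j → smoothBump (2 ^ j * (‖ξ‖ ^ 2 / 2)) = 0 := fun j hj =>
      smoothBump_of_le_abs <| by
        rw [abs_of_pos (by positivity)]
        refine hJ.le.trans (mul_le_mul_of_nonneg_right ?_ hpos.le)
        exact pow_le_pow_right₀ one_le_two hj
    have h1 : ∑ j ∈ Finset.range J, ((‖ξ‖ ^ 2) ^ α * (smoothBump (2 ^ j * (‖ξ‖ ^ 2 / 2)) -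
        smoothBump (2 ^ (j + 1) * (‖ξ‖ ^ 2 / 2)))) =
        (‖ξ‖ ^ 2) ^ α * smoothBump (‖ξ‖ ^ 2 / 2) := by
      rw [← Finset.mul_sum, Finset.sum_range_sub', hz J le_rfl, pow_zero, one_mul, sub_zero]
    rw [← h1]
    refine hasSum_sum_of_ne_finset_zero fun j hj => ?_
    rw [Finset.mem_range, not_lt] at hj
    rw [hz j hj, hz (j + 1) (by omega), sub_self, mul_zero]
  simp_rw [← hterm] at hsum
  exact_mod_cast Complex.hasSum_ofReal.2 hsum

/-- With `a = |ξ|^{2α} χ(|ξ|²/2)`, which equals `|ξ|^{2α}` on the support of `χ(|ξ|²)`, the function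
is `∑ χ (-a)^k / k!`, with bounds `D C^k / k!`. The factor `χ` is kept in every term because the
constant `1` of the bare exponential series does not come from `L¹`. -/
theorem exists_isFourierL1_smoothBump_mul_exp {α : ℝ} (hα : 0 < α) :
    ∃ C, IsFourierL1
      (fun ξ : V => ((smoothBump (‖ξ‖ ^ 2) * Real.exp (-(‖ξ‖ ^ 2) ^ α) : ℝ) : ℂ)) C := by
  obtain ⟨C, hC⟩ := exists_isFourierL1_rpow_mul_smoothBump (V := V) hα
  obtain ⟨D, hD⟩ := IsFourierL1.of_smooth_norm_sq (V := V) contDiff_smoothBump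
    (hasCompactSupport_of_eq_zero 2 fun s hs => smoothBump_of_le_abs hs)
  set a : V → ℝ := fun ξ => (‖ξ‖ ^ 2) ^ α * smoothBump (‖ξ‖ ^ 2 / 2) with ha
  have hna : IsFourierL1 (fun ξ => -(a ξ : ℂ)) C := by
    obtain ⟨h, hi, h1, h2⟩ := hC
    refine ⟨fun x => -h x, hi.neg, by simpa using h1, fun ξ => ?_⟩
    have h3 : 𝓕 h ξ = (a ξ : ℂ) := h2 ξ
    simp only
    rw [← h3, Real.fourier_eq, Real.fourier_eq]
    simp_rw [smul_neg]
    exact integral_neg _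
  have hk : ∀ k : ℕ, IsFourierL1 (fun ξ => (smoothBump (‖ξ‖ ^ 2) : ℂ) * (-(a ξ : ℂ)) ^ k)
      (D * C ^ k) := by
    intro k
    induction k with
    | zero => simpa using hD
    | succ k ih =>
      rw [pow_succ, ← mul_assoc]
      exact (ih.mul hna).congr fun ξ => by ring
  have hk' := fun k : ℕ => (hk k).const_mul (c := ((k.factorial : ℝ))⁻¹) (by positivity)
  refine ⟨_, (IsFourierL1.hasSum hk' (S := D * Real.exp C) ?_
    (f := fun ξ => (smoothBump (‖ξ‖ ^ 2) : ℂ) * Complex.exp (-(a ξ : ℂ))) fun ξ => ?_).congr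
    fun ξ => ?_⟩
  · have := (NormedSpace.expSeries_div_hasSum_exp C).mul_left D
    rw [← Real.exp_eq_exp_ℝ] at this
    refine this.congr_fun fun k => ?_
    ring
  · have := (NormedSpace.expSeries_div_hasSum_exp (-(a ξ : ℂ))).mul_left
      (smoothBump (‖ξ‖ ^ 2) : ℂ)
    rw [← Complex.exp_eq_exp_ℂ] at this
    refine this.congr_fun fun k => ?_
    push_cast
    ring
  · have key : smoothBump (‖ξ‖ ^ 2) * Real.exp (-a ξ) =
        smoothBump (‖ξ‖ ^ 2) * Real.exp (-(‖ξ‖ ^ 2) ^ α) := by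
      rcases le_or_gt 2 |‖ξ‖ ^ 2| with h | h
      · rw [smoothBump_of_le_abs h, zero_mul, zero_mul]
      · simp only [ha]
        rw [smoothBump_of_abs_le (s := ‖ξ‖ ^ 2 / 2), mul_one]
        rw [abs_div, abs_two]
        linarith
    rw [← key]
    push_cast
    rfl

/-- The function `exp (-|ξ|^{2α})` is the Fourier transform of an integrable function. -/
theorem exists_isFourierL1_exp {α : ℝ} (hα : 0 < α) :
    ∃ C, IsFourierL1 (fun ξ : V => ((Real.exp (-‖ξ‖ ^ (2 * α)) : ℝ) : ℂ)) C := by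
  obtain ⟨C, hC⟩ := exists_isFourierL1_smoothBump_mul_exp (V := V) hα
  obtain ⟨F, hF⟩ := exists_schwartz_smoothCutoff_mul_exp hα
  obtain ⟨D, hD⟩ := IsFourierL1.of_schwartz_norm_sq (V := V) F
  refine ⟨_, (hC.add hD).congr fun ξ => ?_⟩
  rw [hF, smoothBump_of_nonneg (by positivity), ← Complex.ofReal_add, Real.rpow_mul (norm_nonneg ξ),
    Real.rpow_two]
  congr 1
  ring

end

/-! ### The fractional heat kernel: integrability, scaling, convolution -/

section
variable {n : ℕ} {α t : ℝ}

theorem integrable_exp_neg_norm_rpow {α : ℝ} (hα : 0 < α) :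
    Integrable fun ξ : EuclideanSpace ℝ (Fin n) => Real.exp (-‖ξ‖ ^ (2 * α)) := by
  obtain ⟨C, hC0, hC⟩ := exists_rpow_le_mul_exp (α := 2 * α) (by positivity) (n + 1 : ℝ)
  have h2α : 0 < 2 * α := by positivity
  have hcont : Continuous fun ξ : EuclideanSpace ℝ (Fin n) => Real.exp (-‖ξ‖ ^ (2 * α)) :=
    Real.continuous_exp.comp ((continuous_norm.rpow_const fun _ => Or.inr h2α.le).neg)
  have h1 : Integrable fun ξ : EuclideanSpace ℝ (Fin n) => (1 + ‖ξ‖) ^ (-(n + 1 : ℝ)) :=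
    integrable_one_add_norm (by simp)
  refine (h1.const_mul (2 ^ (n + 1 : ℝ) * (1 + C))).mono' hcont.aestronglyMeasurable
    (Eventually.of_forall fun ξ => ?_)
  rw [Real.norm_of_nonneg (Real.exp_pos _).le, Real.rpow_neg (by positivity), ← div_eq_mul_inv,
    le_div_iff₀ (by positivity)]
  have hn : (0 : ℝ) ≤ n + 1 := by positivity
  rcases le_or_gt 1 ‖ξ‖ with h | h
  · calc Real.exp (-‖ξ‖ ^ (2 * α)) * (1 + ‖ξ‖) ^ (n + 1 : ℝ)
        ≤ Real.exp (-‖ξ‖ ^ (2 * α)) * (2 * ‖ξ‖) ^ (n + 1 : ℝ) := by gcongr; linarith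
      _ = 2 ^ (n + 1 : ℝ) * (‖ξ‖ ^ (n + 1 : ℝ) * Real.exp (-‖ξ‖ ^ (2 * α))) := by
          rw [Real.mul_rpow (by norm_num) (by positivity)]; ring
      _ ≤ _ := by gcongr; linarith [hC ‖ξ‖ h]
  · calc Real.exp (-‖ξ‖ ^ (2 * α)) * (1 + ‖ξ‖) ^ (n + 1 : ℝ)
        ≤ 1 * 2 ^ (n + 1 : ℝ) := by
          gcongr
          · exact Real.exp_le_one_iff.2 (by simp; positivity)
          · linarith
      _ ≤ _ := by nlinarith [Real.rpow_pos_of_pos two_pos (n + 1 : ℝ)]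

/-- Homogeneity absorbs both `t` and the factor `2π` into one dilation, so the multiplier at unit
scale serves all positive times. -/
theorem fracHeatSymbol_eq (hα : 0 < α) (ht : 0 < t) (ξ : EuclideanSpace ℝ (Fin n)) :
    fracHeatSymbol n α t ξ =
      ((Real.exp (-‖(t ^ (1 / (2 * α)) * (2 * Real.pi)) • ξ‖ ^ (2 * α)) : ℝ) : ℂ) := by
  have hp := Real.pi_pos
  rw [fracHeatSymbol, norm_smul, Real.norm_of_nonneg (by positivity),
    mul_assoc (t ^ (1 / (2 * α))), Real.mul_rpow (x := t ^ (1 / (2 * α))) (by positivity) (by positivity), ← Real.rpow_mul ht.le]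
  rw [one_div_mul_cancel (by positivity), Real.rpow_one]

theorem continuous_fracHeatSymbol (hα : 0 < α) (t : ℝ) : Continuous (fracHeatSymbol n α t) := by
  refine Complex.continuous_ofReal.comp (Real.continuous_exp.comp ?_)
  exact (continuous_const.mul ((continuous_const.mul continuous_norm).rpow_const
    fun _ => Or.inr (by positivity))).neg

theorem integrable_fracHeatSymbol (hα : 0 < α) (ht : 0 < t) :
    Integrable (fracHeatSymbol n α t) := by
  have hp := Real.pi_pos
  have := ((integrable_exp_neg_norm_rpow (n := n) hα).comp_smul
    (R := t ^ (1 / (2 * α)) * (2 * Real.pi)) (by positivity)).ofReal (𝕜 := ℂ)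
  exact this.congr (Eventually.of_forall fun ξ => (fracHeatSymbol_eq hα ht ξ).symm)

theorem fracHeatSymbol_add (s t : ℝ) (ξ : EuclideanSpace ℝ (Fin n)) :
    fracHeatSymbol n α (s + t) ξ = fracHeatSymbol n α s ξ * fracHeatSymbol n α t ξ := by
  rw [fracHeatSymbol, fracHeatSymbol, fracHeatSymbol, ← Complex.ofReal_mul, ← Real.exp_add]
  congr 3
  ring

theorem fracHeatSymbol_zero (hα : 0 < α) (t : ℝ) :
    fracHeatSymbol n α t (0 : EuclideanSpace ℝ (Fin n)) = 1 := by
  simp [fracHeatSymbol, Real.zero_rpow (by positivity : 2 * α ≠ 0)]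

theorem integrable_fourierInv_fracHeatSymbol (hα : 0 < α) (ht : 0 < t) :
    Integrable (𝓕⁻ (fracHeatSymbol n α t)) := by
  have hp := Real.pi_pos
  obtain ⟨C, hC⟩ := exists_isFourierL1_exp (V := EuclideanSpace ℝ (Fin n)) hα
  refine IsFourierL1.integrable_fourierInv
    ((hC.comp_smul (c := t ^ (1 / (2 * α)) * (2 * Real.pi)) (by positivity)).congr fun ξ => ?_)
    (integrable_fracHeatSymbol hα ht)
  exact (fracHeatSymbol_eq hα ht ξ).symm

theorem integrable_fracHeatKernel (hα : 0 < α) (ht : 0 < t) :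
    Integrable (fracHeatKernel n α t) :=
  (integrable_fourierInv_fracHeatSymbol hα ht).re

theorem continuous_fourierInv_fracHeatSymbol (hα : 0 < α) (ht : 0 < t) :
    Continuous (𝓕⁻ (fracHeatSymbol n α t)) :=
  VectorFourier.fourierIntegral_continuous Real.continuous_fourierChar
    (by simp; fun_prop) (integrable_fracHeatSymbol hα ht)

theorem continuous_fracHeatKernel (hα : 0 < α) (ht : 0 < t) :
    Continuous (fracHeatKernel n α t) :=
  Complex.continuous_re.comp (continuous_fourierInv_fracHeatSymbol hα ht)

theorem exists_abs_fracHeatKernel_le (n : ℕ) (α t : ℝ) :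
    ∃ M, ∀ x, |fracHeatKernel n α t x| ≤ M := by
  refine ⟨∫ ξ, ‖fracHeatSymbol n α t ξ‖, fun x => ?_⟩
  refine (Complex.abs_re_le_norm _).trans ?_
  exact VectorFourier.norm_fourierIntegral_le_integral_norm _ _ _ _ _

theorem fourier_fracHeatKernel (hα : 0 < α) (ht : 0 < t) :
    𝓕 (fun x => (fracHeatKernel n α t x : ℂ)) = fracHeatSymbol n α t := by
  have h : (fun x => (fracHeatKernel n α t x : ℂ)) = 𝓕⁻ (fracHeatSymbol n α t) :=
    funext fun x => ofReal_fracHeatKernel n α t x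
  rw [h]
  refine (continuous_fracHeatSymbol hα t).fourier_fourierInv_eq
    (integrable_fracHeatSymbol hα ht) ?_
  have := (integrable_fourierInv_fracHeatSymbol (n := n) hα ht).comp_neg
  refine this.congr (Eventually.of_forall fun x => ?_)
  simp only
  rw [Real.fourierInv_eq_fourier_neg, neg_neg]

theorem integral_fracHeatKernel (hα : 0 < α) (ht : 0 < t) :
    ∫ x, fracHeatKernel n α t x = 1 := by
  have := congrFun (fourier_fracHeatKernel (n := n) hα ht) 0
  rw [fracHeatSymbol_zero hα, Real.fourier_eq] at this
  simp only [inner_zero_right, neg_zero, AddChar.map_zero_eq_one, one_smul] at this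
  rw [integral_complex_ofReal] at this
  exact_mod_cast this

/-- A change of variables in the inverse transform. The powers of `t` in the smoothing estimates
come from here. -/
theorem fracHeatKernel_scaling (hα : 0 < α) (ht : 0 < t) (x : EuclideanSpace ℝ (Fin n)) :
    fracHeatKernel n α t x = ((t ^ (1 / (2 * α))) ^ n)⁻¹ *
      fracHeatKernel n α 1 ((t ^ (1 / (2 * α)))⁻¹ • x) := by
  set c := t ^ (1 / (2 * α)) with hc
  have hc0 : 0 < c := by positivity
  have hs : ∀ ξ, fracHeatSymbol n α t ξ = fracHeatSymbol n α 1 (c • ξ) := fun ξ => by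
    rw [fracHeatSymbol_eq hα ht, fracHeatSymbol_eq hα one_pos, Real.one_rpow, one_mul, smul_smul,
      mul_comm c]
  apply Complex.ofReal_injective
  push_cast
  rw [ofReal_fracHeatKernel, ofReal_fracHeatKernel, Real.fourierInv_eq, Real.fourierInv_eq]
  have := Measure.integral_comp_smul volume (fun ξ : EuclideanSpace ℝ (Fin n) =>
    Real.fourierChar (inner ℝ ξ (c⁻¹ • x)) • fracHeatSymbol n α 1 ξ) c
  rw [finrank_euclideanSpace_fin, abs_of_pos (by positivity), Complex.real_smul] at this
  push_cast at this
  rw [← this]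
  refine integral_congr_ae (Eventually.of_forall fun ξ => ?_)
  simp only
  rw [hs, inner_smul_left, inner_smul_right]
  simp [← mul_assoc, mul_inv_cancel₀ hc0.ne']

/-- Both sides have the symbol at time `s + t` as Fourier transform. Fourier inversion holds at
every point because the convolution is continuous. -/
theorem integral_fracHeatKernel_mul (hα : 0 < α) {s t : ℝ} (hs : 0 < s) (ht : 0 < t)
    (x : EuclideanSpace ℝ (Fin n)) :
    ∫ y, fracHeatKernel n α s y * fracHeatKernel n α t (x - y) = fracHeatKernel n α (s + t) x := by
  have hKs : Integrable fun x => (fracHeatKernel n α s x : ℂ) :=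
    (integrable_fracHeatKernel hα hs).ofReal
  have hKt : Integrable fun x => (fracHeatKernel n α t x : ℂ) :=
    (integrable_fracHeatKernel hα ht).ofReal
  set u := convolution (fun x => (fracHeatKernel n α s x : ℂ))
    (fun x => (fracHeatKernel n α t x : ℂ)) (ContinuousLinearMap.mul ℂ ℂ) volume with hu
  have h1 : 𝓕 u = fracHeatSymbol n α (s + t) := by
    ext ξ
    rw [hu, Real.fourier_mul_convolution_eq hKs hKt, fourier_fracHeatKernel hα hs,
      fourier_fracHeatKernel hα ht, fracHeatSymbol_add]
  have hcont : Continuous u := by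
    obtain ⟨M, hM⟩ := exists_abs_fracHeatKernel_le n α t
    refine BddAbove.continuous_convolution_right_of_integrable _ ?_ hKs
      (Complex.continuous_ofReal.comp (continuous_fracHeatKernel hα ht))
    refine ⟨M, ?_⟩
    rintro _ ⟨x, rfl⟩
    simpa using hM x
  have h2 := hcont.fourierInv_fourier_eq (hKs.integrable_convolution _ hKt)
    (by rw [h1]; exact integrable_fracHeatSymbol hα (add_pos hs ht))
  apply Complex.ofReal_injective
  rw [ofReal_fracHeatKernel, ← h1, h2, hu, convolution, ← integral_complex_ofReal]
  simp

end

/-! ### Interpolation and averaging inequalities -/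

section
variable {X Y F : Type*} [MeasurableSpace X] [MeasurableSpace Y] [NormedAddCommGroup F]
  {μ : Measure X} {ν : Measure Y}

/-- Interpolation of Lebesgue norms. -/
theorem eLpNorm_le_rpow_mul_rpow {f : X → F} (hf : AEStronglyMeasurable f μ) {a b c : ℝ≥0∞}
    {l : ℝ} (hl0 : 0 ≤ l) (hl1 : l ≤ 1)
    (h : c⁻¹ = a⁻¹ * ENNReal.ofReal (1 - l) + b⁻¹ * ENNReal.ofReal l) :
    eLpNorm f c μ ≤ eLpNorm f a μ ^ (1 - l) * eLpNorm f b μ ^ l := by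
  rcases hl0.eq_or_lt with rfl | hl0
  · have : c = a := by simpa using h
    simp [this]
  rcases hl1.eq_or_lt with rfl | hl1
  · have : c = b := by simpa using h
    simp [this]
  have hx0 : ENNReal.ofReal (1 - l) ≠ 0 := by simpa using hl1
  have hy0 : ENNReal.ofReal l ≠ 0 := by simpa using hl0
  have : ENNReal.HolderTriple (a * (ENNReal.ofReal (1 - l))⁻¹) (b * (ENNReal.ofReal l)⁻¹) c := by
    constructor
    rw [h, ENNReal.mul_inv (Or.inr (ENNReal.inv_ne_top.2 hx0))
      (Or.inr (ENNReal.inv_ne_zero.2 ENNReal.ofReal_ne_top)), inv_inv,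
      ENNReal.mul_inv (Or.inr (ENNReal.inv_ne_top.2 hy0))
      (Or.inr (ENNReal.inv_ne_zero.2 ENNReal.ofReal_ne_top)), inv_inv]
  -- Hölder for `|f| = |f|^{1-l} |f|^l` with exponents `a/(1-l)` and `b/l`; the endpoints `l = 0`
  -- and `l = 1`, where one of these degenerates, are already settled.
  have key := eLpNorm_smul_le_mul_eLpNorm (μ := μ) (r := c)
    (p := a * (ENNReal.ofReal (1 - l))⁻¹) (q := b * (ENNReal.ofReal l)⁻¹)
    (f := fun x => ‖f x‖ ^ l) (φ := fun x => ‖f x‖ ^ (1 - l))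
    ((Real.continuous_rpow_const hl0.le).comp_aestronglyMeasurable hf.norm)
    ((Real.continuous_rpow_const (by linarith)).comp_aestronglyMeasurable hf.norm)
  rw [eLpNorm_norm_rpow f (by linarith), eLpNorm_norm_rpow f hl0, mul_assoc, mul_assoc,
    ENNReal.inv_mul_cancel hx0 (by simp), ENNReal.inv_mul_cancel hy0 (by simp), mul_one,
    mul_one] at key
  refine le_trans (le_of_eq ?_) key
  refine eLpNorm_congr_norm_ae (Eventually.of_forall fun x => ?_)
  simp only [Pi.smul_apply', smul_eq_mul]
  rw [← Real.rpow_add_of_nonneg (norm_nonneg _) (by linarith) hl0.le, sub_add_cancel,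
    Real.rpow_one, norm_norm]

/-- Jensen's inequality for the weight `k`. -/
theorem lintegral_mul_rpow_le {k H : Y → ℝ≥0∞} (hk : AEMeasurable k ν) (hH : AEMeasurable H ν)
    {m : ℝ} (hm : 1 ≤ m) :
    (∫⁻ y, k y * H y ∂ν) ^ m ≤ (∫⁻ y, k y ∂ν) ^ (m - 1) * ∫⁻ y, k y * H y ^ m ∂ν := by
  have hm0 : 0 < m := by linarith
  have h1 : 0 ≤ 1 - 1 / m := by
    rw [sub_nonneg, div_le_one hm0]
    exact hm
  -- Hölder applied to the splitting `k H = k^{1-1/m} (k H^m)^{1/m}`.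
  have key := ENNReal.lintegral_mul_norm_pow_le hk (hk.mul (hH.pow_const m)) h1
    (one_div_nonneg.2 hm0.le) (by ring)
  have e : ∀ y, k y ^ (1 - 1 / m) * (k y * H y ^ m) ^ (1 / m) = k y * H y := fun y => by
    rw [ENNReal.mul_rpow_of_nonneg _ _ (by positivity), ← mul_assoc,
      ← ENNReal.rpow_add_of_nonneg _ _ h1 (by positivity), ← ENNReal.rpow_mul,
      mul_one_div_cancel hm0.ne', sub_add_cancel, ENNReal.rpow_one, ENNReal.rpow_one]
  simp only [Pi.mul_apply, e] at key
  calc (∫⁻ y, k y * H y ∂ν) ^ m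
      ≤ ((∫⁻ y, k y ∂ν) ^ (1 - 1 / m) * (∫⁻ y, k y * H y ^ m ∂ν) ^ (1 / m)) ^ m := by
        gcongr
    _ = _ := by
        rw [ENNReal.mul_rpow_of_nonneg _ _ hm0.le, ← ENNReal.rpow_mul, ← ENNReal.rpow_mul,
          one_div_mul_cancel hm0.ne', ENNReal.rpow_one]
        congr 2
        field_simp

/-- An `L^m` bound for an average `∫ k(y) F(x, y) dy`. -/
theorem lintegral_enorm_integral_smul_rpow_le [SFinite μ] [SFinite ν] [NormedSpace ℝ F]
    {k : Y → ℝ} (hk : Measurable k) {H : X → Y → F} (hH : StronglyMeasurable (Function.uncurry H))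
    {m : ℝ} (hm : 1 ≤ m) :
    ∫⁻ x, ‖∫ y, k y • H x y ∂ν‖ₑ ^ m ∂μ ≤
      (∫⁻ y, ‖k y‖ₑ ∂ν) ^ (m - 1) * ∫⁻ y, ‖k y‖ₑ * ∫⁻ x, ‖H x y‖ₑ ^ m ∂μ ∂ν := by
  have hmeas : Measurable fun z : X × Y => ‖H z.1 z.2‖ₑ := hH.enorm
  calc ∫⁻ x, ‖∫ y, k y • H x y ∂ν‖ₑ ^ m ∂μ
      ≤ ∫⁻ x, (∫⁻ y, ‖k y‖ₑ * ‖H x y‖ₑ ∂ν) ^ m ∂μ := by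
        refine lintegral_mono fun x => ?_
        refine ENNReal.rpow_le_rpow ((enorm_integral_le_lintegral_enorm _).trans ?_) (by linarith)
        simp_rw [enorm_smul]
        exact le_rfl
    _ ≤ ∫⁻ x, (∫⁻ y, ‖k y‖ₑ ∂ν) ^ (m - 1) * ∫⁻ y, ‖k y‖ₑ * ‖H x y‖ₑ ^ m ∂ν ∂μ :=
        lintegral_mono fun x => lintegral_mul_rpow_le hk.enorm.aemeasurable
          (hmeas.comp measurable_prodMk_left).aemeasurable hm
    _ = (∫⁻ y, ‖k y‖ₑ ∂ν) ^ (m - 1) * ∫⁻ x, ∫⁻ y, ‖k y‖ₑ * ‖H x y‖ₑ ^ m ∂ν ∂μ := by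
        refine lintegral_const_mul _ (Measurable.lintegral_prod_right' (f := fun z : X × Y =>
          ‖k z.2‖ₑ * ‖H z.1 z.2‖ₑ ^ m) ?_)
        exact (hk.enorm.comp measurable_snd).mul (hmeas.pow_const m)
    _ = _ := by
        rw [lintegral_lintegral_swap]
        · congr 1
          refine lintegral_congr fun y => ?_
          exact lintegral_const_mul _ ((hmeas.comp measurable_prodMk_right).pow_const m)
        · exact ((hk.enorm.comp measurable_snd).mul (hmeas.pow_const m)).aemeasurable

end

/-! ### The semigroup on functions and its smoothing estimates -/

section
variable {𝕜 : Type*} [RCLike 𝕜] {n : ℕ} {α t : ℝ}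

theorem fracHeatSemigroup_of_pos (ht : 0 < t) (f : EuclideanSpace ℝ (Fin n) → 𝕜)
    (x : EuclideanSpace ℝ (Fin n)) :
    fracHeatSemigroup α t f x = ∫ y, fracHeatKernel n α t (x - y) • f y := by
  rw [fracHeatSemigroup, if_pos ht]

theorem fracHeatSemigroup_zero (f : EuclideanSpace ℝ (Fin n) → 𝕜) :
    fracHeatSemigroup α 0 f = f := by
  rw [fracHeatSemigroup, if_neg (lt_irrefl _)]

/-- Scaling presents `S(t) f` as an average of translates of `f` against the fixed kernel `K₁`.
Since `∫ K₁ = 1` this includes `t = 0`, so bounds and continuity need no separate treatment there.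
-/
theorem fracHeatSemigroup_eq_integral_translate (hα : 0 < α) (ht : 0 ≤ t)
    (f : EuclideanSpace ℝ (Fin n) → 𝕜) (x : EuclideanSpace ℝ (Fin n)) :
    fracHeatSemigroup α t f x =
      ∫ y, fracHeatKernel n α 1 y • f (x - t ^ (1 / (2 * α)) • y) := by
  rcases ht.eq_or_lt with rfl | ht
  · rw [fracHeatSemigroup_zero, Real.zero_rpow (by positivity)]
    simp only [zero_smul, sub_zero]
    rw [integral_smul_const, integral_fracHeatKernel hα one_pos, one_smul]
  · rw [fracHeatSemigroup_of_pos ht, ← integral_sub_left_eq_self _ volume x]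
    simp only [sub_sub_cancel]
    have hc : 0 < t ^ (1 / (2 * α)) := by positivity
    have := Measure.integral_comp_smul volume (fun y : EuclideanSpace ℝ (Fin n) =>
      fracHeatKernel n α t y • f (x - y)) (t ^ (1 / (2 * α)))
    rw [finrank_euclideanSpace_fin, abs_of_pos (by positivity),
      eq_inv_smul_iff₀ (by positivity)] at this
    rw [← this, ← integral_smul]
    refine integral_congr_ae (Eventually.of_forall fun y => ?_)
    simp only
    rw [fracHeatKernel_scaling hα ht, smul_smul, ← mul_assoc, mul_inv_cancel₀ (by positivity),
      one_mul, smul_smul, inv_mul_cancel₀ hc.ne', one_smul]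

theorem fracHeatSemigroup_congr (ht : 0 < t) {f g : EuclideanSpace ℝ (Fin n) → 𝕜}
    (h : f =ᵐ[volume] g) : fracHeatSemigroup α t f = fracHeatSemigroup α t g := by
  ext x
  rw [fracHeatSemigroup_of_pos ht, fracHeatSemigroup_of_pos ht]
  refine integral_congr_ae ?_
  filter_upwards [h] with y hy
  rw [hy]

theorem fracHeatSemigroup_congr_ae (ht : 0 ≤ t) {f g : EuclideanSpace ℝ (Fin n) → 𝕜}
    (h : f =ᵐ[volume] g) : fracHeatSemigroup α t f =ᵐ[volume] fracHeatSemigroup α t g := by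
  rcases ht.eq_or_lt with rfl | ht
  · rwa [fracHeatSemigroup_zero, fracHeatSemigroup_zero]
  · rw [fracHeatSemigroup_congr ht h]

theorem measurable_fracHeatKernel (hα : 0 < α) (ht : 0 < t) : Measurable (fracHeatKernel n α t) :=
  (continuous_fracHeatKernel hα ht).measurable

theorem aestronglyMeasurable_fracHeatSemigroup (hα : 0 < α) (ht : 0 ≤ t)
    {f : EuclideanSpace ℝ (Fin n) → 𝕜} (hf : AEStronglyMeasurable f volume) :
    AEStronglyMeasurable (fracHeatSemigroup α t f) volume := by
  refine AEStronglyMeasurable.congr ?_ (fracHeatSemigroup_congr_ae ht hf.ae_eq_mk.symm)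
  have : fracHeatSemigroup α t (hf.mk f) = fun x =>
      ∫ y, fracHeatKernel n α 1 y • hf.mk f (x - t ^ (1 / (2 * α)) • y) :=
    funext fun x => fracHeatSemigroup_eq_integral_translate hα ht _ x
  rw [this]
  refine StronglyMeasurable.aestronglyMeasurable (StronglyMeasurable.integral_prod_right'
    (f := fun z : EuclideanSpace ℝ (Fin n) × EuclideanSpace ℝ (Fin n) =>
      fracHeatKernel n α 1 z.2 • hf.mk f (z.1 - t ^ (1 / (2 * α)) • z.2)) ?_)
  exact ((measurable_fracHeatKernel hα one_pos).comp measurable_snd).stronglyMeasurable.smul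
    (hf.stronglyMeasurable_mk.comp_measurable (by fun_prop))

theorem lintegral_enorm_sub_rpow {m : ℝ} {f : EuclideanSpace ℝ (Fin n) → 𝕜}
    (a : EuclideanSpace ℝ (Fin n)) :
    ∫⁻ x, ‖f (x - a)‖ₑ ^ m = ∫⁻ x, ‖f x‖ₑ ^ m :=
  lintegral_sub_right_eq_self (fun x => ‖f x‖ₑ ^ m) a

/-- Jensen for an average of translates, each with the norm of `f`. The constant is `‖K₁‖₁` and not
`1`, as no positivity of the kernel enters. -/
theorem eLpNorm_fracHeatSemigroup_le_self (hα : 0 < α) (ht : 0 ≤ t) {m : ℝ≥0∞} (hm : 1 ≤ m)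
    (hm' : m ≠ ∞) {f : EuclideanSpace ℝ (Fin n) → 𝕜} (hf : AEStronglyMeasurable f volume) :
    eLpNorm (fracHeatSemigroup α t f) m volume ≤
      ENNReal.ofReal (∫ y, ‖fracHeatKernel n α 1 y‖) * eLpNorm f m volume := by
  have hm0 : m ≠ 0 := (zero_lt_one.trans_le hm).ne'
  have hmr : 1 ≤ m.toReal := by simpa using ENNReal.toReal_mono hm' hm
  have hmr0 : 0 < m.toReal := by linarith
  rw [ofReal_integral_norm_eq_lintegral_enorm (integrable_fracHeatKernel hα one_pos)]
  rw [eLpNorm_congr_ae (fracHeatSemigroup_congr_ae ht hf.ae_eq_mk), eLpNorm_congr_ae hf.ae_eq_mk,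
    eLpNorm_eq_lintegral_rpow_enorm_toReal hm0 hm', eLpNorm_eq_lintegral_rpow_enorm_toReal hm0 hm']
  simp_rw [fracHeatSemigroup_eq_integral_translate hα ht]
  have key := lintegral_enorm_integral_smul_rpow_le (μ := (volume : Measure (EuclideanSpace ℝ (Fin n))))
    (ν := (volume : Measure (EuclideanSpace ℝ (Fin n))))
    (measurable_fracHeatKernel (n := n) hα one_pos)
    (H := fun x y => hf.mk f (x - t ^ (1 / (2 * α)) • y))
    (hf.stronglyMeasurable_mk.comp_measurable (by fun_prop)) hmr
  simp_rw [lintegral_enorm_sub_rpow] at key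
  rw [lintegral_mul_const _ (measurable_fracHeatKernel hα one_pos).enorm, ← mul_assoc] at key
  nth_rewrite 2 [← ENNReal.rpow_one (∫⁻ y, ‖fracHeatKernel n α 1 y‖ₑ)] at key
  rw [← ENNReal.rpow_add_of_nonneg _ _ (by linarith) zero_le_one, sub_add_cancel] at key
  refine (ENNReal.rpow_le_rpow key (one_div_nonneg.2 hmr0.le)).trans (le_of_eq ?_)
  rw [ENNReal.mul_rpow_of_nonneg _ _ (by positivity), ← ENNReal.rpow_mul,
    mul_one_div_cancel hmr0.ne', ENNReal.rpow_one]

theorem eLpNorm_fracHeatKernel_one_le (hα : 0 < α) (ht : 0 < t) :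
    eLpNorm (fracHeatKernel n α t) 1 volume ≤
      ENNReal.ofReal (∫ y, ‖fracHeatKernel n α 1 y‖) := by
  rw [eLpNorm_one_eq_lintegral_enorm,
    ← ofReal_integral_norm_eq_lintegral_enorm (integrable_fracHeatKernel hα ht)]
  refine ENNReal.ofReal_le_ofReal (le_of_eq ?_)
  simp_rw [fracHeatKernel_scaling hα ht, norm_mul]
  rw [integral_const_mul, Measure.integral_comp_smul volume
    (fun y => ‖fracHeatKernel n α 1 y‖), finrank_euclideanSpace_fin,
    Real.norm_of_nonneg (by positivity), abs_of_pos (by positivity), smul_eq_mul, ← mul_assoc,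
    inv_pow, inv_inv, inv_mul_cancel₀ (by positivity), one_mul]

/-- Interpolation of the kernel between `L¹`, where its norm does not depend on `t`, and `L^∞`,
where it is of order `t^{-n/(2α)}`; the exponent conjugate to `m` puts weight `1/m` on `L^∞`. -/
theorem exists_eLpNorm_fracHeatKernel_le (hα : 0 < α) {m m' : ℝ≥0∞} (hm : 1 ≤ m)
    (hmm : m⁻¹ + m'⁻¹ = 1) : ∃ C : ℝ, 0 ≤ C ∧ ∀ t : ℝ, 0 < t →
      eLpNorm (fracHeatKernel n α t) m' volume ≤
        ENNReal.ofReal (C * t ^ (-(n / (2 * α) * m.toReal⁻¹))) := by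
  obtain ⟨M, hM⟩ := exists_abs_fracHeatKernel_le n α 1
  have hM0 : 0 ≤ M := (abs_nonneg _).trans (hM 0)
  set A := ∫ y, ‖fracHeatKernel n α 1 y‖ with hA
  have hA0 : 0 ≤ A := integral_nonneg fun _ => norm_nonneg _
  have hl1 : m.toReal⁻¹ ≤ 1 := by
    rw [← ENNReal.toReal_inv]
    exact ENNReal.toReal_le_of_le_ofReal zero_le_one (by simpa using hm)
  have hl0 : 0 ≤ m.toReal⁻¹ := by positivity
  refine ⟨A ^ (1 - m.toReal⁻¹) * M ^ m.toReal⁻¹, by positivity, fun t ht => ?_⟩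
  have hsup : eLpNorm (fracHeatKernel n α t) ∞ volume ≤
      ENNReal.ofReal (M * t ^ (-(n / (2 * α)))) := by
    rw [eLpNorm_exponent_top]
    refine eLpNormEssSup_le_of_ae_bound (Eventually.of_forall fun x => ?_)
    rw [fracHeatKernel_scaling hα ht, norm_mul, Real.norm_of_nonneg (by positivity), mul_comm M]
    refine mul_le_mul (le_of_eq ?_) (hM _) (norm_nonneg _) (by positivity)
    rw [← Real.rpow_natCast, ← Real.rpow_mul ht.le, ← Real.rpow_neg ht.le]
    congr 2
    field_simp
  have hmfin : m⁻¹ ≠ ∞ := by simpa using (zero_lt_one.trans_le hm).ne'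
  have hinv : m'⁻¹ = (1 : ℝ≥0∞)⁻¹ * ENNReal.ofReal (1 - m.toReal⁻¹) +
      (∞ : ℝ≥0∞)⁻¹ * ENNReal.ofReal m.toReal⁻¹ := by
    rw [ENNReal.inv_top, zero_mul, add_zero, inv_one, one_mul, ENNReal.ofReal_sub _ hl0,
      ENNReal.ofReal_one, ← ENNReal.toReal_inv, ENNReal.ofReal_toReal hmfin, ← hmm]
    exact (ENNReal.add_sub_cancel_left hmfin).symm
  refine (eLpNorm_le_rpow_mul_rpow (continuous_fracHeatKernel hα ht).aestronglyMeasurable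
    hl0 hl1 hinv).trans ?_
  calc _ ≤ ENNReal.ofReal A ^ (1 - m.toReal⁻¹) *
        ENNReal.ofReal (M * t ^ (-(n / (2 * α)))) ^ m.toReal⁻¹ := by
        gcongr
        exact eLpNorm_fracHeatKernel_one_le hα ht
    _ = _ := by
        rw [ENNReal.ofReal_rpow_of_nonneg hA0 (by linarith),
          ENNReal.ofReal_rpow_of_nonneg (by positivity) hl0,
          ← ENNReal.ofReal_mul (by positivity), Real.mul_rpow hM0 (by positivity),
          ← Real.rpow_mul ht.le, ← mul_assoc]
        congr 3
        ring

theorem exists_conjExponent {m : ℝ≥0∞} (hm : 1 ≤ m) : ∃ m' : ℝ≥0∞, m⁻¹ + m'⁻¹ = 1 :=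
  ⟨(1 - m⁻¹)⁻¹, by rw [inv_inv]; exact add_tsub_cancel_of_le (by simpa using hm)⟩

theorem integrable_fracHeatKernel_smul (hα : 0 < α) (ht : 0 < t) {m : ℝ≥0∞} (hm : 1 ≤ m)
    {f : EuclideanSpace ℝ (Fin n) → 𝕜} (hf : MemLp f m volume) (x : EuclideanSpace ℝ (Fin n)) :
    Integrable fun y => fracHeatKernel n α t (x - y) • f y := by
  obtain ⟨m', hmm⟩ := exists_conjExponent hm
  obtain ⟨C, hC0, hC⟩ := exists_eLpNorm_fracHeatKernel_le (n := n) hα hm hmm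
  have : ENNReal.HolderTriple m' m 1 := ⟨by rw [add_comm, hmm, inv_one]⟩
  have hK : MemLp (fracHeatKernel n α t) m' volume :=
    ⟨(continuous_fracHeatKernel hα ht).aestronglyMeasurable, (hC t ht).trans_lt (by simp)⟩
  have hK' := hK.comp_measurePreserving (Measure.measurePreserving_sub_left volume x)
  exact memLp_one_iff_integrable.1 (hf.smul hK')

theorem exists_lintegral_fracHeatKernel_smul_le (n : ℕ) (hα : 0 < α) {m : ℝ≥0∞} (hm : 1 ≤ m) :
    ∃ C : ℝ, 0 ≤ C ∧ ∀ (t : ℝ), 0 < t → ∀ (f : EuclideanSpace ℝ (Fin n) → 𝕜),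
      AEStronglyMeasurable f volume → ∀ x,
      ∫⁻ y, ‖fracHeatKernel n α t (x - y) • f y‖ₑ ≤
        ENNReal.ofReal (C * t ^ (-(n / (2 * α) * m.toReal⁻¹))) * eLpNorm f m volume := by
  obtain ⟨m', hmm⟩ := exists_conjExponent hm
  obtain ⟨C, hC0, hC⟩ := exists_eLpNorm_fracHeatKernel_le (n := n) hα hm hmm
  refine ⟨C, hC0, fun t ht f hf x => ?_⟩
  have : ENNReal.HolderTriple m' m 1 := ⟨by rw [add_comm, hmm, inv_one]⟩
  have hKm := (continuous_fracHeatKernel (n := n) hα ht).aestronglyMeasurable (μ := volume)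
  have hmp := Measure.measurePreserving_sub_left (volume : Measure (EuclideanSpace ℝ (Fin n))) x
  have := eLpNorm_smul_le_mul_eLpNorm (p := m') (q := m) (r := 1) hf
    (hKm.comp_measurePreserving hmp)
  rw [eLpNorm_comp_measurePreserving hKm hmp, eLpNorm_one_eq_lintegral_enorm] at this
  exact this.trans (mul_le_mul_left (hC t ht) _)

/-- The `L^m`-`L^ρ` smoothing estimate of the fractional heat semigroup. -/
theorem exists_eLpNorm_fracHeatSemigroup_le (𝕜 : Type*) [RCLike 𝕜] (n : ℕ) (hα : 0 < α)
    {m ρ : ℝ≥0∞} (hm : 1 ≤ m) (hmρ : m ≤ ρ) (hρ : ρ ≠ ∞) :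
    ∃ C : ℝ, 0 ≤ C ∧ ∀ (t : ℝ), 0 < t → ∀ (f : EuclideanSpace ℝ (Fin n) → 𝕜),
      AEStronglyMeasurable f volume →
      eLpNorm (fracHeatSemigroup α t f) ρ volume ≤
        ENNReal.ofReal (C * t ^ (-(n / (2 * α) * (m.toReal⁻¹ - ρ.toReal⁻¹)))) *
          eLpNorm f m volume := by
  obtain ⟨B, hB0, hB⟩ := exists_lintegral_fracHeatKernel_smul_le (𝕜 := 𝕜) n hα hm
  have hm' : m ≠ ∞ := ne_top_of_le_ne_top hρ hmρ
  set A := ∫ y, ‖fracHeatKernel n α 1 y‖ with hA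
  have hA0 : 0 ≤ A := integral_nonneg fun _ => norm_nonneg _
  have hm0 : 0 < m.toReal := ENNReal.toReal_pos (zero_lt_one.trans_le hm).ne' hm'
  have hmρ' : m.toReal ≤ ρ.toReal := ENNReal.toReal_mono hρ hmρ
  have hρ0 : 0 < ρ.toReal := hm0.trans_le hmρ'
  -- `1/ρ = (1-l)/m`: the output is interpolated between the `L^m` bound, uniform in `t`, and the
  -- `L^∞` bound from Hölder's inequality.
  set l := 1 - m.toReal / ρ.toReal with hl
  have hl0 : 0 ≤ l := by rw [hl, sub_nonneg, div_le_one hρ0]; exact hmρ'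
  have hl1 : 0 ≤ 1 - l := by rw [hl]; simp; positivity
  have hinv : ρ⁻¹ = m⁻¹ * ENNReal.ofReal (1 - l) + (∞ : ℝ≥0∞)⁻¹ * ENNReal.ofReal l := by
    rw [ENNReal.inv_top, zero_mul, add_zero, hl, sub_sub_cancel, ENNReal.ofReal_div_of_pos hρ0,
      ENNReal.ofReal_toReal hm', ENNReal.ofReal_toReal hρ, ← mul_div_assoc,
      ENNReal.inv_mul_cancel (zero_lt_one.trans_le hm).ne' hm', one_div]
  refine ⟨A ^ (1 - l) * B ^ l, by positivity, fun t ht f hf => ?_⟩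
  have hsup : eLpNorm (fracHeatSemigroup α t f) ∞ volume ≤
      ENNReal.ofReal (B * t ^ (-(n / (2 * α) * m.toReal⁻¹))) * eLpNorm f m volume := by
    rw [eLpNorm_exponent_top]
    refine essSup_le_of_ae_le _ (Eventually.of_forall fun x => ?_)
    simp only [fracHeatSemigroup_of_pos ht]
    exact (enorm_integral_le_lintegral_enorm _).trans (hB t ht f hf x)
  refine (eLpNorm_le_rpow_mul_rpow (aestronglyMeasurable_fracHeatSemigroup hα ht.le hf) hl0
    (by linarith) hinv).trans ?_
  calc _ ≤ (ENNReal.ofReal A * eLpNorm f m volume) ^ (1 - l) *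
        (ENNReal.ofReal (B * t ^ (-(n / (2 * α) * m.toReal⁻¹))) * eLpNorm f m volume) ^ l := by
        gcongr
        exact eLpNorm_fracHeatSemigroup_le_self hα ht.le hm hm' hf
    _ = ENNReal.ofReal A ^ (1 - l) * ENNReal.ofReal (B * t ^ (-(n / (2 * α) * m.toReal⁻¹))) ^ l *
        (eLpNorm f m volume ^ (1 - l) * eLpNorm f m volume ^ l) := by
        rw [ENNReal.mul_rpow_of_nonneg _ _ hl1, ENNReal.mul_rpow_of_nonneg _ _ hl0]
        ring
    _ = _ := by
        rw [← ENNReal.rpow_add_of_nonneg _ _ hl1 hl0, sub_add_cancel, ENNReal.rpow_one,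
          ENNReal.ofReal_rpow_of_nonneg hA0 hl1,
          ENNReal.ofReal_rpow_of_nonneg (by positivity) hl0,
          ← ENNReal.ofReal_mul (by positivity), Real.mul_rpow hB0 (by positivity),
          ← Real.rpow_mul ht.le, ← mul_assoc]
        congr 4
        rw [hl]
        field_simp

end

/-! ### Semigroup law, strong continuity, and the semigroup as bounded operators -/

section
variable {𝕜 : Type*} [RCLike 𝕜] {n : ℕ} {α t : ℝ} {m ρ : ℝ≥0∞}

/-- Fubini and the convolution identity of the kernels. Absolute integrability holds because the
inner integral is bounded uniformly in `y` for `f ∈ L^m`. -/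
theorem fracHeatSemigroup_fracHeatSemigroup (hα : 0 < α) {s : ℝ} (hs : 0 < s) (ht : 0 < t)
    (hm : 1 ≤ m) {f : EuclideanSpace ℝ (Fin n) → 𝕜} (hf : MemLp f m volume) :
    fracHeatSemigroup α t (fracHeatSemigroup α s f) = fracHeatSemigroup α (t + s) f := by
  ext x
  rw [fracHeatSemigroup_of_pos ht, fracHeatSemigroup_of_pos (add_pos ht hs)]
  simp_rw [fracHeatSemigroup_of_pos hs, ← integral_smul]
  obtain ⟨C, hC0, hC⟩ := exists_lintegral_fracHeatKernel_smul_le (𝕜 := 𝕜) n hα hm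
  have hKt : Continuous (fracHeatKernel n α t) := continuous_fracHeatKernel hα ht
  have hKs : Continuous (fracHeatKernel n α s) := continuous_fracHeatKernel hα hs
  have hmeas : AEStronglyMeasurable (fun z : EuclideanSpace ℝ (Fin n) × EuclideanSpace ℝ (Fin n) =>
      fracHeatKernel n α t (x - z.1) • fracHeatKernel n α s (z.1 - z.2) • f z.2)
      (volume.prod volume) := by
    refine AEStronglyMeasurable.smul ?_ (AEStronglyMeasurable.smul ?_ hf.1.comp_snd)
    · exact (hKt.comp (by fun_prop)).aestronglyMeasurable
    · exact (hKs.comp (by fun_prop)).aestronglyMeasurable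
  rw [integral_integral_swap]
  · refine integral_congr_ae (Eventually.of_forall fun z => ?_)
    simp only [smul_smul]
    rw [integral_smul_const]
    congr 1
    rw [← integral_fracHeatKernel_mul hα ht hs, ← integral_sub_left_eq_self _ volume x]
    refine integral_congr_ae (Eventually.of_forall fun y => ?_)
    simp only [sub_sub_cancel]
    congr 2
    abel
  · refine ⟨hmeas, ?_⟩
    rw [hasFiniteIntegral_iff_enorm]
    simp only [Function.uncurry]
    rw [lintegral_prod _ hmeas.enorm]
    have hKi := (integrable_fracHeatKernel (n := n) hα ht).comp_sub_left x
    calc ∫⁻ y, ∫⁻ z, ‖fracHeatKernel n α t (x - y) • fracHeatKernel n α s (y - z) • f z‖ₑ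
        ≤ ∫⁻ y, ‖fracHeatKernel n α t (x - y)‖ₑ *
          (ENNReal.ofReal (C * s ^ (-(n / (2 * α) * m.toReal⁻¹))) * eLpNorm f m volume) := by
          refine lintegral_mono fun y => ?_
          simp_rw [enorm_smul (fracHeatKernel n α t (x - y))]
          rw [lintegral_const_mul' _ _ (by simp)]
          exact mul_le_mul_right (hC s hs f hf.1 y) _
      _ < ∞ := by
          rw [lintegral_mul_const' _ _ (by finiteness [hf.2])]
          exact ENNReal.mul_lt_top hKi.2 (by finiteness [hf.2])

theorem integrable_fracHeatKernel_one_smul (hα : 0 < α) (ht : 0 ≤ t) (hm : 1 ≤ m)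
    {f : EuclideanSpace ℝ (Fin n) → 𝕜} (hf : MemLp f m volume) (x : EuclideanSpace ℝ (Fin n)) :
    Integrable fun y => fracHeatKernel n α 1 y • f (x - t ^ (1 / (2 * α)) • y) := by
  rcases ht.eq_or_lt with rfl | ht
  · rw [Real.zero_rpow (by positivity)]
    simp only [zero_smul, sub_zero]
    exact (integrable_fracHeatKernel hα one_pos).smul_const _
  · have hc : 0 < t ^ (1 / (2 * α)) := by positivity
    have h1 := ((integrable_fracHeatKernel_smul hα ht hm hf x).comp_sub_left x).comp_smul hc.ne'
    have h2 := h1.smul ((t ^ (1 / (2 * α))) ^ n)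
    refine h2.congr (Eventually.of_forall fun y => ?_)
    simp only [sub_sub_cancel, Pi.smul_apply]
    rw [fracHeatKernel_scaling hα ht, smul_smul, ← mul_assoc, mul_inv_cancel₀ (by positivity),
      one_mul, smul_smul, inv_mul_cancel₀ hc.ne', one_smul]

theorem tendsto_eLpNorm_translate_sub (hm : 1 ≤ m) (hm' : m ≠ ∞)
    {f : EuclideanSpace ℝ (Fin n) → 𝕜} (hf : MemLp f m volume) (a₀ : EuclideanSpace ℝ (Fin n)) :
    Tendsto (fun a => eLpNorm (fun x => f (x - a) - f (x - a₀)) m volume) (𝓝 a₀) (𝓝 0) := by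
  have : Fact (1 ≤ m) := ⟨hm⟩
  let g : EuclideanSpace ℝ (Fin n) → C(EuclideanSpace ℝ (Fin n), EuclideanSpace ℝ (Fin n)) :=
    fun a => ⟨fun x => x - a, by fun_prop⟩
  have hg : Continuous g :=
    ContinuousMap.continuous_of_continuous_uncurry _ (by
      change Continuous fun z : EuclideanSpace ℝ (Fin n) × EuclideanSpace ℝ (Fin n) => z.2 - z.1
      fun_prop)
  have hgm : ∀ a, MeasurePreserving (g a) volume volume := fun a =>
    measurePreserving_sub_right volume a
  have h1 := (continuous_const (y := hf.toLp f)).compMeasurePreservingLp hg hgm hm'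
  have h2 := (tendsto_iff_edist_tendsto_0.1 (h1.tendsto a₀))
  refine h2.congr fun a => ?_
  rw [Lp.edist_def]
  refine eLpNorm_congr_ae ?_
  have e : ∀ b, ⇑(Lp.compMeasurePreserving (g b) (hgm b) (hf.toLp f)) =ᵐ[volume]
      fun x => f (x - b) := fun b =>
    (Lp.coeFn_compMeasurePreserving _ (hgm b)).trans
      ((hgm b).quasiMeasurePreserving.ae_eq_comp hf.coeFn_toLp)
  filter_upwards [e a, e a₀] with x hx hx'
  rw [Pi.sub_apply, hx, hx']

/-- In the form of averaged translates, continuity of translations in `L^m` gives convergence for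
each `y`, and dominated convergence against `|K₁|` finishes. -/
theorem tendsto_eLpNorm_fracHeatSemigroup_sub (hα : 0 < α) (hm : 1 ≤ m) (hm' : m ≠ ∞)
    {f : EuclideanSpace ℝ (Fin n) → 𝕜} (hf : MemLp f m volume) {t₀ : ℝ} (ht₀ : 0 ≤ t₀) :
    Tendsto (fun t => eLpNorm (fracHeatSemigroup α t f - fracHeatSemigroup α t₀ f) m volume)
      (𝓝[Ici 0] t₀) (𝓝 0) := by
  have hm0 : m ≠ 0 := (zero_lt_one.trans_le hm).ne'
  have hmr : 1 ≤ m.toReal := by simpa using ENNReal.toReal_mono hm' hm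
  have hmr0 : 0 < m.toReal := by linarith
  wlog hfs : StronglyMeasurable f generalizing f
  · have hmk : MemLp (hf.1.mk f) m volume := hf.ae_eq hf.1.ae_eq_mk
    refine (this hmk hf.1.stronglyMeasurable_mk).congr' ?_
    filter_upwards [self_mem_nhdsWithin] with t ht
    exact eLpNorm_congr_ae ((fracHeatSemigroup_congr_ae ht hf.1.ae_eq_mk.symm).sub
      (fracHeatSemigroup_congr_ae ht₀ hf.1.ae_eq_mk.symm))
  set c : ℝ → ℝ := fun t => t ^ (1 / (2 * α)) with hc
  have hcc : Continuous c := Real.continuous_rpow_const (by positivity)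
  set D : ℝ → EuclideanSpace ℝ (Fin n) → ℝ≥0∞ := fun t y =>
    ∫⁻ x, ‖f (x - c t • y) - f (x - c t₀ • y)‖ₑ ^ m.toReal with hD
  have hDe : ∀ t y, D t y =
      eLpNorm (fun x => f (x - c t • y) - f (x - c t₀ • y)) m volume ^ m.toReal := fun t y => by
    rw [eLpNorm_eq_lintegral_rpow_enorm_toReal hm0 hm', ← ENNReal.rpow_mul,
      one_div_mul_cancel hmr0.ne', ENNReal.rpow_one]
  have hKm := (measurable_fracHeatKernel (n := n) hα one_pos).enorm
  have hmeas : ∀ t, StronglyMeasurable (Function.uncurry fun x y : EuclideanSpace ℝ (Fin n) =>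
      f (x - c t • y) - f (x - c t₀ • y)) := fun t =>
    (hfs.comp_measurable (by fun_prop)).sub (hfs.comp_measurable (by fun_prop))
  have htr : ∀ a : EuclideanSpace ℝ (Fin n), eLpNorm (fun x => f (x - a)) m volume =
      eLpNorm f m volume := fun a =>
    eLpNorm_comp_measurePreserving hf.1 (measurePreserving_sub_right volume a)
  have hlim : Tendsto (fun t => ∫⁻ y, ‖fracHeatKernel n α 1 y‖ₑ * D t y) (𝓝[Ici 0] t₀) (𝓝 0) := by
    rw [← lintegral_zero (μ := (volume : Measure (EuclideanSpace ℝ (Fin n))))]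
    refine tendsto_lintegral_filter_of_dominated_convergence
      (fun y => ‖fracHeatKernel n α 1 y‖ₑ *
        (eLpNorm f m volume + eLpNorm f m volume) ^ m.toReal) ?_ ?_ ?_ ?_
    · refine Eventually.of_forall fun t => hKm.mul ?_
      exact Measurable.lintegral_prod_left' (f := fun z : EuclideanSpace ℝ (Fin n) ×
        EuclideanSpace ℝ (Fin n) => ‖f (z.1 - c t • z.2) - f (z.1 - c t₀ • z.2)‖ₑ ^ m.toReal)
        ((hmeas t).enorm.pow_const _)
    · refine Eventually.of_forall fun t => Eventually.of_forall fun y => ?_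
      rw [hDe]
      gcongr
      refine (eLpNorm_sub_le (hfs.comp_measurable (by fun_prop)).aestronglyMeasurable
        (hfs.comp_measurable (by fun_prop)).aestronglyMeasurable hm).trans ?_
      exact add_le_add (htr _).le (htr _).le
    · rw [lintegral_mul_const _ hKm]
      exact ENNReal.mul_ne_top (integrable_fracHeatKernel hα one_pos).2.ne
        (ENNReal.rpow_ne_top_of_nonneg (by linarith) (by finiteness [hf.2]))
    · refine Eventually.of_forall fun y => ?_
      have h1 : Tendsto (fun t => c t • y) (𝓝[Ici 0] t₀) (𝓝 (c t₀ • y)) :=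
        ((hcc.tendsto t₀).smul_const y).mono_left nhdsWithin_le_nhds
      have h2 := (tendsto_eLpNorm_translate_sub hm hm' hf _).comp h1
      have h3 := h2.ennrpow_const m.toReal
      rw [ENNReal.zero_rpow_of_pos hmr0] at h3
      have h4 := ENNReal.Tendsto.const_mul (a := ‖fracHeatKernel n α 1 y‖ₑ) h3 (Or.inr (by simp))
      rw [mul_zero] at h4
      refine h4.congr fun t => ?_
      rw [hDe]
      rfl
  have hlim2 := ENNReal.Tendsto.const_mul
    (a := (∫⁻ y, ‖fracHeatKernel n α 1 y‖ₑ) ^ (m.toReal - 1)) hlim (Or.inr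
      (ENNReal.rpow_ne_top_of_nonneg (by linarith) (integrable_fracHeatKernel hα one_pos).2.ne))
  have hlim3 := hlim2.ennrpow_const (1 / m.toReal)
  rw [mul_zero, ENNReal.zero_rpow_of_pos (by positivity)] at hlim3
  refine tendsto_of_tendsto_of_tendsto_of_le_of_le' tendsto_const_nhds hlim3
    (Eventually.of_forall fun _ => zero_le) ?_
  filter_upwards [self_mem_nhdsWithin] with t ht
  rw [eLpNorm_eq_lintegral_rpow_enorm_toReal hm0 hm']
  refine ENNReal.rpow_le_rpow ?_ (by positivity)
  refine le_trans (le_of_eq ?_) (lintegral_enorm_integral_smul_rpow_le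
    (μ := (volume : Measure (EuclideanSpace ℝ (Fin n))))
    (ν := (volume : Measure (EuclideanSpace ℝ (Fin n))))
    (measurable_fracHeatKernel (n := n) hα one_pos)
    (H := fun x y => f (x - c t • y) - f (x - c t₀ • y)) (hmeas t) hmr)
  refine lintegral_congr fun x => ?_
  rw [Pi.sub_apply, fracHeatSemigroup_eq_integral_translate hα ht,
    fracHeatSemigroup_eq_integral_translate hα ht₀, ← integral_sub
      (integrable_fracHeatKernel_one_smul hα ht hm hf x)
      (integrable_fracHeatKernel_one_smul hα ht₀ hm hf x)]
  simp_rw [smul_sub]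
  rfl

theorem fracHeatSemigroup_add_apply (hα : 0 < α) (ht : 0 ≤ t) (hm : 1 ≤ m)
    {f g : EuclideanSpace ℝ (Fin n) → 𝕜} (hf : MemLp f m volume) (hg : MemLp g m volume) :
    fracHeatSemigroup α t (f + g) = fracHeatSemigroup α t f + fracHeatSemigroup α t g := by
  ext x
  rw [Pi.add_apply, fracHeatSemigroup_eq_integral_translate hα ht,
    fracHeatSemigroup_eq_integral_translate hα ht, fracHeatSemigroup_eq_integral_translate hα ht,
    ← integral_add (integrable_fracHeatKernel_one_smul hα ht hm hf x)
      (integrable_fracHeatKernel_one_smul hα ht hm hg x)]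
  simp_rw [Pi.add_apply, smul_add]

theorem fracHeatSemigroup_smul (hα : 0 < α) (ht : 0 ≤ t) (c : ℝ)
    (f : EuclideanSpace ℝ (Fin n) → 𝕜) :
    fracHeatSemigroup α t (c • f) = c • fracHeatSemigroup α t f := by
  ext x
  rw [Pi.smul_apply, fracHeatSemigroup_eq_integral_translate hα ht,
    fracHeatSemigroup_eq_integral_translate hα ht, ← integral_smul]
  simp_rw [Pi.smul_apply, smul_comm c]

theorem exists_heatOp [Fact (1 ≤ m)] [Fact (1 ≤ ρ)] (hα : 0 < α) (ht : 0 ≤ t) {C : ℝ} (hC : 0 ≤ C)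
    (h : ∀ f : EuclideanSpace ℝ (Fin n) → 𝕜, AEStronglyMeasurable f volume →
      eLpNorm (fracHeatSemigroup α t f) ρ volume ≤ ENNReal.ofReal C * eLpNorm f m volume) :
    ∃ L : Lp 𝕜 m (volume : Measure (EuclideanSpace ℝ (Fin n))) →L[ℝ]
        Lp 𝕜 ρ (volume : Measure (EuclideanSpace ℝ (Fin n))),
      (∀ f, ⇑(L f) =ᵐ[volume] fracHeatSemigroup α t f) ∧ ‖L‖ ≤ C := by
  have hmem : ∀ f : Lp 𝕜 m (volume : Measure (EuclideanSpace ℝ (Fin n))),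
      MemLp (fracHeatSemigroup α t f) ρ volume := fun f =>
    ⟨aestronglyMeasurable_fracHeatSemigroup hα ht (Lp.aestronglyMeasurable f),
      (h f (Lp.aestronglyMeasurable f)).trans_lt
        (ENNReal.mul_lt_top ENNReal.ofReal_lt_top (Lp.eLpNorm_lt_top f))⟩
  let L : Lp 𝕜 m (volume : Measure (EuclideanSpace ℝ (Fin n))) →ₗ[ℝ]
      Lp 𝕜 ρ (volume : Measure (EuclideanSpace ℝ (Fin n))) :=
    { toFun := fun f => (hmem f).toLp _
      map_add' := fun f g => by
        rw [← MemLp.toLp_add, MemLp.toLp_eq_toLp_iff,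
          ← fracHeatSemigroup_add_apply hα ht Fact.out (Lp.memLp f) (Lp.memLp g)]
        exact fracHeatSemigroup_congr_ae ht (Lp.coeFn_add f g)
      map_smul' := fun c f => by
        rw [RingHom.id_apply, ← MemLp.toLp_const_smul, MemLp.toLp_eq_toLp_iff,
          ← fracHeatSemigroup_smul hα ht]
        exact fracHeatSemigroup_congr_ae ht (Lp.coeFn_smul c f) }
  refine ⟨L.mkContinuous C fun f => ?_, fun f => (hmem f).coeFn_toLp,
    L.mkContinuous_norm_le hC _⟩
  change ‖(hmem f).toLp _‖ ≤ _
  rw [Lp.norm_toLp, Lp.norm_def, ← ENNReal.toReal_ofReal hC, ← ENNReal.toReal_mul]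
  exact ENNReal.toReal_mono (ENNReal.mul_ne_top ENNReal.ofReal_ne_top (Lp.eLpNorm_ne_top f))
    (h f (Lp.aestronglyMeasurable f))

end

/-- The fractional heat semigroup as a bounded operator from `L^m` to `L^ρ`. -/
noncomputable def heatOp (𝕜 : Type*) [RCLike 𝕜] (n : ℕ) (α : ℝ) (m ρ : ℝ≥0∞) [Fact (1 ≤ m)]
    [Fact (1 ≤ ρ)] (t : ℝ) : Lp 𝕜 m (volume : Measure (EuclideanSpace ℝ (Fin n))) →L[ℝ]
        Lp 𝕜 ρ (volume : Measure (EuclideanSpace ℝ (Fin n))) :=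
  open Classical in
  -- The value `0` is a mere default: for `m ≤ ρ < ∞` and `t > 0`, and also for `m = ρ` and `t = 0`,
  -- the operator exists.
  if h : ∃ L : Lp 𝕜 m (volume : Measure (EuclideanSpace ℝ (Fin n))) →L[ℝ]
        Lp 𝕜 ρ (volume : Measure (EuclideanSpace ℝ (Fin n))),
      ∀ f, ⇑(L f) =ᵐ[volume] fracHeatSemigroup α t f then h.choose else 0

section
variable {𝕜 : Type*} [RCLike 𝕜] {n : ℕ} {α t : ℝ} {m m' ρ : ℝ≥0∞} [Fact (1 ≤ m)]
  [Fact (1 ≤ m')] [Fact (1 ≤ ρ)]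

theorem coeFn_heatOp_of_exists (h : ∃ L : Lp 𝕜 m (volume : Measure (EuclideanSpace ℝ (Fin n))) →L[ℝ]
        Lp 𝕜 ρ (volume : Measure (EuclideanSpace ℝ (Fin n))),
      ∀ f, ⇑(L f) =ᵐ[volume] fracHeatSemigroup α t f)
    (f : Lp 𝕜 m (volume : Measure (EuclideanSpace ℝ (Fin n)))) :
    ⇑(heatOp 𝕜 n α m ρ t f) =ᵐ[volume] fracHeatSemigroup α t f := by
  rw [heatOp, dif_pos h]
  exact h.choose_spec f

theorem coeFn_heatOp (hα : 0 < α) (hmρ : m ≤ ρ) (hρ : ρ ≠ ∞) (ht : 0 < t)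
    (f : Lp 𝕜 m (volume : Measure (EuclideanSpace ℝ (Fin n)))) :
    ⇑(heatOp 𝕜 n α m ρ t f) =ᵐ[volume] fracHeatSemigroup α t f := by
  obtain ⟨C, hC0, hC⟩ := exists_eLpNorm_fracHeatSemigroup_le 𝕜 n hα (Fact.out : 1 ≤ m) hmρ hρ
  obtain ⟨L, hL, -⟩ := exists_heatOp hα ht.le (by positivity) (hC t ht)
  exact coeFn_heatOp_of_exists ⟨L, hL⟩ f

theorem coeFn_heatOp_self (hα : 0 < α) (hm : m ≠ ∞) (ht : 0 ≤ t)
    (f : Lp 𝕜 m (volume : Measure (EuclideanSpace ℝ (Fin n)))) :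
    ⇑(heatOp 𝕜 n α m m t f) =ᵐ[volume] fracHeatSemigroup α t f := by
  obtain ⟨L, hL, -⟩ := exists_heatOp (𝕜 := 𝕜) (n := n) (m := m) hα ht
    (integral_nonneg fun _ => norm_nonneg _)
    fun f hf => eLpNorm_fracHeatSemigroup_le_self hα ht Fact.out hm hf
  exact coeFn_heatOp_of_exists ⟨L, hL⟩ f

theorem heatOp_zero (hα : 0 < α) (hm : m ≠ ∞)
    (f : Lp 𝕜 m (volume : Measure (EuclideanSpace ℝ (Fin n)))) : heatOp 𝕜 n α m m 0 f = f := by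
  ext1
  refine (coeFn_heatOp_self hα hm le_rfl f).trans ?_
  rw [fracHeatSemigroup_zero]

theorem exists_norm_heatOp_le (𝕜 : Type*) [RCLike 𝕜] (n : ℕ) (hα : 0 < α) (hmρ : m ≤ ρ)
    (hρ : ρ ≠ ∞) : ∃ C : ℝ, 0 ≤ C ∧ ∀ t : ℝ, 0 < t → ‖heatOp 𝕜 n α m ρ t‖ ≤
      C * t ^ (-(n / (2 * α) * (m.toReal⁻¹ - ρ.toReal⁻¹))) := by
  obtain ⟨C, hC0, hC⟩ := exists_eLpNorm_fracHeatSemigroup_le 𝕜 n hα (Fact.out : 1 ≤ m) hmρ hρ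
  refine ⟨C, hC0, fun t ht => ?_⟩
  obtain ⟨L, hL, hLn⟩ := exists_heatOp hα ht.le (by positivity) (hC t ht)
  have : heatOp 𝕜 n α m ρ t = L := by
    ext1 f
    ext1
    exact (coeFn_heatOp hα hmρ hρ ht f).trans (hL f).symm
  rwa [this]

theorem heatOp_heatOp (hα : 0 < α) (hm : m ≤ m') (hmρ : m' ≤ ρ) (hρ : ρ ≠ ∞) {s : ℝ} (ht : 0 < t)
    (hs : 0 < s) (f : Lp 𝕜 m (volume : Measure (EuclideanSpace ℝ (Fin n)))) :
    heatOp 𝕜 n α m' ρ t (heatOp 𝕜 n α m m' s f) = heatOp 𝕜 n α m ρ (t + s) f := by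
  ext1
  refine (coeFn_heatOp hα hmρ hρ ht _).trans ?_
  rw [fracHeatSemigroup_congr ht (coeFn_heatOp hα hm (ne_top_of_le_ne_top hρ hmρ) hs f),
    fracHeatSemigroup_fracHeatSemigroup hα hs ht Fact.out (Lp.memLp f)]
  exact (coeFn_heatOp hα (hm.trans hmρ) hρ (add_pos ht hs) f).symm

theorem continuousOn_heatOp_self (hα : 0 < α) (hm : m ≠ ∞)
    (f : Lp 𝕜 m (volume : Measure (EuclideanSpace ℝ (Fin n)))) :
    ContinuousOn (fun t => heatOp 𝕜 n α m m t f) (Ici 0) := by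
  intro t₀ ht₀
  rw [ContinuousWithinAt, tendsto_iff_edist_tendsto_0]
  refine (tendsto_eLpNorm_fracHeatSemigroup_sub hα Fact.out hm (Lp.memLp f) ht₀).congr' ?_
  filter_upwards [self_mem_nhdsWithin] with t ht
  rw [Lp.edist_def]
  exact eLpNorm_congr_ae ((coeFn_heatOp_self hα hm ht f).symm.sub
    (coeFn_heatOp_self hα hm ht₀ f).symm)

/-- Near `t₀` write `S(t) = S(t₀/2) S(t - t₀/2)`: the inner factor is strongly continuous in `L^m`,
and the outer one is a fixed bounded operator into `L^ρ`. -/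
theorem continuousOn_heatOp (hα : 0 < α) (hmρ : m ≤ ρ) (hρ : ρ ≠ ∞)
    (f : Lp 𝕜 m (volume : Measure (EuclideanSpace ℝ (Fin n)))) :
    ContinuousOn (fun t => heatOp 𝕜 n α m ρ t f) (Ioi 0) := by
  intro t₀ ht₀
  have ht₀' : 0 < t₀ / 2 := half_pos ht₀
  have h1 : ContinuousAt (fun t => heatOp 𝕜 n α m m t f) (t₀ - t₀ / 2) :=
    (continuousOn_heatOp_self hα (ne_top_of_le_ne_top hρ hmρ) f).continuousAt
      (Ici_mem_nhds (by linarith))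
  have h2 : ContinuousAt (fun t => heatOp 𝕜 n α m ρ (t₀ / 2) (heatOp 𝕜 n α m m (t - t₀ / 2) f))
      t₀ := (heatOp 𝕜 n α m ρ (t₀ / 2)).continuous.continuousAt.comp
        (ContinuousAt.comp (f := fun t => t - t₀ / 2) h1 (by fun_prop))
  refine (h2.congr ?_).continuousWithinAt
  filter_upwards [Ioi_mem_nhds (show t₀ / 2 < t₀ by linarith)] with t ht
  rw [heatOp_heatOp hα le_rfl hmρ hρ ht₀' (sub_pos.2 ht)]
  congr 1
  ring_nf

end

/-! ### Duhamel integrals of families of operators with a power singularity -/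

theorem intervalIntegrable_beta {γ δ : ℝ} (hγ : γ < 1) (hδ : δ < 1) :
    IntervalIntegrable (fun θ : ℝ => (1 - θ) ^ (-γ) * θ ^ (-δ)) volume 0 1 := by
  have h := Complex.betaIntegral_convergent (u := ((1 - δ : ℝ) : ℂ)) (v := ((1 - γ : ℝ) : ℂ))
    (by simpa using hδ) (by simpa using hγ)
  have h2 := h.norm
  refine h2.congr_uIoo ?_
  intro θ hθ
  rw [uIoo_of_le zero_le_one] at hθ
  have h1 : (0 : ℝ) < 1 - θ := by linarith [hθ.2]
  simp only [norm_mul]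
  rw [← Complex.ofReal_one, ← Complex.ofReal_sub, ← Complex.ofReal_sub, ← Complex.ofReal_sub,
    ← Complex.ofReal_cpow hθ.1.le, ← Complex.ofReal_cpow h1.le, Complex.norm_real,
    Complex.norm_real, Real.norm_of_nonneg (by have := hθ.1; positivity),
    Real.norm_of_nonneg (by positivity), mul_comm]
  congr 2 <;> ring

/-- The beta integral `∫₀¹ (1 - θ)^{-γ} θ^{-δ} dθ`. -/
noncomputable def betaConst (γ δ : ℝ) : ℝ := ∫ θ in (0 : ℝ)..1, (1 - θ) ^ (-γ) * θ ^ (-δ)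

theorem betaConst_nonneg (γ δ : ℝ) : 0 ≤ betaConst γ δ := by
  refine intervalIntegral.integral_nonneg zero_le_one fun θ hθ => ?_
  have h1 : (0 : ℝ) ≤ 1 - θ := by linarith [hθ.2]
  have h2 := hθ.1
  positivity

section
variable {X Z : Type*} [NormedAddCommGroup X] [NormedSpace ℝ X] [NormedAddCommGroup Z]
  [NormedSpace ℝ Z]

/-- A strongly continuous family of operators, at positive times, with a power bound. -/
structure IsSmoothingFamily (S : ℝ → Z →L[ℝ] X) (A γ : ℝ) : Prop where
  nonneg : 0 ≤ A
  norm_le : ∀ t, 0 < t → ‖S t‖ ≤ A * t ^ (-γ)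
  continuousOn : ∀ z, ContinuousOn (fun t => S t z) (Ioi 0)

/-- The Duhamel integral `∫₀ᵗ S(t - τ) F(τ) dτ`. -/
noncomputable def duhamel (S : ℝ → Z →L[ℝ] X) (F : ℝ → Z) (t : ℝ) : X :=
  ∫ τ in (0 : ℝ)..t, S (t - τ) (F τ)

variable {S : ℝ → Z →L[ℝ] X} {A B γ δ δ' : ℝ} {F : ℝ → Z} {t : ℝ}

/-- Joint continuity in time and vector: the operator norms are locally bounded at positive times.
-/
theorem IsSmoothingFamily.tendsto (hS : IsSmoothingFamily S A γ) {ι : Type*} {l : Filter ι}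
    {s : ι → ℝ} {z : ι → Z} {s₀ : ℝ} {z₀ : Z} (hs₀ : 0 < s₀) (hs : Tendsto s l (𝓝 s₀))
    (hz : Tendsto z l (𝓝 z₀)) : Tendsto (fun i => S (s i) (z i)) l (𝓝 (S s₀ z₀)) := by
  have h1 : Tendsto (fun i => S (s i) z₀) l (𝓝 (S s₀ z₀)) :=
    ((hS.continuousOn z₀).continuousAt (Ioi_mem_nhds hs₀)).tendsto.comp hs
  have h2 : Tendsto (fun i => A * s i ^ (-γ) * ‖z i - z₀‖) l (𝓝 (A * s₀ ^ (-γ) * 0)) := by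
    refine ((hs.rpow_const (Or.inl hs₀.ne')).const_mul A).mul ?_
    simpa using (hz.sub_const z₀).norm
  rw [mul_zero] at h2
  have h3 : Tendsto (fun i => S (s i) (z i - z₀)) l (𝓝 0) := by
    refine squeeze_zero_norm' ?_ h2
    filter_upwards [hs.eventually (Ioi_mem_nhds hs₀)] with i hi
    exact (S (s i)).le_of_opNorm_le (hS.norm_le _ hi) _
  have h4 := h3.add h1
  simpa using h4

/-- The substitution `τ = tθ` splits off a power of `t` from the beta density. A weaker singularity
`δ'` is dominated by `δ`, so that one beta constant serves all admissible weights. -/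
theorem IsSmoothingFamily.norm_apply_le (hS : IsSmoothingFamily S A γ) (ht : 0 < t)
    (hδ' : δ' ≤ δ) (hB : 0 ≤ B) (hFb : ∀ τ ∈ Ioo 0 t, ‖F τ‖ ≤ B * τ ^ (-δ')) {θ : ℝ}
    (hθ : θ ∈ Ioo (0 : ℝ) 1) :
    ‖S (t * (1 - θ)) (F (t * θ))‖ ≤
      A * B * t ^ (-γ - δ') * ((1 - θ) ^ (-γ) * θ ^ (-δ)) := by
  have h1 : 0 < 1 - θ := by linarith [hθ.2]
  have h2 := hθ.1
  have hA := hS.nonneg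
  have hmem : t * θ ∈ Ioo 0 t := ⟨by positivity, by nlinarith [hθ.2]⟩
  calc ‖S (t * (1 - θ)) (F (t * θ))‖
      ≤ A * (t * (1 - θ)) ^ (-γ) * ‖F (t * θ)‖ :=
        (S _).le_of_opNorm_le (hS.norm_le _ (by positivity)) _
    _ ≤ A * (t * (1 - θ)) ^ (-γ) * (B * (t * θ) ^ (-δ')) := by
        gcongr
        exact hFb _ hmem
    _ = A * B * (t ^ (-γ) * t ^ (-δ')) * ((1 - θ) ^ (-γ) * θ ^ (-δ')) := by
        rw [Real.mul_rpow ht.le h1.le, Real.mul_rpow ht.le h2.le]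
        ring
    _ ≤ _ := by
        rw [← Real.rpow_add ht, ← sub_eq_add_neg]
        have := Real.rpow_le_rpow_of_exponent_ge h2 hθ.2.le (neg_le_neg hδ')
        exact mul_le_mul_of_nonneg_left (mul_le_mul_of_nonneg_left this (by positivity))
          (by positivity)

theorem IsSmoothingFamily.continuousOn_scaled (hS : IsSmoothingFamily S A γ) (ht : 0 < t)
    (hF : ContinuousOn F (Ioo 0 t)) :
    ContinuousOn (fun θ => S (t * (1 - θ)) (F (t * θ))) (Ioo 0 1) := by
  intro θ hθ
  have h1 : 0 < 1 - θ := by linarith [hθ.2]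
  have hmem : t * θ ∈ Ioo 0 t := ⟨mul_pos ht hθ.1, by nlinarith [hθ.2]⟩
  have hFc : ContinuousAt (fun θ => F (t * θ)) θ :=
    ContinuousAt.comp (f := fun θ => t * θ) (hF.continuousAt (Ioo_mem_nhds hmem.1 hmem.2))
      (by fun_prop)
  have hc : ContinuousAt (fun θ => t * (1 - θ)) θ := by fun_prop
  exact (hS.tendsto (mul_pos ht h1) hc.tendsto hFc.tendsto).mono_left nhdsWithin_le_nhds

theorem IsSmoothingFamily.aestronglyMeasurable_scaled (hS : IsSmoothingFamily S A γ) (ht : 0 < t)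
    (hF : ContinuousOn F (Ioo 0 t)) :
    AEStronglyMeasurable (fun θ => S (t * (1 - θ)) (F (t * θ))) (volume.restrict (uIoc 0 1)) := by
  rw [uIoc_of_le zero_le_one, ← restrict_Ioo_eq_restrict_Ioc]
  exact (hS.continuousOn_scaled ht hF).aestronglyMeasurable measurableSet_Ioo

theorem ae_uIoc_of_forall_Ioo {Q : ℝ → Prop} {a t : ℝ} (hat : a ≤ t) (h : ∀ θ ∈ Ioo a t, Q θ) :
    ∀ᵐ θ : ℝ, θ ∈ uIoc a t → Q θ := by
  have : ∀ᵐ θ : ℝ, θ ≠ t := by simp [ae_iff]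
  filter_upwards [this] with θ hθ hmem
  rw [uIoc_of_le hat] at hmem
  exact h θ ⟨hmem.1, lt_of_le_of_ne hmem.2 hθ⟩

theorem IsSmoothingFamily.intervalIntegrable_scaled (hS : IsSmoothingFamily S A γ) (hγ : γ < 1)
    (hδ : δ < 1) (ht : 0 < t) (hF : ContinuousOn F (Ioo 0 t)) (hB : 0 ≤ B)
    (hFb : ∀ τ ∈ Ioo 0 t, ‖F τ‖ ≤ B * τ ^ (-δ)) :
    IntervalIntegrable (fun θ => S (t * (1 - θ)) (F (t * θ))) volume 0 1 := by
  refine ((intervalIntegrable_beta hγ hδ).const_mul (A * B * t ^ (-γ - δ))).mono_fun'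
    (hS.aestronglyMeasurable_scaled ht hF) ?_
  rw [EventuallyLE, ae_restrict_iff' measurableSet_uIoc]
  exact ae_uIoc_of_forall_Ioo zero_le_one fun θ hθ => hS.norm_apply_le ht le_rfl hB hFb hθ

theorem IsSmoothingFamily.intervalIntegrable (hS : IsSmoothingFamily S A γ) (hγ : γ < 1)
    (hδ : δ < 1) (ht : 0 < t) (hF : ContinuousOn F (Ioo 0 t)) (hB : 0 ≤ B)
    (hFb : ∀ τ ∈ Ioo 0 t, ‖F τ‖ ≤ B * τ ^ (-δ)) :
    IntervalIntegrable (fun τ => S (t - τ) (F τ)) volume 0 t := by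
  have h := (hS.intervalIntegrable_scaled hγ hδ ht hF hB hFb).comp_mul_left (c := t⁻¹)
  simp only [zero_div, one_div, inv_inv] at h
  refine h.congr fun τ _ => ?_
  rw [mul_sub, mul_one, ← mul_assoc, mul_inv_cancel₀ ht.ne', one_mul]

theorem duhamel_eq_scaled (S : ℝ → Z →L[ℝ] X) (F : ℝ → Z) (t : ℝ) :
    duhamel S F t = t • ∫ θ in (0 : ℝ)..1, S (t * (1 - θ)) (F (t * θ)) := by
  have := intervalIntegral.smul_integral_comp_mul_left (a := 0) (b := 1)
    (fun τ => S (t - τ) (F τ)) t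
  rw [mul_zero, mul_one] at this
  rw [duhamel, ← this]
  simp_rw [mul_sub, mul_one]

theorem IsSmoothingFamily.norm_duhamel_le (hS : IsSmoothingFamily S A γ) (hγ : γ < 1)
    (hδ : δ < 1) (hδ' : δ' ≤ δ) (ht : 0 < t) (hB : 0 ≤ B)
    (hFb : ∀ τ ∈ Ioo 0 t, ‖F τ‖ ≤ B * τ ^ (-δ')) :
    ‖duhamel S F t‖ ≤ A * B * betaConst γ δ * t ^ (1 - γ - δ') := by
  rw [duhamel_eq_scaled, norm_smul, Real.norm_of_nonneg ht.le]
  have h1 : ‖∫ θ in (0 : ℝ)..1, S (t * (1 - θ)) (F (t * θ))‖ ≤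
      ∫ θ in (0 : ℝ)..1, A * B * t ^ (-γ - δ') * ((1 - θ) ^ (-γ) * θ ^ (-δ)) := by
    refine intervalIntegral.norm_integral_le_of_norm_le zero_le_one ?_
      ((intervalIntegrable_beta hγ hδ).const_mul _)
    have := ae_uIoc_of_forall_Ioo zero_le_one fun θ hθ => hS.norm_apply_le ht hδ' hB hFb hθ
    rwa [uIoc_of_le zero_le_one] at this
  rw [intervalIntegral.integral_const_mul] at h1
  calc t * ‖∫ θ in (0 : ℝ)..1, S (t * (1 - θ)) (F (t * θ))‖
      ≤ t * (A * B * t ^ (-γ - δ') * betaConst γ δ) := by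
        gcongr
        exact h1
    _ = A * B * betaConst γ δ * (t ^ (1 : ℝ) * t ^ (-γ - δ')) := by rw [Real.rpow_one]; ring
    _ = _ := by
        rw [← Real.rpow_add ht]
        congr 2
        ring

/-- On the fixed interval `[0, 1]` dominated convergence applies, the power of `t` being locally
bounded near `t₀ > 0`. -/
theorem IsSmoothingFamily.continuousOn_duhamel (hS : IsSmoothingFamily S A γ) (hγ : γ < 1)
    (hδ : δ < 1) {J : Set ℝ} (hJo : IsOpen J) (hJ0 : J ⊆ Ioi 0) (hJ : ∀ t ∈ J, Ioo 0 t ⊆ J)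
    (hF : ContinuousOn F J) (hB : 0 ≤ B) (hFb : ∀ τ ∈ J, ‖F τ‖ ≤ B * τ ^ (-δ)) :
    ContinuousOn (duhamel S F) J := by
  intro t₀ ht₀
  have ht₀' : 0 < t₀ := hJ0 ht₀
  have hA := hS.nonneg
  refine ContinuousAt.continuousWithinAt ?_
  rw [show duhamel S F = fun t => t • ∫ θ in (0 : ℝ)..1, S (t * (1 - θ)) (F (t * θ)) from
    funext fun t => duhamel_eq_scaled S F t]
  refine continuousAt_id.smul ?_
  refine intervalIntegral.continuousAt_of_dominated_interval
    (bound := fun θ => A * B * (t₀ ^ (-γ - δ) + 1) * ((1 - θ) ^ (-γ) * θ ^ (-δ))) ?_ ?_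
    ((intervalIntegrable_beta hγ hδ).const_mul _) ?_
  · filter_upwards [hJo.mem_nhds ht₀] with t ht
    exact hS.aestronglyMeasurable_scaled (hJ0 ht) (hF.mono (hJ t ht))
  · have hc : ContinuousAt (fun t : ℝ => t ^ (-γ - δ)) t₀ :=
      Real.continuousAt_rpow_const _ _ (Or.inl ht₀'.ne')
    filter_upwards [hJo.mem_nhds ht₀, hc.eventually (gt_mem_nhds (lt_add_one _))] with t ht ht'
    refine ae_uIoc_of_forall_Ioo zero_le_one fun θ hθ => ?_
    refine (hS.norm_apply_le (hJ0 ht) le_rfl hB (fun τ hτ => hFb τ (hJ t ht hτ)) hθ).trans ?_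
    have h1 : (0 : ℝ) ≤ 1 - θ := by linarith [hθ.2]
    have h2 := hθ.1
    gcongr
  · refine ae_uIoc_of_forall_Ioo zero_le_one fun θ hθ => ?_
    have h1 : 0 < 1 - θ := by linarith [hθ.2]
    have hmem : t₀ * θ ∈ J := hJ t₀ ht₀ ⟨mul_pos ht₀' hθ.1, by nlinarith [hθ.2]⟩
    have hFc : ContinuousAt (fun t => F (t * θ)) t₀ :=
      ContinuousAt.comp (f := fun t => t * θ) (hF.continuousAt (hJo.mem_nhds hmem)) (by fun_prop)
    have hc : ContinuousAt (fun t => t * (1 - θ)) t₀ := by fun_prop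
    exact hS.tendsto (mul_pos ht₀' h1) hc.tendsto hFc.tendsto

end

/-! ### Power nonlinearities and the abstract fixed point -/

section
variable {X Z : Type*} [NormedAddCommGroup X] [NormedAddCommGroup Z]

/-- A nonlinearity with `N 0 = 0` that is locally Lipschitz with a power constant. -/
structure IsPowerLipschitz (N : X → Z) (κ b : ℝ) : Prop where
  nonneg : 0 ≤ κ
  map_zero : N 0 = 0
  norm_sub_le : ∀ x y, ‖N x - N y‖ ≤ κ * (‖x‖ ^ b + ‖y‖ ^ b) * ‖x - y‖

theorem IsPowerLipschitz.norm_le {N : X → Z} {κ b : ℝ} (hN : IsPowerLipschitz N κ b) (hb : 0 < b)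
    (x : X) : ‖N x‖ ≤ κ * ‖x‖ ^ b * ‖x‖ := by
  have := hN.norm_sub_le x 0
  rwa [hN.map_zero, sub_zero, sub_zero, norm_zero, Real.zero_rpow hb.ne', add_zero] at this

theorem IsPowerLipschitz.continuous {N : X → Z} {κ b : ℝ} (hN : IsPowerLipschitz N κ b)
    (hb : 0 < b) : Continuous N := by
  rw [continuous_iff_continuousAt]
  intro x
  rw [ContinuousAt, tendsto_iff_norm_sub_tendsto_zero]
  have h1 : Continuous fun y : X => κ * (‖y‖ ^ b + ‖x‖ ^ b) * ‖y - x‖ :=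
    (continuous_const.mul ((continuous_norm.rpow_const fun _ => Or.inr hb.le).add
      continuous_const)).mul (by fun_prop)
  have h2 := h1.tendsto x
  rw [sub_self, norm_zero, mul_zero] at h2
  exact squeeze_zero (fun _ => norm_nonneg _) (fun y => hN.norm_sub_le y x) h2

theorem norm_le_mul_rpow_neg {x : X} {t e M : ℝ} (ht : 0 < t) (h : t ^ e * ‖x‖ ≤ M) :
    ‖x‖ ≤ M * t ^ (-e) := by
  rw [Real.rpow_neg ht.le, ← div_eq_mul_inv, le_div_iff₀ (by positivity), mul_comm]
  exact h

theorem rpow_mul_norm_le {x : X} {t e M : ℝ} (ht : 0 < t) (h : ‖x‖ ≤ M * t ^ (-e)) :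
    t ^ e * ‖x‖ ≤ M := by
  rw [Real.rpow_neg ht.le, ← div_eq_mul_inv, le_div_iff₀ (by positivity), mul_comm] at h
  exact h

theorem IsPowerLipschitz.norm_comp_le {N : X → Z} {κ b e : ℝ}
    (hN : IsPowerLipschitz N κ b) (hb : 0 < b) {w : X}
    {t R R' σ : ℝ}
    (ht : 0 < t) (hR : 0 ≤ R) (h1 : t ^ e * ‖w‖ ≤ R) (h2 : t ^ σ * ‖w‖ ≤ R') :
    ‖N w‖ ≤ κ * R ^ b * R' * t ^ (-(b * e + σ)) := by
  have hκ := hN.nonneg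
  have h1' := norm_le_mul_rpow_neg ht h1
  have h2' := norm_le_mul_rpow_neg ht h2
  calc ‖N w‖ ≤ κ * ‖w‖ ^ b * ‖w‖ := hN.norm_le hb w
    _ ≤ κ * (R * t ^ (-e)) ^ b * (R' * t ^ (-σ)) := by gcongr
    _ = κ * R ^ b * R' * ((t ^ (-e)) ^ b * t ^ (-σ)) := by
        rw [Real.mul_rpow hR (by positivity)]; ring
    _ = _ := by
        rw [← Real.rpow_mul ht.le, ← Real.rpow_add ht]
        congr 2
        ring

end

section
variable {X Z : Type*} [NormedAddCommGroup X] [NormedSpace ℝ X] [NormedAddCommGroup Z]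
  [NormedSpace ℝ Z]

theorem duhamel_sub {S : ℝ → Z →L[ℝ] X} {F G : ℝ → Z} {t : ℝ}
    (hF : IntervalIntegrable (fun τ => S (t - τ) (F τ)) volume 0 t)
    (hG : IntervalIntegrable (fun τ => S (t - τ) (G τ)) volume 0 t) :
    duhamel S F t - duhamel S G t = duhamel S (fun τ => F τ - G τ) t := by
  rw [duhamel, duhamel, duhamel, ← intervalIntegral.integral_sub hF hG]
  simp_rw [map_sub]

variable {S : ℝ → Z →L[ℝ] X} {A γ κ b e : ℝ} {N : X → Z}

/-- Contraction in the space of `w` with `t^e w(t)` bounded and continuous. The last clause says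
that every weighted bound on the linear part, on any initial piece `J'` and with any weight `σ ≤ e`,
passes to the solution with a factor `2`. It yields decay as `t → 0` (take `J'` short) and better
integrability for better data (take `σ < e`). -/
theorem exists_mildSolution_of_small [CompleteSpace X] (hS : IsSmoothingFamily S A γ) (hγ : γ < 1)
    (hN : IsPowerLipschitz N κ b) (hb : 0 < b) (he : 0 ≤ e) (hδ : (b + 1) * e < 1)
    {J : Set ℝ} (hJo : IsOpen J) (hJ0 : J ⊆ Ioi 0) (hJ : ∀ t ∈ J, Ioo 0 t ⊆ J)
    {L R : ℝ} (hL0 : 0 ≤ L) (hR : 0 ≤ R) (hL : ∀ t ∈ J, t ^ (1 - γ - b * e) ≤ L)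
    (hsmall : 4 * A * κ * betaConst γ ((b + 1) * e) * L * R ^ b ≤ 1)
    {a : ℝ → X} (ha : ContinuousOn a J) (haR : ∀ t ∈ J, t ^ e * ‖a t‖ ≤ R / 2) :
    ∃ w : ℝ → X, ContinuousOn w J ∧ (∀ t ∈ J, w t = a t + duhamel S (fun τ => N (w τ)) t) ∧
      ∀ (σ R' : ℝ) (J' : Set ℝ), J' ⊆ J → (∀ t ∈ J', Ioo 0 t ⊆ J') → 0 ≤ σ → σ ≤ e →
        (∀ t ∈ J', t ^ σ * ‖a t‖ ≤ R' / 2) → ∀ t ∈ J', t ^ σ * ‖w t‖ ≤ R' := by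
  classical
  set β := betaConst γ ((b + 1) * e) with hβ
  have hβ0 : 0 ≤ β := betaConst_nonneg _ _
  have hA := hS.nonneg
  have hκ := hN.nonneg
  let ext : BoundedContinuousFunction J X → ℝ → X := fun W t =>
    if h : t ∈ J then t ^ (-e) • W ⟨t, h⟩ else 0
  have ext_of : ∀ W t (h : t ∈ J), ext W t = t ^ (-e) • W ⟨t, h⟩ := fun W t h => dif_pos h
  have norm_ext : ∀ W t (h : t ∈ J), t ^ e * ‖ext W t‖ = ‖W ⟨t, h⟩‖ := fun W t h => by
    have ht : 0 < t := hJ0 h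
    rw [ext_of W t h, norm_smul, Real.norm_of_nonneg (by positivity), ← mul_assoc,
      ← Real.rpow_add ht, add_neg_cancel, Real.rpow_zero, one_mul]
  have ext_cont : ∀ W, ContinuousOn (ext W) J := fun W => by
    rw [continuousOn_iff_continuous_domRestrict]
    have : J.domRestrict (ext W) = fun t : J => (t : ℝ) ^ (-e) • W t := by
      ext t
      exact ext_of W t t.2
    rw [this]
    refine Continuous.smul ?_ W.continuous
    rw [continuous_iff_continuousAt]
    intro t
    exact (Real.continuousAt_rpow_const _ _ (Or.inl (ne_of_gt (hJ0 t.2)))).comp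
      continuous_subtype_val.continuousAt
  have F_cont : ∀ W, ContinuousOn (fun τ => N (ext W τ)) J := fun W =>
    (hN.continuous hb).comp_continuousOn (ext_cont W)
  have F_bound : ∀ W, ∀ τ ∈ J, ‖N (ext W τ)‖ ≤ κ * ‖W‖ ^ b * ‖W‖ * τ ^ (-((b + 1) * e)) := by
    intro W τ hτ
    have h1 : τ ^ e * ‖ext W τ‖ ≤ ‖W‖ := (norm_ext W τ hτ).trans_le (W.norm_coe_le_norm _)
    refine (hN.norm_comp_le hb (hJ0 hτ) (norm_nonneg _) h1 h1).trans (le_of_eq ?_)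
    ring_nf
  have duh_bound : ∀ (G : ℝ → Z) (B σ : ℝ) (J' : Set ℝ), J' ⊆ J → (∀ t ∈ J', Ioo 0 t ⊆ J') →
      0 ≤ B → σ ≤ e → (∀ τ ∈ J', ‖G τ‖ ≤ B * τ ^ (-(b * e + σ))) → ∀ t ∈ J',
        t ^ σ * ‖duhamel S G t‖ ≤ A * B * β * L := by
    intro G B σ J' hJJ hJ' hB hσ hG t ht
    have ht0 : 0 < t := hJ0 (hJJ ht)
    have h1 := hS.norm_duhamel_le hγ hδ (δ' := b * e + σ) (by linarith) ht0 hB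
      (fun τ hτ => hG τ (hJ' t ht hτ))
    calc t ^ σ * ‖duhamel S G t‖ ≤ t ^ σ * (A * B * β * t ^ (1 - γ - (b * e + σ))) := by gcongr
      _ = A * B * β * (t ^ σ * t ^ (1 - γ - (b * e + σ))) := by ring
      _ = A * B * β * t ^ (1 - γ - b * e) := by
          rw [← Real.rpow_add ht0]
          congr 2
          ring
      _ ≤ _ := by
          gcongr
          exact hL t (hJJ ht)
  have duh_cont : ∀ W, ContinuousOn (duhamel S fun τ => N (ext W τ)) J := fun W =>
    hS.continuousOn_duhamel hγ hδ hJo hJ0 hJ (F_cont W) (by positivity) (F_bound W)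
  let Φ : BoundedContinuousFunction J X → BoundedContinuousFunction J X := fun W =>
    BoundedContinuousFunction.ofNormedAddCommGroup
      (fun t : J => (t : ℝ) ^ e • (a t + duhamel S (fun τ => N (ext W τ)) t))
      (by
        refine Continuous.smul ?_ ?_
        · exact (Real.continuous_rpow_const he).comp continuous_subtype_val
        · exact (continuousOn_iff_continuous_domRestrict.1 ha).add
            (continuousOn_iff_continuous_domRestrict.1 (duh_cont W)))
      (R / 2 + A * (κ * ‖W‖ ^ b * ‖W‖) * β * L)
      (fun t => by
        have ht0 : 0 < (t : ℝ) := hJ0 t.2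
        rw [norm_smul, Real.norm_of_nonneg (by positivity)]
        refine (mul_le_mul_of_nonneg_left (norm_add_le _ _) (by positivity)).trans ?_
        rw [mul_add]
        refine add_le_add (haR t t.2) (duh_bound _ _ e J subset_rfl hJ (by positivity) le_rfl ?_ t t.2)
        intro τ hτ
        refine (F_bound W τ hτ).trans (le_of_eq ?_)
        ring_nf)
  have Φ_apply : ∀ W (t : J), Φ W t = (t : ℝ) ^ e • (a t + duhamel S (fun τ => N (ext W τ)) t) :=
    fun W t => rfl
  have ext_Φ : ∀ W, ∀ t ∈ J, ext (Φ W) t = a t + duhamel S (fun τ => N (ext W τ)) t := by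
    intro W t ht
    have ht0 : 0 < t := hJ0 ht
    rw [ext_of _ t ht, Φ_apply, smul_smul, ← Real.rpow_add ht0, neg_add_cancel, Real.rpow_zero,
      one_smul]
  -- The iteration takes place in the closed set of curves that inherit all these bounds at once.
  -- The choice `σ = e`, `R' = R`, `J' = J` shows that it lies in the ball of radius `R`.
  let s : Set (BoundedContinuousFunction J X) := {W | ∀ (σ R' : ℝ) (J' : Set ℝ), J' ⊆ J →
    (∀ t ∈ J', Ioo 0 t ⊆ J') → 0 ≤ σ → σ ≤ e →
    (∀ t ∈ J', t ^ σ * ‖a t‖ ≤ R' / 2) → ∀ t ∈ J', t ^ σ * ‖ext W t‖ ≤ R'}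
  have s_closed : IsClosed s := by
    simp only [s, Set.ofPred_forall]
    refine isClosed_iInter fun σ => isClosed_iInter fun R' => isClosed_iInter fun J' =>
      isClosed_iInter fun hJJ => isClosed_iInter fun _ => isClosed_iInter fun _ =>
      isClosed_iInter fun _ => isClosed_iInter fun _ => isClosed_iInter fun t =>
      isClosed_iInter fun ht => isClosed_le ?_ continuous_const
    simp_rw [ext_of _ t (hJJ ht)]
    refine continuous_const.mul (Continuous.norm (Continuous.const_smul ?_ _))
    exact continuous_eval_const _
  have s_R : ∀ W ∈ s, ∀ t ∈ J, t ^ e * ‖ext W t‖ ≤ R := fun W hW =>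
    hW e R J subset_rfl hJ he le_rfl haR
  have s_maps : MapsTo Φ s s := by
    intro W hW σ R' J' hJJ hJ' hσ0 hσe haσ t ht
    have ht0 : 0 < t := hJ0 (hJJ ht)
    have hR' : 0 ≤ R' := by
      have := (by positivity : 0 ≤ t ^ σ * ‖a t‖).trans (haσ t ht)
      linarith
    rw [ext_Φ W t (hJJ ht)]
    refine (mul_le_mul_of_nonneg_left (norm_add_le _ _) (by positivity)).trans ?_
    rw [mul_add]
    have h1 := duh_bound (fun τ => N (ext W τ)) (κ * R ^ b * R') σ J' hJJ hJ' (by positivity)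
      hσe (fun τ hτ => hN.norm_comp_le hb (hJ0 (hJJ hτ)) hR (s_R W hW τ (hJJ hτ))
        (hW σ R' J' hJJ hJ' hσ0 hσe haσ τ hτ)) t ht
    -- One factor `‖w‖^b` uses the bound `R` and the remaining factor the bound `R'`, so smallness
    -- depends on `R` only. The constant `4` is dictated by the contraction, where the Lipschitz
    -- bound has two terms and the factor has to be `1/2`.
    have h2 : A * (κ * R ^ b * R') * β * L ≤ R' / 2 := by
      have := mul_le_mul_of_nonneg_right hsmall hR'
      have h3 : 0 ≤ A * (κ * R ^ b * R') * β * L := by positivity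
      nlinarith
    linarith [haσ t ht]
  have s_contr : ∀ W ∈ s, ∀ V ∈ s, dist (Φ W) (Φ V) ≤ (1 / 2 : ℝ) * dist W V := by
    intro W hW V hV
    refine (BoundedContinuousFunction.dist_le (by positivity)).2 fun t => ?_
    have ht0 : 0 < (t : ℝ) := hJ0 t.2
    have hint : ∀ U, IntervalIntegrable (fun τ => S ((t : ℝ) - τ) (N (ext U τ))) volume 0 t :=
      fun U => hS.intervalIntegrable hγ hδ ht0 ((F_cont U).mono (hJ t t.2)) (by positivity)
        fun τ hτ => F_bound U τ (hJ t t.2 hτ)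
    rw [Φ_apply, Φ_apply, dist_eq_norm, ← smul_sub, add_sub_add_left_eq_sub, duhamel_sub
      (hint W) (hint V), norm_smul, Real.norm_of_nonneg (by positivity)]
    have hd : ∀ τ ∈ J, τ ^ e * ‖ext W τ - ext V τ‖ ≤ dist W V := fun τ hτ => by
      have h0 : 0 < τ := hJ0 hτ
      rw [ext_of W τ hτ, ext_of V τ hτ, ← smul_sub, norm_smul, Real.norm_of_nonneg (by positivity),
        ← mul_assoc, ← Real.rpow_add h0, add_neg_cancel, Real.rpow_zero, one_mul, ← dist_eq_norm]
      exact BoundedContinuousFunction.dist_coe_le_dist _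
    have h1 := duh_bound (fun τ => N (ext W τ) - N (ext V τ)) (2 * κ * R ^ b * dist W V) e
      J subset_rfl hJ (by positivity) le_rfl (fun τ hτ => ?_) t t.2
    · refine h1.trans ?_
      have := mul_le_mul_of_nonneg_right hsmall (dist_nonneg (x := W) (y := V))
      nlinarith
    · have h0 : 0 < τ := hJ0 hτ
      have hw := norm_le_mul_rpow_neg h0 (s_R W hW τ hτ)
      have hv := norm_le_mul_rpow_neg h0 (s_R V hV τ hτ)
      have hwv := norm_le_mul_rpow_neg h0 (hd τ hτ)
      calc ‖N (ext W τ) - N (ext V τ)‖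
          ≤ κ * (‖ext W τ‖ ^ b + ‖ext V τ‖ ^ b) * ‖ext W τ - ext V τ‖ := hN.norm_sub_le _ _
        _ ≤ κ * ((R * τ ^ (-e)) ^ b + (R * τ ^ (-e)) ^ b) * (dist W V * τ ^ (-e)) := by gcongr
        _ = 2 * κ * R ^ b * dist W V * ((τ ^ (-e)) ^ b * τ ^ (-e)) := by
            rw [Real.mul_rpow hR (by positivity)]; ring
        _ = _ := by
            rw [← Real.rpow_mul h0.le, ← Real.rpow_add h0]
            congr 2
            ring
  have s_zero : (0 : BoundedContinuousFunction J X) ∈ s := by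
    intro σ R' J' hJJ _ _ _ haσ t ht
    have ht0 : 0 < t := hJ0 (hJJ ht)
    rw [ext_of _ t (hJJ ht)]
    have := (by positivity : 0 ≤ t ^ σ * ‖a t‖).trans (haσ t ht)
    simp
    linarith
  have hcontr : ContractingWith (1 / 2 : NNReal) (s_maps.restrict Φ s s) := by
    refine ⟨by rw [← NNReal.coe_lt_coe]; norm_num, LipschitzWith.of_dist_le_mul fun W V => ?_⟩
    have := s_contr W W.2 V V.2
    simpa using! this
  obtain ⟨W, hWs, hWfix, -⟩ := hcontr.exists_fixedPoint' s_closed.isComplete s_maps s_zero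
    (edist_ne_top _ _)
  refine ⟨ext W, ext_cont W, fun t ht => ?_, hWs⟩
  have := ext_Φ W t ht
  rwa [hWfix.eq] at this

end

/-! ### The power nonlinearity between Lebesgue spaces -/

section Nonlinearity

/-- Bernoulli's inequality for `(Y/X)^{b+1}`, that is, convexity of `s^{b+1}`. The factor `Y` on the
left is what permits `b < 1`, where `s^b` itself is not Lipschitz at `0`. -/
theorem rpow_sub_rpow_mul_le {b X Y : ℝ} (hb : 0 < b) (hY : 0 ≤ Y) (hYX : Y ≤ X) :
    (X ^ b - Y ^ b) * Y ≤ (b + 1) * X ^ b * (X - Y) := by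
  rcases (hY.trans hYX).eq_or_lt with h | hX
  · subst h
    have : Y = 0 := le_antisymm hYX hY
    simp [this]
  have h1 : 1 + (b + 1) * (Y / X - 1) ≤ (1 + (Y / X - 1)) ^ (b + 1) :=
    one_add_mul_self_le_rpow_one_add (by linarith [div_nonneg hY hX.le]) (by linarith)
  have h2 : X ^ (b + 1) * (1 + (b + 1) * (Y / X - 1)) ≤ Y ^ (b + 1) := by
    refine (mul_le_mul_of_nonneg_left h1 (by positivity)).trans (le_of_eq ?_)
    rw [add_sub_cancel, Real.div_rpow hY hX.le, mul_div_cancel₀ _ (by positivity)]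
  have h3 : X ^ (b + 1) = X ^ b * X := by rw [Real.rpow_add hX, Real.rpow_one]
  have h4 : Y ^ (b + 1) = Y ^ b * Y := by
    rcases hY.eq_or_lt with h | h
    · rw [← h, Real.zero_rpow (by linarith), mul_zero]
    · rw [Real.rpow_add h, Real.rpow_one]
  rw [h3, h4] at h2
  have h5 : X ^ b * X * (1 + (b + 1) * (Y / X - 1)) = X ^ b * X + (b + 1) * X ^ b * (Y - X) := by
    field_simp
  rw [h5] at h2
  have h6 : X ^ b * Y ≤ X ^ b * X := by gcongr
  linarith

/-- With `‖y‖ ≤ ‖x‖`, split the difference as `‖x‖^b (x - y) + (‖x‖^b - ‖y‖^b) y`; the two parts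
contribute `1` and `b + 1` to the constant. -/
theorem norm_powerNonlinearity_sub_le {𝕜 : Type*} [RCLike 𝕜] {μ b : ℝ} (hb : 0 < b) (x y : 𝕜) :
    ‖powerNonlinearity μ b x - powerNonlinearity μ b y‖
      ≤ |μ| * (b + 2) * (‖x‖ ^ b + ‖y‖ ^ b) * ‖x - y‖ := by
  wlog hyx : ‖y‖ ≤ ‖x‖ generalizing x y
  · rw [norm_sub_rev, norm_sub_rev x y, add_comm (‖x‖ ^ b)]
    exact this y x (le_of_not_ge hyx)
  have h1 : powerNonlinearity μ b x - powerNonlinearity μ b y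
      = (μ * ‖x‖ ^ b) • (x - y) + (μ * (‖x‖ ^ b - ‖y‖ ^ b)) • y := by
    simp only [powerNonlinearity, smul_sub, mul_sub, sub_smul]
    abel
  have h2 := rpow_sub_rpow_mul_le hb (norm_nonneg y) hyx
  have h3 : ‖y‖ ^ b ≤ ‖x‖ ^ b := by gcongr
  have h4 : ‖x‖ - ‖y‖ ≤ ‖x - y‖ := norm_sub_norm_le x y
  rw [h1]
  refine (norm_add_le _ _).trans ?_
  rw [norm_smul, norm_smul, norm_mul, norm_mul, Real.norm_eq_abs μ,
    Real.norm_of_nonneg (by positivity), Real.norm_of_nonneg (sub_nonneg.2 h3)]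
  have h5 : (b + 1) * ‖x‖ ^ b * (‖x‖ - ‖y‖) ≤ (b + 1) * ‖x‖ ^ b * ‖x - y‖ := by gcongr
  have h6 : (b + 2) * ‖x‖ ^ b * ‖x - y‖ ≤ (b + 2) * (‖x‖ ^ b + ‖y‖ ^ b) * ‖x - y‖ := by
    gcongr
    linarith [Real.rpow_nonneg (norm_nonneg y) b]
  calc |μ| * ‖x‖ ^ b * ‖x - y‖ + |μ| * (‖x‖ ^ b - ‖y‖ ^ b) * ‖y‖
      = |μ| * (‖x‖ ^ b * ‖x - y‖ + (‖x‖ ^ b - ‖y‖ ^ b) * ‖y‖) := by ring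
    _ ≤ |μ| * ((b + 2) * (‖x‖ ^ b + ‖y‖ ^ b) * ‖x - y‖) := by
        gcongr
        linarith
    _ = _ := by ring

theorem norm_powerNonlinearity {𝕜 : Type*} [RCLike 𝕜] {μ b : ℝ} (hb : 0 < b) (x : 𝕜) :
    ‖powerNonlinearity μ b x‖ = |μ| * ‖x‖ ^ (b + 1) := by
  rw [powerNonlinearity, norm_smul, norm_mul, Real.norm_eq_abs,
    Real.norm_of_nonneg (by positivity), mul_assoc]
  rcases (norm_nonneg x).eq_or_lt with h | h
  · rw [← h, mul_zero, Real.zero_rpow (by positivity)]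
  · rw [Real.rpow_add h, Real.rpow_one]

theorem continuous_powerNonlinearity {𝕜 : Type*} [RCLike 𝕜] {μ b : ℝ} (hb : 0 < b) :
    Continuous (powerNonlinearity (𝕜 := 𝕜) μ b) :=
  (continuous_const.mul (continuous_norm.rpow_const fun _ => Or.inr hb.le)).smul continuous_id

variable {Ω : Type*} [MeasurableSpace Ω] {ν : Measure Ω} {𝕜 : Type*} [RCLike 𝕜]

theorem eLpNorm_norm_rpow_eq {E : Type*} [NormedAddCommGroup E] (f : Ω → E) {b P : ℝ} (hb : 0 < b)
    (hP : 0 < P) :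
    eLpNorm (fun x => ‖f x‖ ^ b) (ENNReal.ofReal (P / b)) ν
      = eLpNorm f (ENNReal.ofReal P) ν ^ b := by
  rw [eLpNorm_norm_rpow f hb, ← ENNReal.ofReal_mul (by positivity), div_mul_cancel₀ _ hb.ne']

theorem MeasureTheory.MemLp.powerNonlinearity {μ b : ℝ} (hb : 0 < b) {P : ℝ} (hP : 0 < P)
    {f : Ω → 𝕜} (hf : MemLp f (ENNReal.ofReal P) ν) :
    MemLp (fun x => powerNonlinearity μ b (f x)) (ENNReal.ofReal (P / (b + 1))) ν := by
  refine ⟨(continuous_powerNonlinearity hb).comp_aestronglyMeasurable hf.1, ?_⟩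
  have h1 : eLpNorm (fun x => _root_.powerNonlinearity μ b (f x)) (ENNReal.ofReal (P / (b + 1))) ν
      = eLpNorm (|μ| • fun x => ‖f x‖ ^ (b + 1)) (ENNReal.ofReal (P / (b + 1))) ν := by
    refine eLpNorm_congr_norm_ae (Eventually.of_forall fun x => ?_)
    rw [norm_powerNonlinearity hb, Pi.smul_apply, smul_eq_mul, Real.norm_of_nonneg (by positivity)]
  rw [h1, eLpNorm_const_smul, eLpNorm_norm_rpow_eq f (by linarith) hP]
  exact ENNReal.mul_lt_top (by simp) (ENNReal.rpow_lt_top_of_nonneg (by linarith) hf.2.ne)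

open Classical in
/-- The superposition operator of the power nonlinearity between Lebesgue spaces. -/
noncomputable def powerOp (μ b : ℝ) {p : ℝ≥0∞} (m : ℝ≥0∞) (f : Lp 𝕜 p ν) : Lp 𝕜 m ν :=
  if h : MemLp (fun x => powerNonlinearity μ b (f x)) m ν then h.toLp else 0

theorem coeFn_powerOp {μ b : ℝ} {p m : ℝ≥0∞} {f : Lp 𝕜 p ν}
    (h : MemLp (fun x => powerNonlinearity μ b (f x)) m ν) :
    powerOp μ b m f =ᵐ[ν] fun x => powerNonlinearity μ b (f x) := by
  rw [powerOp, dif_pos h]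
  exact h.coeFn_toLp

/-- Hölder with `(b+1)/P = b/P + 1/P`. The condition `b + 1 ≤ P` makes the target exponent at least
`1`, and also `P/b ≥ 1` for the triangle inequality. -/
theorem isPowerLipschitz_powerOp (μ : ℝ) {b P : ℝ} (hb : 0 < b) (hP : b + 1 ≤ P)
    [Fact (1 ≤ ENNReal.ofReal P)] [Fact (1 ≤ ENNReal.ofReal (P / (b + 1)))] :
    IsPowerLipschitz (fun f : Lp 𝕜 (ENNReal.ofReal P) ν =>
      powerOp μ b (ENNReal.ofReal (P / (b + 1))) f) (|μ| * (b + 2)) b := by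
  have hP0 : 0 < P := by linarith
  have hmem : ∀ f : Lp 𝕜 (ENNReal.ofReal P) ν, MemLp (fun x => powerNonlinearity μ b (f x))
    (ENNReal.ofReal (P / (b + 1))) ν := fun f => (Lp.memLp f).powerNonlinearity hb hP0
  refine ⟨by positivity, ?_, fun f g => ?_⟩
  · refine Lp.ext ((coeFn_powerOp (hmem 0)).trans ?_)
    filter_upwards [Lp.coeFn_zero 𝕜 (ENNReal.ofReal P) ν,
      Lp.coeFn_zero 𝕜 (ENNReal.ofReal (P / (b + 1))) ν] with x h1 h2
    rw [h1, h2]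
    simp [powerNonlinearity]
  · set c : ℝ := |μ| * (b + 2) with hc
    have hc0 : 0 ≤ c := by positivity
    have hmf : AEStronglyMeasurable (fun x => ‖f x‖ ^ b) ν :=
      (continuous_id.rpow_const fun _ => Or.inr hb.le).comp_aestronglyMeasurable
        (Lp.aestronglyMeasurable f).norm
    have hmg : AEStronglyMeasurable (fun x => ‖g x‖ ^ b) ν :=
      (continuous_id.rpow_const fun _ => Or.inr hb.le).comp_aestronglyMeasurable
        (Lp.aestronglyMeasurable g).norm
    have hH : ENNReal.HolderTriple (ENNReal.ofReal (P / b)) (ENNReal.ofReal P)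
        (ENNReal.ofReal (P / (b + 1))) := by
      refine ⟨?_⟩
      rw [← ENNReal.ofReal_inv_of_pos (by positivity), ← ENNReal.ofReal_inv_of_pos (by positivity),
        ← ENNReal.ofReal_inv_of_pos (by positivity), ← ENNReal.ofReal_add (by positivity)
        (by positivity)]
      congr 1
      field_simp
    have h1 : eLpNorm (⇑(powerOp μ b (ENNReal.ofReal (P / (b + 1))) f
          - powerOp μ b (ENNReal.ofReal (P / (b + 1))) g)) (ENNReal.ofReal (P / (b + 1))) ν
        ≤ ENNReal.ofReal c * eLpNorm (((fun x => ‖f x‖ ^ b) + fun x => ‖g x‖ ^ b) •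
          fun x => f x - g x) (ENNReal.ofReal (P / (b + 1))) ν := by
      refine eLpNorm_le_mul_eLpNorm_of_ae_le_mul ?_ _
      filter_upwards [Lp.coeFn_sub (powerOp μ b (ENNReal.ofReal (P / (b + 1))) f)
        (powerOp μ b (ENNReal.ofReal (P / (b + 1))) g), coeFn_powerOp (hmem f),
        coeFn_powerOp (hmem g)] with x hx hxf hxg
      rw [hx, Pi.sub_apply, hxf, hxg]
      refine (norm_powerNonlinearity_sub_le hb _ _).trans (le_of_eq ?_)
      rw [Pi.smul_apply', Pi.add_apply, norm_smul, Real.norm_of_nonneg (by positivity), mul_assoc]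
    have h2 := eLpNorm_smul_le_mul_eLpNorm (p := ENNReal.ofReal (P / b)) (q := ENNReal.ofReal P)
      (r := ENNReal.ofReal (P / (b + 1))) (μ := ν) (f := fun x => f x - g x)
      ((Lp.aestronglyMeasurable f).sub (Lp.aestronglyMeasurable g)) (hmf.add hmg)
    have h3 : eLpNorm ((fun x => ‖f x‖ ^ b) + fun x => ‖g x‖ ^ b) (ENNReal.ofReal (P / b)) ν
        ≤ ENNReal.ofReal (‖f‖ ^ b + ‖g‖ ^ b) := by
      have h1b : 1 ≤ ENNReal.ofReal (P / b) := by
        rw [ENNReal.one_le_ofReal, one_le_div hb]; linarith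
      refine (eLpNorm_add_le hmf hmg h1b).trans ?_
      rw [eLpNorm_norm_rpow_eq _ hb hP0, eLpNorm_norm_rpow_eq _ hb hP0,
        ENNReal.ofReal_add (by positivity) (by positivity), ← ENNReal.ofReal_rpow_of_nonneg
        (norm_nonneg _) hb.le, ← ENNReal.ofReal_rpow_of_nonneg (norm_nonneg _) hb.le,
        Lp.norm_def, Lp.norm_def, ENNReal.ofReal_toReal (Lp.eLpNorm_ne_top f),
        ENNReal.ofReal_toReal (Lp.eLpNorm_ne_top g)]
    have h4 : eLpNorm (fun x => f x - g x) (ENNReal.ofReal P) ν = ENNReal.ofReal ‖f - g‖ := by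
      rw [Lp.norm_def, ENNReal.ofReal_toReal (Lp.eLpNorm_ne_top _)]
      exact eLpNorm_congr_ae (Lp.coeFn_sub f g).symm
    clear_value c
    rw [Lp.norm_def]
    refine ENNReal.toReal_le_of_le_ofReal (by positivity) (h1.trans ?_)
    rw [mul_assoc c, ENNReal.ofReal_mul hc0, ENNReal.ofReal_mul (by positivity), ← h4]
    gcongr
    exact h2.trans (by gcongr)

end Nonlinearity

/-! ### Comparing Bochner integrals in different Lebesgue spaces -/

section Bochner
variable {Ω : Type*} [MeasurableSpace Ω] {ν : Measure Ω} {𝕜 : Type*} [RCLike 𝕜]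

theorem integrableOn_Lp {p : ℝ≥0∞} (hp : 1 ≤ p) (f : Lp 𝕜 p ν) {s : Set Ω} (hs : ν s < ∞) :
    IntegrableOn f s ν := by
  have : IsFiniteMeasure (ν.restrict s) := ⟨by rwa [Measure.restrict_apply_univ]⟩
  exact ((Lp.memLp f).restrict s).integrable hp

/-- Integrals over sets of finite measure are continuous on every `L^p`, hence commute with Bochner
integrals, and they separate functions. They serve as common test functionals for different
exponents. -/
theorem exists_clm_setIntegral (p : ℝ≥0∞) [hp : Fact (1 ≤ p)] {s : Set Ω} (hs : ν s < ∞) :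
    ∃ L : Lp 𝕜 p ν →L[ℝ] 𝕜, ∀ f, L f = ∫ x in s, f x ∂ν := by
  have hfin : IsFiniteMeasure (ν.restrict s) := ⟨by rwa [Measure.restrict_apply_univ]⟩
  have hint := fun f : Lp 𝕜 p ν => integrableOn_Lp hp.out f hs
  set K := (ν.restrict s) univ ^ (1 / (1 : ℝ≥0∞).toReal - 1 / p.toReal) with hK
  have hexp : 0 ≤ 1 / (1 : ℝ≥0∞).toReal - 1 / p.toReal := by
    rcases eq_or_ne p ∞ with h | h
    · simp [h]
    · have : 1 ≤ p.toReal := by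
        rw [← ENNReal.toReal_one]; exact ENNReal.toReal_mono h hp.out
      rw [ENNReal.toReal_one, sub_nonneg]
      gcongr
  have hKtop : K ≠ ∞ := ENNReal.rpow_ne_top_of_nonneg hexp (measure_ne_top _ _)
  let l : Lp 𝕜 p ν →ₗ[ℝ] 𝕜 :=
    { toFun := fun f => ∫ x in s, f x ∂ν
      map_add' := fun f g => by
        rw [← integral_add (hint f) (hint g)]
        exact integral_congr_ae (ae_restrict_of_ae (Lp.coeFn_add f g))
      map_smul' := fun c f => by
        rw [RingHom.id_apply, ← integral_smul]
        exact integral_congr_ae (ae_restrict_of_ae (Lp.coeFn_smul c f)) }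
  refine ⟨l.mkContinuous K.toReal fun f => ?_, fun f => rfl⟩
  have h1 : ‖∫ x in s, f x ∂ν‖ₑ ≤ eLpNorm f p ν * K := by
    refine (enorm_integral_le_lintegral_enorm _).trans ?_
    rw [← eLpNorm_one_eq_lintegral_enorm]
    refine (eLpNorm_le_eLpNorm_mul_rpow_measure_univ hp.out
      (Lp.aestronglyMeasurable f).restrict).trans ?_
    gcongr
    exact Measure.restrict_le_self
  have h2 := ENNReal.toReal_mono (ENNReal.mul_ne_top (Lp.eLpNorm_ne_top f) hKtop) h1
  rw [ENNReal.toReal_mul, toReal_enorm, mul_comm] at h2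
  exact h2

/-- Bochner integrals of two curves in Lebesgue spaces with different exponents are the same
function when the curves are. -/
theorem coeFn_intervalIntegral_ae_eq [SigmaFinite ν] {p p' : ℝ≥0∞} [hp : Fact (1 ≤ p)]
    [hp' : Fact (1 ≤ p')] {F : ℝ → Lp 𝕜 p ν} {G : ℝ → Lp 𝕜 p' ν} {a t : ℝ} (hat : a ≤ t)
    (hF : IntervalIntegrable F volume a t) (hG : IntervalIntegrable G volume a t)
    (h : ∀ᵐ τ : ℝ, τ ∈ Ioo a t → F τ =ᵐ[ν] G τ) :
    ⇑(∫ τ in a..t, F τ) =ᵐ[ν] ⇑(∫ τ in a..t, G τ) := by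
  refine ae_eq_of_forall_setIntegral_eq_of_sigmaFinite
    (fun s _ hs => integrableOn_Lp hp.out _ hs) (fun s _ hs => integrableOn_Lp hp'.out _ hs)
    fun s _ hs => ?_
  obtain ⟨L, hL⟩ := exists_clm_setIntegral (𝕜 := 𝕜) p hs
  obtain ⟨L', hL'⟩ := exists_clm_setIntegral (𝕜 := 𝕜) p' hs
  rw [← hL, ← hL', ← L.intervalIntegral_comp_comm hF, ← L'.intervalIntegral_comp_comm hG]
  refine intervalIntegral.integral_congr_ae ?_
  have hne : ∀ᵐ τ : ℝ, τ ≠ t := by simp [ae_iff]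
  filter_upwards [h, hne] with τ hτ hτt hmem
  rw [uIoc_of_le hat] at hmem
  rw [hL, hL']
  exact integral_congr_ae (ae_restrict_of_ae (hτ ⟨hmem.1, lt_of_le_of_ne hmem.2 hτt⟩))

end Bochner

/-! ### The semigroup between spaces with real exponents -/

section HeatFlow

/-- The Lebesgue space over `ℝⁿ` with a real exponent. -/
abbrev LpReal (𝕜 : Type*) [RCLike 𝕜] (n : ℕ) (ρ : ℝ) : Type _ :=
  Lp 𝕜 (ENNReal.ofReal ρ) (volume : Measure (EuclideanSpace ℝ (Fin n)))

/-- The fractional heat semigroup between Lebesgue spaces with real exponents. -/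
noncomputable abbrev heatFlow (𝕜 : Type*) [RCLike 𝕜] (n : ℕ) (α m ρ : ℝ)
    [Fact (1 ≤ ENNReal.ofReal m)] [Fact (1 ≤ ENNReal.ofReal ρ)] (t : ℝ) :
    LpReal 𝕜 n m →L[ℝ] LpReal 𝕜 n ρ :=
  heatOp 𝕜 n α (ENNReal.ofReal m) (ENNReal.ofReal ρ) t

/-- The decay rate of the fractional heat semigroup from `L^m` to `L^ρ`. -/
noncomputable def heatDecay (n : ℕ) (α m ρ : ℝ) : ℝ := n / (2 * α) * (m⁻¹ - ρ⁻¹)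

theorem heatDecay_self (n : ℕ) (α m : ℝ) : heatDecay n α m m = 0 := by simp [heatDecay]

theorem heatDecay_nonneg (n : ℕ) {α m ρ : ℝ} (hα : 0 < α) (hm : 0 < m) (hmρ : m ≤ ρ) :
    0 ≤ heatDecay n α m ρ := by
  have : ρ⁻¹ ≤ m⁻¹ := by gcongr
  exact mul_nonneg (by positivity) (sub_nonneg.2 this)

theorem heatDecay_add (n : ℕ) (α m ρ σ : ℝ) :
    heatDecay n α m ρ + heatDecay n α ρ σ = heatDecay n α m σ := by
  rw [heatDecay, heatDecay, heatDecay]; ring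

theorem one_le_of_fact {m : ℝ} [hm : Fact (1 ≤ ENNReal.ofReal m)] : 1 ≤ m := by
  simpa using hm.out

variable {𝕜 : Type*} [RCLike 𝕜] {n : ℕ} {α m ρ ρ' r : ℝ}
  [Fact (1 ≤ ENNReal.ofReal m)] [Fact (1 ≤ ENNReal.ofReal ρ)] [Fact (1 ≤ ENNReal.ofReal ρ')]
  [Fact (1 ≤ ENNReal.ofReal r)]

theorem exists_isSmoothingFamily_heatFlow (𝕜 : Type*) [RCLike 𝕜] (n : ℕ) (hα : 0 < α)
    (hmρ : m ≤ ρ) : ∃ A, IsSmoothingFamily (heatFlow 𝕜 n α m ρ) A (heatDecay n α m ρ) := by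
  have hm := one_le_of_fact (m := m)
  obtain ⟨A, hA0, hA⟩ := exists_norm_heatOp_le (m := ENNReal.ofReal m) (ρ := ENNReal.ofReal ρ) 𝕜 n
    hα (ENNReal.ofReal_le_ofReal hmρ) ENNReal.ofReal_ne_top
  refine ⟨A, hA0, fun t ht => ?_, fun z => continuousOn_heatOp hα (ENNReal.ofReal_le_ofReal hmρ)
    ENNReal.ofReal_ne_top z⟩
  have := hA t ht
  rwa [ENNReal.toReal_ofReal (by linarith), ENNReal.toReal_ofReal (by linarith)] at this

theorem coeFn_heatFlow (hα : 0 < α) (hmρ : m ≤ ρ) {t : ℝ} (ht : 0 < t) (f : LpReal 𝕜 n m) :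
    ⇑(heatFlow 𝕜 n α m ρ t f) =ᵐ[volume] fracHeatSemigroup α t f :=
  coeFn_heatOp hα (ENNReal.ofReal_le_ofReal hmρ) ENNReal.ofReal_ne_top ht f

theorem heatFlow_ae_eq_heatFlow (hα : 0 < α) (hmρ : m ≤ ρ) (hr : r ≤ ρ') {t : ℝ} (ht : 0 < t)
    {f : LpReal 𝕜 n m} {g : LpReal 𝕜 n r} (hfg : f =ᵐ[volume] g) :
    ⇑(heatFlow 𝕜 n α m ρ t f) =ᵐ[volume] ⇑(heatFlow 𝕜 n α r ρ' t g) := by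
  refine (coeFn_heatFlow hα hmρ ht f).trans ?_
  rw [fracHeatSemigroup_congr ht hfg]
  exact (coeFn_heatFlow hα hr ht g).symm

theorem heatFlow_heatFlow (hα : 0 < α) (hmr : m ≤ r) (hr : r ≤ ρ) {t s : ℝ} (ht : 0 < t)
    (hs : 0 < s) (f : LpReal 𝕜 n m) :
    heatFlow 𝕜 n α r ρ t (heatFlow 𝕜 n α m r s f) = heatFlow 𝕜 n α m ρ (t + s) f :=
  heatOp_heatOp hα (ENNReal.ofReal_le_ofReal hmr) (ENNReal.ofReal_le_ofReal hr)
    ENNReal.ofReal_ne_top ht hs f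

/-- Compare `φ` with `S(s)φ`: the difference contributes at most `A ‖φ - S(s)φ‖`, small for small
`s`, while `‖S(t+s)φ‖` stays bounded as `t → 0`, so that its weight `t^e` sends it to `0`. -/
theorem tendsto_rpow_mul_norm_heatFlow (hα : 0 < α) (hr : r ≤ ρ) (he : 0 < heatDecay n α r ρ)
    (φ : LpReal 𝕜 n r) :
    Tendsto (fun t => t ^ heatDecay n α r ρ * ‖heatFlow 𝕜 n α r ρ t φ‖) (𝓝[>] 0) (𝓝 0) := by
  set e := heatDecay n α r ρ with he_def
  obtain ⟨A, hA⟩ := exists_isSmoothingFamily_heatFlow 𝕜 n (m := r) hα hr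
  have hA0 := hA.nonneg
  have bound : ∀ t, 0 < t → ∀ ψ : LpReal 𝕜 n r, t ^ e * ‖heatFlow 𝕜 n α r ρ t ψ‖ ≤ A * ‖ψ‖ := by
    intro t ht ψ
    have h1 := (heatFlow 𝕜 n α r ρ t).le_of_opNorm_le (hA.norm_le t ht) ψ
    refine rpow_mul_norm_le ht (h1.trans (le_of_eq ?_))
    ring
  have hcont : Tendsto (fun s => heatFlow 𝕜 n α r r s φ) (𝓝[>] 0) (𝓝 φ) := by
    have h1 := continuousOn_heatOp_self (m := ENNReal.ofReal r) hα ENNReal.ofReal_ne_top φ 0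
      self_mem_Ici
    rw [ContinuousWithinAt, heatOp_zero hα ENNReal.ofReal_ne_top] at h1
    exact h1.mono_left (nhdsWithin_mono _ Ioi_subset_Ici_self)
  rw [tendsto_order]
  refine ⟨fun c hc => ?_, fun ε hε => ?_⟩
  · filter_upwards [self_mem_nhdsWithin] with t ht
    exact hc.trans_le (mul_nonneg (Real.rpow_nonneg (le_of_lt ht) _) (norm_nonneg _))
  have h1 : ∀ᶠ s in 𝓝[>] (0 : ℝ), A * ‖φ - heatFlow 𝕜 n α r r s φ‖ < ε / 2 := by
    have h2 : Tendsto (fun s => A * ‖φ - heatFlow 𝕜 n α r r s φ‖) (𝓝[>] 0) (𝓝 (A * ‖φ - φ‖)) :=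
      ((tendsto_const_nhds.sub hcont).norm).const_mul A
    rw [sub_self, norm_zero, mul_zero] at h2
    exact h2.eventually_lt_const (half_pos hε)
  obtain ⟨s, hs, hs0⟩ := (h1.and self_mem_nhdsWithin).exists
  have hs0' : (0 : ℝ) < s := hs0
  have h3 : Tendsto (fun t : ℝ => t ^ e * (A * s ^ (-e) * ‖φ‖)) (𝓝[>] 0) (𝓝 0) := by
    have h4 : Tendsto (fun t : ℝ => t ^ e) (𝓝[>] 0) (𝓝 (0 ^ e)) :=
      ((Real.continuousAt_rpow_const 0 e (Or.inr he.le)).tendsto).mono_left nhdsWithin_le_nhds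
    rw [Real.zero_rpow he.ne'] at h4
    simpa using h4.mul_const (A * s ^ (-e) * ‖φ‖)
  filter_upwards [h3.eventually_lt_const (half_pos hε), self_mem_nhdsWithin] with t ht ht0
  have ht0' : (0 : ℝ) < t := ht0
  have h5 : heatFlow 𝕜 n α r ρ t φ = heatFlow 𝕜 n α r ρ t (φ - heatFlow 𝕜 n α r r s φ)
      + heatFlow 𝕜 n α r ρ (t + s) φ := by
    rw [map_sub, heatFlow_heatFlow hα le_rfl hr ht0' hs0', sub_add_cancel]
  have h6 : ‖heatFlow 𝕜 n α r ρ (t + s) φ‖ ≤ A * s ^ (-e) * ‖φ‖ := by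
    refine (heatFlow 𝕜 n α r ρ (t + s)).le_of_opNorm_le ((hA.norm_le _ (by positivity)).trans ?_) φ
    gcongr A * ?_
    exact Real.rpow_le_rpow_of_nonpos hs0' (by linarith) (by linarith)
  calc t ^ e * ‖heatFlow 𝕜 n α r ρ t φ‖
      ≤ t ^ e * (‖heatFlow 𝕜 n α r ρ t (φ - heatFlow 𝕜 n α r r s φ)‖
        + ‖heatFlow 𝕜 n α r ρ (t + s) φ‖) := by
        rw [h5]
        gcongr
        exact norm_add_le _ _
    _ ≤ A * ‖φ - heatFlow 𝕜 n α r r s φ‖ + t ^ e * (A * s ^ (-e) * ‖φ‖) := by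
        rw [mul_add]
        exact add_le_add (bound t ht0' _) (by gcongr)
    _ < ε := by linarith

theorem duhamel_heatFlow_ae_eq {F : ℝ → LpReal 𝕜 n m} {G : ℝ → LpReal 𝕜 n r} (hα : 0 < α)
    (hmρ : m ≤ ρ) (hr : r ≤ ρ') {t : ℝ} (ht : 0 ≤ t)
    (hF : IntervalIntegrable (fun τ => heatFlow 𝕜 n α m ρ (t - τ) (F τ)) volume 0 t)
    (hG : IntervalIntegrable (fun τ => heatFlow 𝕜 n α r ρ' (t - τ) (G τ)) volume 0 t)
    (h : ∀ τ ∈ Ioo 0 t, F τ =ᵐ[volume] G τ) :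
    ⇑(duhamel (heatFlow 𝕜 n α m ρ) F t) =ᵐ[volume] ⇑(duhamel (heatFlow 𝕜 n α r ρ') G t) :=
  coeFn_intervalIntegral_ae_eq ht hF hG <| Eventually.of_forall fun τ hτ =>
    heatFlow_ae_eq_heatFlow hα hmρ hr (sub_pos.2 hτ.2) (h τ hτ)

end HeatFlow

/-! ### Intervals of positive times -/

section Times

/-- The positive times in `[0, T)`. -/
def posTimes (T : EReal) : Set ℝ := {t | 0 < t ∧ (t : EReal) < T}

theorem isOpen_posTimes (T : EReal) : IsOpen (posTimes T) :=
  (isOpen_lt continuous_const continuous_id).inter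
    (isOpen_lt continuous_coe_real_ereal continuous_const)

theorem posTimes_subset_Ioi (T : EReal) : posTimes T ⊆ Ioi 0 := fun _ h => h.1

theorem Ioo_subset_posTimes {T : EReal} {t : ℝ} (ht : t ∈ posTimes T) : Ioo 0 t ⊆ posTimes T :=
  fun _ hs => ⟨hs.1, (EReal.coe_lt_coe_iff.2 hs.2).trans ht.2⟩

theorem mem_posTimes_of_mem {T : EReal} {t : ℝ} (ht : t ∈ timeInterval T) (h0 : 0 < t) :
    t ∈ posTimes T := ⟨h0, ht.2⟩

theorem posTimes_subset_timeInterval (T : EReal) : posTimes T ⊆ timeInterval T :=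
  fun _ h => ⟨h.1.le, h.2⟩

theorem timeInterval_inter_Ioi (T : EReal) : timeInterval T ∩ Ioi 0 = posTimes T := by
  ext t
  simp only [timeInterval, posTimes, mem_inter_iff, Set.mem_ofPred_eq, mem_Ioi]
  exact ⟨fun h => ⟨h.2, h.1.2⟩, fun h => ⟨⟨h.1.le, h.2⟩, h.1⟩⟩

theorem eventually_mem_posTimes {T : EReal} (hT : 0 < T) :
    ∀ᶠ t in 𝓝[>] (0 : ℝ), t ∈ posTimes T := by
  have h1 : ∀ᶠ t : ℝ in 𝓝 (0 : ℝ), (t : EReal) < T :=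
    (isOpen_lt continuous_coe_real_ereal continuous_const).mem_nhds (by simpa using hT)
  filter_upwards [self_mem_nhdsWithin, nhdsWithin_le_nhds h1] with t h2 h3
  exact ⟨h2, h3⟩

theorem continuousOn_timeInterval {B : Type*} [TopologicalSpace B] {T : EReal} {u : ℝ → B}
    (h1 : ContinuousOn u (posTimes T)) (h0 : Tendsto u (𝓝[>] 0) (𝓝 (u 0))) :
    ContinuousOn u (timeInterval T) := by
  intro t ht
  rcases ht.1.eq_or_lt with h | h
  · subst h
    have h2 : ContinuousWithinAt u (Ici 0) 0 := by
      rw [← Ioi_insert, continuousWithinAt_insert_self]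
      exact h0
    exact h2.mono fun s hs => hs.1
  · exact (h1.continuousAt ((isOpen_posTimes T).mem_nhds ⟨h, ht.2⟩)).continuousWithinAt

end Times

/-! ### Exponents, power counting and forcing terms -/

section Forcing

/-- Power counting for the Duhamel term: `P` cancels, and beyond the natural weight in `L^ρ` there
remains `t^{1 - r₀/r}`, which is constant exactly at the critical exponent. -/
theorem heatDecay_exponent_eq (n : ℕ) (α b r P ρ : ℝ) :
    1 - heatDecay n α (P / (b + 1)) ρ - (b + 1) * heatDecay n α r P
    = (1 - n * b / (2 * α) / r) - heatDecay n α r ρ := by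
  rw [heatDecay, heatDecay, heatDecay, inv_div]
  ring

theorem heatDecay_exponent_self_eq (n : ℕ) (α b r P : ℝ) :
    1 - heatDecay n α (P / (b + 1)) P - b * heatDecay n α r P
    = 1 - n * b / (2 * α) / r := by
  have := heatDecay_exponent_eq n α b r P P
  linarith

/-- `P` is an exponent in which the fixed point argument for the Cauchy problem with data in `L^r`
can be run. -/
structure IsAuxExponent (n : ℕ) (α b r P : ℝ) : Prop where
  α_pos : 0 < α
  b_pos : 0 < b
  one_lt : 1 < r
  critical_le : n * b / (2 * α) ≤ r
  dim_pos : 0 < n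
  lt : r < P
  le : b + 1 ≤ P
  lt_mul : P < r * (b + 1)

namespace IsAuxExponent
variable {n : ℕ} {α b r P : ℝ} (h : IsAuxExponent n α b r P)
include h

theorem pos : 0 < P := by linarith [h.one_lt, h.lt]

theorem r_pos : 0 < r := by linarith [h.one_lt]

theorem succ_pos : 0 < b + 1 := by linarith [h.b_pos]

theorem one_le_div : 1 ≤ P / (b + 1) := by
  rw [_root_.one_le_div h.succ_pos]; exact h.le

theorem div_lt : P / (b + 1) < r := by
  rw [div_lt_iff₀ h.succ_pos]; exact h.lt_mul

theorem heatDecay_pos {ρ : ℝ} (hρ : r < ρ) : 0 < heatDecay n α r ρ := by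
  have h1 : ρ⁻¹ < r⁻¹ := inv_strictAnti₀ h.r_pos hρ
  have h2 := h.dim_pos
  have h3 := h.α_pos
  exact mul_pos (by positivity) (sub_pos.2 h1)

theorem critical_div_le_one : n * b / (2 * α) / r ≤ 1 := by
  rw [div_le_one h.r_pos]; exact h.critical_le

/-- Integrability of the forcing at `τ = 0`: the left side is `r₀/r` minus the decay from
`L^{P/(b+1)}` to `L^r`, which is positive because `P < r(b+1)`. -/
theorem succ_mul_heatDecay_lt : (b + 1) * heatDecay n α r P < 1 := by
  refine lt_of_lt_of_le ?_ h.critical_div_le_one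
  have h1 : r⁻¹ < (P / (b + 1))⁻¹ := inv_strictAnti₀ (by linarith [h.one_le_div]) h.div_lt
  have h2 : (0 : ℝ) < n := by exact_mod_cast h.dim_pos
  have h3 := h.α_pos
  have h4 : (b + 1) * heatDecay n α r P
      = n * b / (2 * α) / r - n / (2 * α) * ((P / (b + 1))⁻¹ - r⁻¹) := by
    rw [heatDecay, inv_div]; field_simp; ring
  rw [h4]
  have := mul_pos (div_pos h2 (by positivity : 0 < 2 * α)) (sub_pos.2 h1)
  linarith

/-- Integrability of the semigroup singularity at `τ = t`: the decay is `r₀/P`, below `r₀/r ≤ 1`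
because `r < P`. -/
theorem decay_self_lt : heatDecay n α (P / (b + 1)) P < 1 := by
  refine lt_of_lt_of_le ?_ h.critical_div_le_one
  have h1 : P⁻¹ < r⁻¹ := inv_strictAnti₀ h.r_pos h.lt
  have h2 : (0 : ℝ) < n := by exact_mod_cast h.dim_pos
  have h3 := h.α_pos
  have h4 := h.b_pos
  have h5 : heatDecay n α (P / (b + 1)) P = n * b / (2 * α) * P⁻¹ := by
    rw [heatDecay, inv_div]; ring
  rw [h5, div_eq_mul_inv _ r]
  gcongr

theorem decay_r_lt : heatDecay n α (P / (b + 1)) r < 1 := by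
  refine lt_of_le_of_lt ?_ h.decay_self_lt
  have := heatDecay_add n α (P / (b + 1)) r P
  have := h.heatDecay_pos h.lt
  linarith

theorem theta_nonneg : 0 ≤ 1 - n * b / (2 * α) / r := sub_nonneg.2 h.critical_div_le_one

theorem fact_pos : Fact (1 ≤ ENNReal.ofReal P) := ⟨by
  rw [ENNReal.one_le_ofReal]; linarith [h.one_lt, h.lt]⟩

theorem fact_div : Fact (1 ≤ ENNReal.ofReal (P / (b + 1))) := ⟨by
  rw [ENNReal.one_le_ofReal]; exact h.one_le_div⟩

end IsAuxExponent

variable {𝕜 : Type*} [RCLike 𝕜] {n : ℕ} {α b r P ρ : ℝ} [Fact (1 ≤ ENNReal.ofReal (P / (b + 1)))]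
  [Fact (1 ≤ ENNReal.ofReal ρ)] {A : ℝ} {F : ℝ → LpReal 𝕜 n (P / (b + 1))} {T : EReal} {B : ℝ}

theorem rpow_mul_norm_duhamel_le (h : IsAuxExponent n α b r P)
    (hS : IsSmoothingFamily (heatFlow 𝕜 n α (P / (b + 1)) ρ) A (heatDecay n α (P / (b + 1)) ρ))
    (hγ : heatDecay n α (P / (b + 1)) ρ < 1) {t η : ℝ} (ht : 0 < t) (hη : 0 ≤ η)
    (hF : ∀ τ ∈ Ioo 0 t, ‖F τ‖ ≤ η * τ ^ (-((b + 1) * heatDecay n α r P))) :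
    t ^ heatDecay n α r ρ * ‖duhamel (heatFlow 𝕜 n α (P / (b + 1)) ρ) F t‖
      ≤ A * η * betaConst (heatDecay n α (P / (b + 1)) ρ) ((b + 1) * heatDecay n α r P)
        * t ^ (1 - n * b / (2 * α) / r) := by
  have h1 := hS.norm_duhamel_le hγ h.succ_mul_heatDecay_lt le_rfl ht hη hF
  rw [heatDecay_exponent_eq] at h1
  refine (mul_le_mul_of_nonneg_left h1 (by positivity)).trans (le_of_eq ?_)
  rw [mul_left_comm, ← Real.rpow_add ht]
  congr 2
  ring

/-- The forcing terms of the Cauchy problem with data in `L^r`, as curves in `L^(P/(b+1))`. -/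
structure IsForcing (α b r P : ℝ) [Fact (1 ≤ ENNReal.ofReal (P / (b + 1)))] (T : EReal)
    (F : ℝ → LpReal 𝕜 n (P / (b + 1))) (B : ℝ) : Prop where
  nonneg : 0 ≤ B
  continuousOn : ContinuousOn F (posTimes T)
  norm_le : ∀ τ ∈ posTimes T, ‖F τ‖ ≤ B * τ ^ (-((b + 1) * heatDecay n α r P))
  small : ∀ η, 0 < η → ∃ δ, 0 < δ ∧ ∀ τ ∈ posTimes T, τ < δ →
    ‖F τ‖ ≤ η * τ ^ (-((b + 1) * heatDecay n α r P))

/-- At `r = r₀` the factor `t^{1 - r₀/r}` does not decay, so the limit has to come from the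
arbitrarily small coefficient of the forcing near `0`. This is the reason for the field `small` of
`IsForcing`. -/
theorem IsForcing.tendsto_duhamel (hF : IsForcing α b r P T F B) (h : IsAuxExponent n α b r P)
    (hT : 0 < T) (hρ : P / (b + 1) ≤ ρ) (hγ : heatDecay n α (P / (b + 1)) ρ < 1) :
    Tendsto (fun t => t ^ heatDecay n α r ρ * ‖duhamel (heatFlow 𝕜 n α (P / (b + 1)) ρ) F t‖)
      (𝓝[>] 0) (𝓝 0) := by
  obtain ⟨A, hS⟩ := exists_isSmoothingFamily_heatFlow 𝕜 n h.α_pos hρ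
  have hA := hS.nonneg
  set β := betaConst (heatDecay n α (P / (b + 1)) ρ) ((b + 1) * heatDecay n α r P)
  have hβ : 0 ≤ β := betaConst_nonneg _ _
  rw [tendsto_order]
  refine ⟨fun c hc => ?_, fun ε hε => ?_⟩
  · filter_upwards [self_mem_nhdsWithin] with t ht
    exact hc.trans_le (mul_nonneg (Real.rpow_nonneg (le_of_lt ht) _) (norm_nonneg _))
  obtain ⟨δ, hδ, hFδ⟩ := hF.small (ε / (A * β + 1)) (by positivity)
  filter_upwards [eventually_mem_posTimes hT, Ioo_mem_nhdsGT hδ, Ioo_mem_nhdsGT one_pos]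
    with t htT htδ ht1
  have ht := htT.1
  refine (rpow_mul_norm_duhamel_le h hS hγ ht (by positivity) fun τ hτ =>
    hFδ τ (Ioo_subset_posTimes htT hτ) (hτ.2.trans htδ.2)).trans_lt ?_
  have h1 : t ^ (1 - n * b / (2 * α) / r) ≤ 1 := Real.rpow_le_one ht.le ht1.2.le h.theta_nonneg
  calc A * (ε / (A * β + 1)) * β * t ^ (1 - n * b / (2 * α) / r)
      ≤ A * (ε / (A * β + 1)) * β * 1 := by gcongr
    _ = ε * (A * β / (A * β + 1)) := by ring
    _ < ε * 1 := by
        gcongr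
        rw [div_lt_one (by positivity)]
        linarith
    _ = ε := mul_one _

theorem IsForcing.intervalIntegrable (hF : IsForcing α b r P T F B) (h : IsAuxExponent n α b r P)
    (hρ : P / (b + 1) ≤ ρ) (hγ : heatDecay n α (P / (b + 1)) ρ < 1) {t : ℝ}
    (ht : t ∈ posTimes T) :
    IntervalIntegrable (fun τ => heatFlow 𝕜 n α (P / (b + 1)) ρ (t - τ) (F τ)) volume 0 t := by
  obtain ⟨A, hS⟩ := exists_isSmoothingFamily_heatFlow 𝕜 n h.α_pos hρ
  exact hS.intervalIntegrable hγ h.succ_mul_heatDecay_lt ht.1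
    (hF.continuousOn.mono (Ioo_subset_posTimes ht)) hF.nonneg
    fun τ hτ => hF.norm_le τ (Ioo_subset_posTimes ht hτ)

theorem IsForcing.continuousOn_duhamel (hF : IsForcing α b r P T F B)
    (h : IsAuxExponent n α b r P) (hρ : P / (b + 1) ≤ ρ)
    (hγ : heatDecay n α (P / (b + 1)) ρ < 1) :
    ContinuousOn (duhamel (heatFlow 𝕜 n α (P / (b + 1)) ρ) F) (posTimes T) := by
  obtain ⟨A, hS⟩ := exists_isSmoothingFamily_heatFlow 𝕜 n h.α_pos hρ
  exact hS.continuousOn_duhamel hγ h.succ_mul_heatDecay_lt (isOpen_posTimes T)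
    (posTimes_subset_Ioi T) (fun t ht => Ioo_subset_posTimes ht) hF.continuousOn hF.nonneg
    hF.norm_le

end Forcing

/-! ### The Duhamel formula read in several Lebesgue spaces -/

section MildCurve
variable {𝕜 : Type*} [RCLike 𝕜] {n : ℕ} {α b r P ρ ρ' : ℝ}
  [Fact (1 ≤ ENNReal.ofReal (P / (b + 1)))] [Fact (1 ≤ ENNReal.ofReal ρ)]
  [Fact (1 ≤ ENNReal.ofReal ρ')]
  {F : ℝ → LpReal 𝕜 n (P / (b + 1))} {T : EReal} {B : ℝ}

/-- The right-hand side of the Duhamel formula, as a curve in `L^ρ`. -/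
noncomputable def mildCurve (α : ℝ) {r m : ℝ} [Fact (1 ≤ ENNReal.ofReal r)]
    [Fact (1 ≤ ENNReal.ofReal m)] (ρ : ℝ) [Fact (1 ≤ ENNReal.ofReal ρ)] (φ : LpReal 𝕜 n r) (F : ℝ → LpReal 𝕜 n m) (t : ℝ) :
    LpReal 𝕜 n ρ :=
  heatFlow 𝕜 n α r ρ t φ + duhamel (heatFlow 𝕜 n α m ρ) F t

theorem IsForcing.continuousOn_mildCurve (hF : IsForcing α b r P T F B)
    (h : IsAuxExponent n α b r P) {s : ℝ} [Fact (1 ≤ ENNReal.ofReal s)] (φ : LpReal 𝕜 n s)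
    (hs : s ≤ ρ) (hρ : r ≤ ρ) (hγ : heatDecay n α (P / (b + 1)) ρ < 1) :
    ContinuousOn (mildCurve α ρ φ F) (posTimes T) :=
  ((continuousOn_heatOp h.α_pos (ENNReal.ofReal_le_ofReal hs) ENNReal.ofReal_ne_top φ).mono
    (posTimes_subset_Ioi T)).add (hF.continuousOn_duhamel h (h.div_lt.le.trans hρ) hγ)

variable [Fact (1 ≤ ENNReal.ofReal r)]

theorem mildCurve_zero {m : ℝ} [Fact (1 ≤ ENNReal.ofReal m)] (hα : 0 < α) (φ : LpReal 𝕜 n r)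
    (F : ℝ → LpReal 𝕜 n m) : mildCurve α r φ F 0 = φ := by
  rw [mildCurve, heatFlow, heatOp_zero hα ENNReal.ofReal_ne_top, duhamel,
    intervalIntegral.integral_same, add_zero]

/-- One forcing gives one function, whatever space the integral is taken in. This identifies the
fixed point in `L^P` with the solution in `L^r` and its values in `L^p`. -/
theorem IsForcing.mildCurve_ae_eq (hF : IsForcing α b r P T F B) (h : IsAuxExponent n α b r P)
    {s : ℝ} [Fact (1 ≤ ENNReal.ofReal s)] {φ : LpReal 𝕜 n r} {ψ : LpReal 𝕜 n s}
    (hφψ : φ =ᵐ[volume] ψ) (hρ : r ≤ ρ) (hγ : heatDecay n α (P / (b + 1)) ρ < 1)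
    (hs : s ≤ ρ') (hρ' : r ≤ ρ') (hγ' : heatDecay n α (P / (b + 1)) ρ' < 1) {t : ℝ}
    (ht : t ∈ posTimes T) :
    ⇑(mildCurve α ρ φ F t) =ᵐ[volume] ⇑(mildCurve α ρ' ψ F t) := by
  have h1 := h.div_lt.le.trans hρ
  have h2 := h.div_lt.le.trans hρ'
  have h3 := heatFlow_ae_eq_heatFlow (𝕜 := 𝕜) (n := n) h.α_pos hρ hs ht.1 hφψ
  have h4 := duhamel_heatFlow_ae_eq (𝕜 := 𝕜) (n := n) h.α_pos h1 h2 (le_of_lt ht.1)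
    (hF.intervalIntegrable h h1 hγ ht) (hF.intervalIntegrable h h2 hγ' ht) fun _ _ => ae_eq_rfl
  exact (Lp.coeFn_add _ _).trans ((h3.add h4).trans (Lp.coeFn_add _ _).symm)

theorem IsForcing.tendsto_rpow_mul_norm_mildCurve (hF : IsForcing α b r P T F B)
    (h : IsAuxExponent n α b r P) (hT : 0 < T) (φ : LpReal 𝕜 n r) (hρ : r < ρ)
    (hγ : heatDecay n α (P / (b + 1)) ρ < 1) :
    Tendsto (fun t => t ^ heatDecay n α r ρ * ‖mildCurve α ρ φ F t‖) (𝓝[>] 0) (𝓝 0) := by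
  have h1 := (tendsto_rpow_mul_norm_heatFlow h.α_pos hρ.le (h.heatDecay_pos hρ) φ).add
    (hF.tendsto_duhamel h hT (h.div_lt.le.trans hρ.le) hγ)
  rw [add_zero] at h1
  refine squeeze_zero' ?_ ?_ h1
  · filter_upwards [self_mem_nhdsWithin] with t ht
    exact mul_nonneg (Real.rpow_nonneg (le_of_lt ht) _) (norm_nonneg _)
  · filter_upwards [self_mem_nhdsWithin] with t ht
    rw [← mul_add]
    exact mul_le_mul_of_nonneg_left (norm_add_le _ _) (Real.rpow_nonneg (le_of_lt ht) _)

theorem IsForcing.tendsto_mildCurve_self (hF : IsForcing α b r P T F B)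
    (h : IsAuxExponent n α b r P) (hT : 0 < T) (φ : LpReal 𝕜 n r) :
    Tendsto (mildCurve α r φ F) (𝓝[>] 0) (𝓝 φ) := by
  have h1 := continuousOn_heatOp_self (m := ENNReal.ofReal r) h.α_pos ENNReal.ofReal_ne_top φ 0
    self_mem_Ici
  rw [ContinuousWithinAt, heatOp_zero h.α_pos ENNReal.ofReal_ne_top] at h1
  have h2 := hF.tendsto_duhamel h hT h.div_lt.le h.decay_r_lt
  simp only [heatDecay_self, Real.rpow_zero, one_mul] at h2
  have h3 := (h1.mono_left (nhdsWithin_mono _ Ioi_subset_Ici_self)).add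
    (tendsto_zero_iff_norm_tendsto_zero.2 h2)
  rwa [add_zero] at h3

end MildCurve

/-! ### From the fixed point to mild solutions -/

section Existence
variable {𝕜 : Type*} [RCLike 𝕜] {n : ℕ} {α b r p P ρ : ℝ}
  [Fact (1 ≤ ENNReal.ofReal (P / (b + 1)))] [Fact (1 ≤ ENNReal.ofReal ρ)]
  [Fact (1 ≤ ENNReal.ofReal p)]

theorem exists_rpow_mul_norm_mildCurve_le (𝕜 : Type*) [RCLike 𝕜]
    [Fact (1 ≤ ENNReal.ofReal r)] (h : IsAuxExponent n α b r P)
    (hρ : r ≤ ρ) (hγ : heatDecay n α (P / (b + 1)) ρ < 1) :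
    ∃ C : ℝ, 0 ≤ C ∧ ∀ (φ : LpReal 𝕜 n r) (T : EReal) (F : ℝ → LpReal 𝕜 n (P / (b + 1)))
      (B Λ : ℝ), IsForcing α b r P T F B →
      (∀ t ∈ posTimes T, t ^ (1 - n * b / (2 * α) / r) ≤ Λ) →
      ∀ t ∈ posTimes T, t ^ heatDecay n α r ρ * ‖mildCurve α ρ φ F t‖ ≤ C * (‖φ‖ + B * Λ) := by
  obtain ⟨A₁, hS₁⟩ := exists_isSmoothingFamily_heatFlow 𝕜 n h.α_pos hρ
  obtain ⟨A₂, hS₂⟩ := exists_isSmoothingFamily_heatFlow 𝕜 n h.α_pos (h.div_lt.le.trans hρ)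
  set β := betaConst (heatDecay n α (P / (b + 1)) ρ) ((b + 1) * heatDecay n α r P)
  have hβ : 0 ≤ β := betaConst_nonneg _ _
  have hA₁ := hS₁.nonneg
  have hA₂ := hS₂.nonneg
  refine ⟨max A₁ (A₂ * β), le_max_of_le_left hA₁, fun φ T F B Λ hF hΛ t ht => ?_⟩
  have ht0 : 0 < t := ht.1
  have hB := hF.nonneg
  have hΛ0 : 0 ≤ Λ := (Real.rpow_nonneg ht0.le _).trans (hΛ t ht)
  have h1 : t ^ heatDecay n α r ρ * ‖heatFlow 𝕜 n α r ρ t φ‖ ≤ A₁ * ‖φ‖ := by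
    refine rpow_mul_norm_le ht0 (((heatFlow 𝕜 n α r ρ t).le_of_opNorm_le
      (hS₁.norm_le t ht0) φ).trans (le_of_eq ?_))
    ring
  have h2 := rpow_mul_norm_duhamel_le h hS₂ hγ ht0 hB fun τ hτ =>
    hF.norm_le τ (Ioo_subset_posTimes ht hτ)
  calc t ^ heatDecay n α r ρ * ‖mildCurve α ρ φ F t‖
      ≤ A₁ * ‖φ‖ + A₂ * B * β * t ^ (1 - n * b / (2 * α) / r) := by
        refine (mul_le_mul_of_nonneg_left (norm_add_le _ _) (by positivity)).trans ?_
        rw [mul_add]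
        exact add_le_add h1 h2
    _ ≤ A₁ * ‖φ‖ + A₂ * B * β * Λ := by
        gcongr
        exact hΛ t ht
    _ = A₁ * ‖φ‖ + (A₂ * β) * (B * Λ) := by ring
    _ ≤ max A₁ (A₂ * β) * ‖φ‖ + max A₁ (A₂ * β) * (B * Λ) := by
        gcongr
        · exact le_max_left _ _
        · exact le_max_right _ _
    _ = _ := by ring

variable {F : ℝ → LpReal 𝕜 n (P / (b + 1))} {T : EReal} {B : ℝ}

/-- For data in `L^p` and a forcing with the milder singularity `τ^{-δ}`, the Duhamel term is
`O(t^c)` in `L^p` with `c > 0`. Thus the curve is continuous in `L^p` at `t = 0` without weight, as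
a restart requires. -/
theorem IsForcing.memCb_mildCurve (hF : IsForcing α b r P T F B) (h : IsAuxExponent n α b r P)
    (hT : 0 < T) (hT' : T ≠ ⊤) (ψ : LpReal 𝕜 n p) (hrp : r ≤ p)
    (hγ : heatDecay n α (P / (b + 1)) p < 1) {δ B' : ℝ} (hδ : δ ≤ (b + 1) * heatDecay n α r P)
    (hδ' : 0 < 1 - heatDecay n α (P / (b + 1)) p - δ) (hB' : 0 ≤ B')
    (hFB : ∀ τ ∈ posTimes T, ‖F τ‖ ≤ B' * τ ^ (-δ)) :
    MemCb (timeInterval T) (mildCurve α p ψ F) := by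
  obtain ⟨A₁, hS₁⟩ := exists_isSmoothingFamily_heatFlow 𝕜 n h.α_pos (le_refl p)
  obtain ⟨A₂, hS₂⟩ := exists_isSmoothingFamily_heatFlow 𝕜 n h.α_pos (h.div_lt.le.trans hrp)
  have hA₁ := hS₁.nonneg
  have hA₂ := hS₂.nonneg
  set β := betaConst (heatDecay n α (P / (b + 1)) p) ((b + 1) * heatDecay n α r P)
  have hβ : 0 ≤ β := betaConst_nonneg _ _
  set c := 1 - heatDecay n α (P / (b + 1)) p - δ with hc
  have hduh : ∀ t ∈ posTimes T, ‖duhamel (heatFlow 𝕜 n α (P / (b + 1)) p) F t‖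
      ≤ A₂ * B' * β * t ^ c := fun t ht =>
    hS₂.norm_duhamel_le hγ h.succ_mul_heatDecay_lt hδ ht.1 hB' fun τ hτ =>
      hFB τ (Ioo_subset_posTimes ht hτ)
  refine ⟨continuousOn_timeInterval (hF.continuousOn_mildCurve h ψ le_rfl hrp hγ) ?_, ?_⟩
  · rw [mildCurve_zero h.α_pos]
    have h1 := continuousOn_heatOp_self (m := ENNReal.ofReal p) h.α_pos ENNReal.ofReal_ne_top ψ 0
      self_mem_Ici
    rw [ContinuousWithinAt, heatOp_zero h.α_pos ENNReal.ofReal_ne_top] at h1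
    have h2 : Tendsto (fun t : ℝ => A₂ * B' * β * t ^ c) (𝓝[>] 0) (𝓝 0) := by
      have h3 : Tendsto (fun t : ℝ => t ^ c) (𝓝[>] 0) (𝓝 (0 ^ c)) :=
        ((Real.continuousAt_rpow_const 0 c (Or.inr hδ'.le)).tendsto).mono_left nhdsWithin_le_nhds
      rw [Real.zero_rpow hδ'.ne'] at h3
      simpa using h3.const_mul (A₂ * B' * β)
    have h4 : Tendsto (duhamel (heatFlow 𝕜 n α (P / (b + 1)) p) F) (𝓝[>] 0) (𝓝 0) :=
      squeeze_zero_norm' ((eventually_mem_posTimes hT).mono hduh) h2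
    have h5 := (h1.mono_left (nhdsWithin_mono _ Ioi_subset_Ici_self)).add h4
    rwa [add_zero] at h5
  · lift T to ℝ using ⟨hT', (bot_le.trans_lt hT).ne'⟩
    have hT0 : (0 : ℝ) < T := by exact_mod_cast hT
    refine ⟨max ‖ψ‖ (A₁ * ‖ψ‖ + A₂ * B' * β * T ^ c), fun t ht => ?_⟩
    rcases ht.1.eq_or_lt with h0 | h0
    · rw [← h0, mildCurve_zero h.α_pos]
      exact le_max_left _ _
    · refine le_max_of_le_right ((norm_add_le _ _).trans (add_le_add ?_ ?_))
      · have := (heatFlow 𝕜 n α p p t).le_of_opNorm_le (hS₁.norm_le t h0) ψ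
        rwa [heatDecay_self, neg_zero, Real.rpow_zero, mul_one] at this
      · refine (hduh t (mem_posTimes_of_mem ht h0)).trans ?_
        have : t ≤ T := (EReal.coe_lt_coe_iff.1 ht.2).le
        gcongr

variable [Fact (1 ≤ ENNReal.ofReal r)] [Fact (1 ≤ ENNReal.ofReal P)]

/-- The fixed point in `L^P`, recorded through its forcing: from the forcing the solution can be
rebuilt in any other `L^ρ`. -/
theorem exists_forcing_of_small (𝕜 : Type*) [RCLike 𝕜] (μ : ℝ) (h : IsAuxExponent n α b r P) :
    ∃ K : ℝ, 0 ≤ K ∧ ∀ (φ : LpReal 𝕜 n r) (T : EReal) (Λ R : ℝ), 0 < T → 0 ≤ Λ → 0 ≤ R →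
      K * Λ * R ^ b ≤ 1 → (∀ t ∈ posTimes T, t ^ (1 - n * b / (2 * α) / r) ≤ Λ) →
      (∀ t ∈ posTimes T, t ^ heatDecay n α r P * ‖heatFlow 𝕜 n α r P t φ‖ ≤ R / 2) →
      ∃ F : ℝ → LpReal 𝕜 n (P / (b + 1)),
        IsForcing α b r P T F (|μ| * (b + 2) * R ^ b * R) ∧
        (∀ t ∈ posTimes T, F t = powerOp μ b _ (mildCurve α P φ F t)) ∧
        ∀ σ R', 0 ≤ σ → σ ≤ heatDecay n α r P →
          (∀ t ∈ posTimes T, t ^ σ * ‖heatFlow 𝕜 n α r P t φ‖ ≤ R' / 2) →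
          ∀ t ∈ posTimes T, t ^ σ * ‖mildCurve α P φ F t‖ ≤ R' := by
  have hm : P / (b + 1) ≤ P := (h.div_lt.trans h.lt).le
  obtain ⟨A, hS⟩ := exists_isSmoothingFamily_heatFlow 𝕜 n h.α_pos hm
  have hA := hS.nonneg
  have hb := h.b_pos
  set κ := |μ| * (b + 2) with hκ_def
  have hκ : 0 ≤ κ := by positivity
  set e := heatDecay n α r P with he_def
  have he : 0 < e := h.heatDecay_pos h.lt
  set γ := heatDecay n α (P / (b + 1)) P with hγ_def
  refine ⟨4 * A * κ * betaConst γ ((b + 1) * e), mul_nonneg (by positivity) (betaConst_nonneg _ _),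
    fun φ T Λ R hT hΛ hR hsmall htΛ hφ => ?_⟩
  have hN := isPowerLipschitz_powerOp (𝕜 := 𝕜)
    (ν := (volume : Measure (EuclideanSpace ℝ (Fin n)))) μ hb h.le
  have htΛ' : ∀ t ∈ posTimes T, t ^ (1 - γ - b * e) ≤ Λ := by
    rw [hγ_def, he_def, heatDecay_exponent_self_eq]
    exact htΛ
  have ha : ContinuousOn (fun t => heatFlow 𝕜 n α r P t φ) (posTimes T) :=
    (continuousOn_heatOp h.α_pos (ENNReal.ofReal_le_ofReal h.lt.le) ENNReal.ofReal_ne_top φ).mono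
      (posTimes_subset_Ioi T)
  obtain ⟨w, hw, hweq, hwb⟩ := exists_mildSolution_of_small hS h.decay_self_lt hN hb he.le
    h.succ_mul_heatDecay_lt (isOpen_posTimes T) (posTimes_subset_Ioi T)
    (fun t ht => Ioo_subset_posTimes ht) hΛ hR htΛ' hsmall ha hφ
  have hwR := hwb e R (posTimes T) subset_rfl (fun t ht => Ioo_subset_posTimes ht) he.le le_rfl hφ
  refine ⟨fun τ => powerOp μ b _ (w τ), ⟨by positivity, ?_, ?_, ?_⟩, ?_, ?_⟩
  · exact (hN.continuous hb).comp_continuousOn hw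
  · intro τ hτ
    refine (hN.norm_comp_le hb hτ.1 hR (hwR τ hτ) (hwR τ hτ)).trans (le_of_eq ?_)
    rw [show b * e + e = (b + 1) * e by ring]
  · intro η hη
    -- Chosen so that `κ R₁^{b+1} = κ η/(κ+1) ≤ η`. As the linear part is below `R₁/2` on a short
    -- interval, the inherited bounds give `R₁` there.
    set R₁ : ℝ := (η / (κ + 1)) ^ (b + 1)⁻¹ with hR₁
    have hb1 := h.succ_pos
    have hR₁0 : 0 < R₁ := by positivity
    have hR₁η : κ * R₁ ^ b * R₁ ≤ η := by
      have h1 : R₁ ^ b * R₁ = η / (κ + 1) := by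
        rw [← Real.rpow_add_one hR₁0.ne', hR₁, ← Real.rpow_mul (by positivity),
          inv_mul_cancel₀ hb1.ne', Real.rpow_one]
      rw [mul_assoc, h1, ← mul_div_assoc, div_le_iff₀ (by positivity)]
      nlinarith
    have h2 := ((tendsto_rpow_mul_norm_heatFlow h.α_pos h.lt.le he φ).eventually_lt_const
      (half_pos hR₁0))
    rw [eventually_nhdsWithin_iff, Metric.eventually_nhds_iff] at h2
    obtain ⟨δ, hδ, hδ'⟩ := h2
    refine ⟨δ, hδ, fun τ hτ hτδ => ?_⟩
    have h3 := hwb e R₁ (posTimes T ∩ Iio δ) inter_subset_left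
      (fun t ht s hs => ⟨Ioo_subset_posTimes ht.1 hs, hs.2.trans ht.2⟩) he.le le_rfl
      (fun t ht => (hδ' (by rw [Real.dist_eq, sub_zero, abs_of_pos ht.1.1]; exact ht.2)
        ht.1.1).le) τ ⟨hτ, hτδ⟩
    refine (hN.norm_comp_le hb hτ.1 hR₁0.le h3 h3).trans ?_
    rw [show b * e + e = (b + 1) * e by ring]
    gcongr
    exact Real.rpow_nonneg hτ.1.le _
  · intro t ht
    exact congrArg (powerOp μ b _) (hweq t ht)
  · intro σ R' hσ hσe hφσ t ht
    have := hwb σ R' (posTimes T) subset_rfl (fun t ht => Ioo_subset_posTimes ht) hσ hσe hφσ t ht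
    rwa [hweq t ht] at this

theorem IsForcing.isMildSolution (hF : IsForcing α b r P T F B) (h : IsAuxExponent n α b r P)
    {μ : ℝ} {φ : LpReal 𝕜 n r}
    (hfix : ∀ t ∈ posTimes T, F t = powerOp μ b _ (mildCurve α P φ F t)) :
    IsMildSolution α b μ φ (timeInterval T) (mildCurve α r φ F) := by
  have hmem : ∀ τ ∈ posTimes T, ⇑(F τ) =ᵐ[volume] fun x =>
      powerNonlinearity μ b (mildCurve α r φ F τ x) := by
    intro τ hτ
    have h1 := hF.mildCurve_ae_eq h (ρ := r) (ρ' := P) (ae_eq_refl φ) le_rfl h.decay_r_lt h.lt.le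
      h.lt.le h.decay_self_lt hτ
    rw [hfix τ hτ]
    refine (coeFn_powerOp ((Lp.memLp _).powerNonlinearity h.b_pos h.pos)).trans ?_
    filter_upwards [h1] with x hx
    rw [hx]
  refine ⟨fun τ hτ hτ0 => ⟨ENNReal.ofReal (P / (b + 1)), Fact.out, ?_⟩, fun t ht => ?_⟩
  · exact (memLp_congr_ae (hmem τ (mem_posTimes_of_mem hτ hτ0))).1 (Lp.memLp _)
  refine ⟨fun τ => heatFlow 𝕜 n α (P / (b + 1)) r (t - τ) (F τ), ?_, ?_, ?_⟩
  · refine Eventually.of_forall fun τ hτ => ?_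
    have hτJ : τ ∈ posTimes T := ⟨hτ.1, (EReal.coe_lt_coe_iff.2 hτ.2).trans ht.2⟩
    refine (coeFn_heatFlow h.α_pos h.div_lt.le (sub_pos.2 hτ.2) (F τ)).trans ?_
    rw [fracHeatSemigroup_congr (sub_pos.2 hτ.2) (hmem τ hτJ)]
  · rcases ht.1.eq_or_lt with h0 | h0
    · rw [← h0]
    · exact hF.intervalIntegrable h h.div_lt.le h.decay_r_lt (mem_posTimes_of_mem ht h0)
  · refine (Lp.coeFn_add _ _).trans ?_
    filter_upwards [coeFn_heatOp_self h.α_pos ENNReal.ofReal_ne_top ht.1 φ] with x hx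
    rw [Pi.add_apply, hx]
    rfl

end Existence

/-! ### Interpolation between the spaces with exponents `r` and `p` -/

section Interpolation
variable {E : Type*} [NormedAddCommGroup E] {Ω : Type*} [MeasurableSpace Ω] {ν : Measure Ω}

theorem eLpNorm_le_interpolate {r P p : ℝ} (hr : 0 < r) (hrP : r ≤ P) (hPp : P ≤ p) (hrp : r < p)
    {f : Ω → E} (hf : AEStronglyMeasurable f ν) :
    eLpNorm f (ENNReal.ofReal P) ν ≤
      eLpNorm f (ENNReal.ofReal r) ν ^ (1 - (r⁻¹ - P⁻¹) / (r⁻¹ - p⁻¹)) *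
      eLpNorm f (ENNReal.ofReal p) ν ^ ((r⁻¹ - P⁻¹) / (r⁻¹ - p⁻¹)) := by
  have hP : 0 < P := hr.trans_le hrP
  have hp : 0 < p := hP.trans_le hPp
  have h1 : p⁻¹ < r⁻¹ := inv_strictAnti₀ hr hrp
  have h2 : P⁻¹ ≤ r⁻¹ := by gcongr
  have h3 : p⁻¹ ≤ P⁻¹ := by gcongr
  have h4 : 0 < r⁻¹ - p⁻¹ := sub_pos.2 h1
  have hl0 : 0 ≤ (r⁻¹ - P⁻¹) / (r⁻¹ - p⁻¹) := div_nonneg (sub_nonneg.2 h2) h4.le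
  have hl1 : (r⁻¹ - P⁻¹) / (r⁻¹ - p⁻¹) ≤ 1 := (div_le_one h4).2 (by linarith)
  refine eLpNorm_le_rpow_mul_rpow hf hl0 hl1 ?_
  rw [← ENNReal.ofReal_inv_of_pos hP, ← ENNReal.ofReal_inv_of_pos hr,
    ← ENNReal.ofReal_inv_of_pos hp, ← ENNReal.ofReal_mul (by positivity),
    ← ENNReal.ofReal_mul (by positivity),
    ← ENNReal.ofReal_add (mul_nonneg (by positivity) (by linarith)) (by positivity)]
  congr 1
  have h5 : p - r ≠ 0 := (sub_pos.2 hrp).ne'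
  field_simp
  ring

theorem MeasureTheory.MemLp.interpolate {r P p : ℝ} (hr : 0 < r) (hrP : r ≤ P) (hPp : P ≤ p)
    {f : Ω → E} (h1 : MemLp f (ENNReal.ofReal r) ν) (h2 : MemLp f (ENNReal.ofReal p) ν) :
    MemLp f (ENNReal.ofReal P) ν := by
  rcases (hrP.trans hPp).eq_or_lt with h | hrp
  · rwa [le_antisymm hPp (h ▸ hrP)]
  refine ⟨h1.1, (eLpNorm_le_interpolate hr hrP hPp hrp h1.1).trans_lt ?_⟩
  have hP : 0 < P := hr.trans_le hrP
  have hp : 0 < p := hP.trans_le hPp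
  have h3 : 0 < r⁻¹ - p⁻¹ := sub_pos.2 (inv_strictAnti₀ hr hrp)
  have h4 : P⁻¹ ≤ r⁻¹ := by gcongr
  have h5 : p⁻¹ ≤ P⁻¹ := by gcongr
  exact ENNReal.mul_lt_top
    (ENNReal.rpow_lt_top_of_nonneg (sub_nonneg.2 ((div_le_one h3).2 (by linarith))) h1.2.ne)
    (ENNReal.rpow_lt_top_of_nonneg (div_nonneg (sub_nonneg.2 h4) h3.le) h2.2.ne)

end Interpolation

/-! ### Solutions in the class `Y` under a smallness condition -/

section Existence
variable {𝕜 : Type*} [RCLike 𝕜] {n : ℕ} {α b r p P : ℝ} [Fact (1 ≤ ENNReal.ofReal P)]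
  [Fact (1 ≤ ENNReal.ofReal p)] [Fact (1 ≤ ENNReal.ofReal r)]

/-- Data in `L^r ∩ L^p` have a better decay in `L^P` than those in `L^r`. -/
theorem IsAuxExponent.exists_rpow_mul_norm_heatFlow_le (h : IsAuxExponent n α b r P)
    (hrp : r < p) (hγ : heatDecay n α (P / (b + 1)) p < 1) (φ : LpReal 𝕜 n r) (ψ : LpReal 𝕜 n p)
    (hψ : ψ =ᵐ[volume] φ) :
    ∃ σ, 0 ≤ σ ∧ σ ≤ heatDecay n α r P ∧ heatDecay n α (P / (b + 1)) p + (b + 1) * σ < 1 ∧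
      ∃ R, 0 ≤ R ∧ ∀ t, 0 < t → t ^ σ * ‖heatFlow 𝕜 n α r P t φ‖ ≤ R := by
  -- If `P ≤ p`, the data lie in `L^P` and `σ = 0` works. If `p ≤ P`, take the decay from `L^p` to
  -- `L^P`; the sum to be bounded is then `r₀/p < r₀/r ≤ 1`.
  rcases le_total P p with hPp | hpP
  · have hmem : MemLp φ (ENNReal.ofReal P) volume := (Lp.memLp φ).interpolate h.r_pos h.lt.le hPp
      ((memLp_congr_ae hψ).1 (Lp.memLp ψ))
    obtain ⟨A, hS⟩ := exists_isSmoothingFamily_heatFlow 𝕜 n h.α_pos (le_refl P)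
    refine ⟨0, le_rfl, (h.heatDecay_pos h.lt).le, by simpa using hγ, A * ‖hmem.toLp‖,
      mul_nonneg hS.nonneg (norm_nonneg _), fun t ht => ?_⟩
    have h1 : heatFlow 𝕜 n α r P t φ = heatFlow 𝕜 n α P P t hmem.toLp :=
      Lp.ext (heatFlow_ae_eq_heatFlow h.α_pos h.lt.le le_rfl ht hmem.coeFn_toLp.symm)
    have h2 := (heatFlow 𝕜 n α P P t).le_of_opNorm_le (hS.norm_le t ht) hmem.toLp
    rw [heatDecay_self, neg_zero, Real.rpow_zero, mul_one] at h2
    rwa [Real.rpow_zero, one_mul, h1]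
  · obtain ⟨A, hS⟩ := exists_isSmoothingFamily_heatFlow 𝕜 n h.α_pos hpP
    have hp := h.r_pos.trans hrp
    refine ⟨heatDecay n α p P, heatDecay_nonneg n h.α_pos hp hpP, ?_, ?_, A * ‖ψ‖,
      mul_nonneg hS.nonneg (norm_nonneg _), fun t ht => ?_⟩
    · have h1 := heatDecay_add n α r p P
      have h2 := heatDecay_nonneg n h.α_pos h.r_pos hrp.le
      linarith
    · have h1 : heatDecay n α (P / (b + 1)) p + (b + 1) * heatDecay n α p P
          = n * b / (2 * α) * p⁻¹ := by
        rw [heatDecay, heatDecay, inv_div]; ring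
      rw [h1]
      refine lt_of_lt_of_le ?_ h.critical_div_le_one
      have h2 : p⁻¹ < r⁻¹ := inv_strictAnti₀ h.r_pos hrp
      have h3 : (0 : ℝ) < n := by exact_mod_cast h.dim_pos
      have h4 := h.α_pos
      have h5 := h.b_pos
      rw [div_eq_mul_inv _ r]
      gcongr
    · have h1 : heatFlow 𝕜 n α r P t φ = heatFlow 𝕜 n α p P t ψ :=
        Lp.ext (heatFlow_ae_eq_heatFlow h.α_pos h.lt.le hpP ht hψ.symm)
      rw [h1]
      refine rpow_mul_norm_le ht (((heatFlow 𝕜 n α p P t).le_of_opNorm_le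
        (hS.norm_le t ht) ψ).trans (le_of_eq ?_))
      ring

variable [Fact (1 ≤ ENNReal.ofReal (P / (b + 1)))]

/-- The common source of local, critical and global existence, which differ only in the choice of
`Λ` and `R`. The last clause, persistence of `L^p` data, is there for gluing. -/
theorem exists_isYSolution_of_small (𝕜 : Type*) [RCLike 𝕜] (μ : ℝ) (h : IsAuxExponent n α b r P)
    (hrp : r < p) (hγ : heatDecay n α (P / (b + 1)) p < 1) {q : ℝ≥0∞}
    (hq : (q⁻¹).toReal = heatDecay n α r p) :
    ∃ A K : ℝ, 0 < A ∧ 0 ≤ K ∧ ∀ (φ : LpReal 𝕜 n r) (T : EReal) (Λ R : ℝ), 0 < T → 0 ≤ Λ →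
      0 ≤ R → K * Λ * R ^ b ≤ 1 →
      (∀ t ∈ posTimes T, t ^ (1 - n * b / (2 * α) / r) ≤ Λ) →
      (∀ t ∈ posTimes T, t ^ heatDecay n α r P * ‖heatFlow 𝕜 n α r P t φ‖ ≤ R / 2) →
      ∃ u, IsYSolution α b μ q (ENNReal.ofReal p) φ T u ∧
        (∀ t ∈ timeInterval T, ‖u t‖ ≤ A * (‖φ‖ + Λ * R ^ b * R)) ∧
        (∀ t ∈ posTimes T, ENNReal.ofReal (t ^ (q⁻¹).toReal) *
          eLpNorm (u t) (ENNReal.ofReal p) volume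
            ≤ ENNReal.ofReal (A * (‖φ‖ + Λ * R ^ b * R))) ∧
        ∀ ψ : LpReal 𝕜 n p, ψ =ᵐ[volume] φ → T ≠ ⊤ → ∃ w : ℝ → LpReal 𝕜 n p,
          MemCb (timeInterval T) w ∧ ∀ t ∈ timeInterval T, w t =ᵐ[volume] u t := by
  obtain ⟨C₁, hC₁, hr_le⟩ := exists_rpow_mul_norm_mildCurve_le 𝕜 h le_rfl h.decay_r_lt
  obtain ⟨C₂, hC₂, hp_le⟩ := exists_rpow_mul_norm_mildCurve_le 𝕜 h hrp.le hγ
  obtain ⟨K, hK, hex⟩ := exists_forcing_of_small 𝕜 μ h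
  set κ := |μ| * (b + 2) with hκ_def
  have hb := h.b_pos
  have hκ : 0 ≤ κ := by positivity
  clear_value κ
  -- The summand `1` covers `t = 0`, where the solution is `φ` itself.
  set A := 1 + (C₁ + C₂) * (1 + κ) with hA
  have hA1 : 1 ≤ A := by
    have : 0 ≤ (C₁ + C₂) * (1 + κ) := by positivity
    linarith
  refine ⟨A, K, by linarith, hK, fun φ T Λ R hT hΛ hR hsmall htΛ hφ => ?_⟩
  obtain ⟨F, hF, hfix, hFσ⟩ := hex φ T Λ R hT hΛ hR hsmall htΛ hφ
  have hX : 0 ≤ Λ * R ^ b * R := by positivity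
  have hle : ∀ C, 0 ≤ C → C ≤ C₁ + C₂ →
      C * (‖φ‖ + κ * R ^ b * R * Λ) ≤ A * (‖φ‖ + Λ * R ^ b * R) := by
    intro C hC hCC
    have h1 : κ * R ^ b * R * Λ = κ * (Λ * R ^ b * R) := by ring
    calc C * (‖φ‖ + κ * R ^ b * R * Λ)
        ≤ (C₁ + C₂) * ((1 + κ) * ‖φ‖ + (1 + κ) * (Λ * R ^ b * R)) := by
          rw [h1]
          gcongr
          · nlinarith [norm_nonneg φ]
          · linarith
      _ = (A - 1) * (‖φ‖ + Λ * R ^ b * R) := by rw [hA]; ring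
      _ ≤ _ := by gcongr; linarith
  have hu_le : ∀ t ∈ timeInterval T, ‖mildCurve α r φ F t‖ ≤ A * (‖φ‖ + Λ * R ^ b * R) := by
    intro t ht
    rcases ht.1.eq_or_lt with h0 | h0
    · rw [← h0, mildCurve_zero h.α_pos]
      nlinarith [norm_nonneg φ]
    · have h1 := hr_le φ T F _ Λ hF htΛ t (mem_posTimes_of_mem ht h0)
      rw [heatDecay_self, Real.rpow_zero, one_mul] at h1
      exact h1.trans (hle C₁ hC₁ (by linarith))
  have hw_le : ∀ t ∈ posTimes T, t ^ heatDecay n α r p * ‖mildCurve α p φ F t‖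
      ≤ A * (‖φ‖ + Λ * R ^ b * R) := fun t ht =>
    (hp_le φ T F _ Λ hF htΛ t ht).trans (hle C₂ hC₂ (by linarith))
  have hwu : ∀ t ∈ posTimes T, mildCurve α p φ F t =ᵐ[volume] mildCurve α r φ F t :=
    fun t ht => hF.mildCurve_ae_eq h (ae_eq_refl φ) hrp.le hγ le_rfl le_rfl h.decay_r_lt ht
  refine ⟨mildCurve α r φ F, ⟨⟨⟨?_, _, hu_le⟩, mildCurve α p φ F, ?_,
    ⟨?_, A * (‖φ‖ + Λ * R ^ b * R), ?_⟩, ?_⟩,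
    hF.isMildSolution h hfix⟩, hu_le, ?_, ?_⟩
  · refine continuousOn_timeInterval (hF.continuousOn_mildCurve h φ le_rfl le_rfl h.decay_r_lt) ?_
    rw [mildCurve_zero h.α_pos]
    exact hF.tendsto_mildCurve_self h hT φ
  · exact fun t ht ht0 => hwu t (mem_posTimes_of_mem ht ht0)
  · rw [timeInterval_inter_Ioi]
    exact hF.continuousOn_mildCurve h φ hrp.le hrp.le hγ
  · rw [hq]
    exact fun t ht ht0 => hw_le t (mem_posTimes_of_mem ht ht0)
  · rw [hq]
    exact hF.tendsto_rpow_mul_norm_mildCurve h hT φ hrp hγ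
  · intro t ht
    have h1 : eLpNorm (mildCurve α r φ F t) (ENNReal.ofReal p) volume
        = ENNReal.ofReal ‖mildCurve α p φ F t‖ := by
      rw [Lp.norm_def, ENNReal.ofReal_toReal (Lp.eLpNorm_ne_top _)]
      exact eLpNorm_congr_ae (hwu t ht).symm
    rw [h1, hq, ← ENNReal.ofReal_mul (Real.rpow_nonneg (le_of_lt ht.1) _)]
    exact ENNReal.ofReal_le_ofReal (hw_le t ht)
  · intro ψ hψ hT'
    obtain ⟨σ, hσ, hσe, hσγ, R₁, hR₁, hR₁b⟩ :=
      h.exists_rpow_mul_norm_heatFlow_le hrp hγ φ ψ hψ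
    have h1 := hFσ σ (2 * R₁) hσ hσe fun t ht => by
      rw [mul_div_cancel_left₀ _ two_ne_zero]; exact hR₁b t ht.1
    have hN := isPowerLipschitz_powerOp (𝕜 := 𝕜)
      (ν := (volume : Measure (EuclideanSpace ℝ (Fin n)))) μ hb h.le
    refine ⟨mildCurve α p ψ F, hF.memCb_mildCurve h hT hT' ψ hrp.le hγ (δ := (b + 1) * σ)
      (B' := |μ| * (b + 2) * (2 * R₁) ^ b * (2 * R₁)) ?_ (by linarith) (by positivity) ?_, ?_⟩
    · exact mul_le_mul_of_nonneg_left hσe h.succ_pos.le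
    · intro τ hτ
      have h2 := hN.norm_comp_le hb hτ.1 (by positivity) (h1 τ hτ) (h1 τ hτ)
      rw [hfix τ hτ, show (b + 1) * σ = b * σ + σ by ring]
      exact h2
    · intro t ht
      rcases ht.1.eq_or_lt with h0 | h0
      · rw [← h0, mildCurve_zero h.α_pos, mildCurve_zero h.α_pos]
        exact hψ
      · exact (hF.mildCurve_ae_eq h hψ.symm le_rfl h.decay_r_lt le_rfl hrp.le hγ
          (mem_posTimes_of_mem ht h0)).symm

end Existence

/-! ### Choice of the auxiliary exponent -/

section Exponents
variable {n : ℕ} {α b r p : ℝ}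

/-- After clearing denominators the claim is `p (n - 2αr) < nr`: this is the upper bound on `p` if
`n > 2αr`, and automatic otherwise. -/
theorem IsGenAdmissible.heatDecay_lt_one {q : ℝ≥0∞} (h : IsGenAdmissible n α q p r) (hα : 0 < α)
    (hn : 0 < n) : heatDecay n α r p < 1 := by
  have hr : 0 < r := by linarith [h.one_lt]
  have hp : 0 < p := hr.trans_le h.le
  have hn' : (0 : ℝ) < n := by exact_mod_cast hn
  have h1 : heatDecay n α r p = n * (p - r) / (2 * α * (r * p)) := by
    rw [heatDecay]; field_simp
  rw [h1, div_lt_one (by positivity)]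
  rcases lt_or_ge (2 * r * α) n with h2 | h2
  · have h3 := h.lt h2
    rw [lt_div_iff₀ (by linarith)] at h3
    nlinarith
  · nlinarith [mul_pos hn' hr]

theorem IsGenAdmissible.toReal_inv {q : ℝ≥0∞} (h : IsGenAdmissible n α q p r) (hα : 0 < α) :
    (q⁻¹).toReal = heatDecay n α r p := by
  have h1 := heatDecay_nonneg n hα (by linarith [h.one_lt]) h.le
  rw [heatDecay] at *
  rw [h.inv_q, one_div, one_div, ENNReal.toReal_ofReal h1]

/-- At `P = r(b+1)` the second condition reads `e(r, p) < 1`, which is given, so by continuity it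
persists slightly below. The other constraints leave room since `max r (b+1) < r(b+1)`. -/
theorem exists_isAuxExponent (hα : 0 < α) (hb : 0 < b) (hr : 1 < r) (hcrit : n * b / (2 * α) ≤ r)
    (hn : 0 < n) (hp : heatDecay n α r p < 1) :
    ∃ P, IsAuxExponent n α b r P ∧ heatDecay n α (P / (b + 1)) p < 1 := by
  have hb1 : 0 < b + 1 := by linarith
  have hr0 : 0 < r := by linarith
  have h1 : ContinuousAt (fun P => heatDecay n α (P / (b + 1)) p) (r * (b + 1)) := by
    have h0 : r * (b + 1) / (b + 1) ≠ 0 := by positivity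
    unfold heatDecay
    exact continuousAt_const.mul (((continuousAt_id.div_const _).inv₀ h0).sub continuousAt_const)
  have h2 : heatDecay n α (r * (b + 1) / (b + 1)) p < 1 := by rwa [mul_div_cancel_right₀ _ hb1.ne']
  have h3 := nhdsWithin_le_nhds (s := Iio (r * (b + 1))) (h1.eventually_lt_const h2)
  have h4 : Ioo (max r (b + 1)) (r * (b + 1)) ∈ 𝓝[<] (r * (b + 1)) :=
    Ioo_mem_nhdsLT (max_lt (by nlinarith) (by nlinarith))
  obtain ⟨P, hP, hP'⟩ := (Filter.Eventually.and h3 h4).exists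
  exact ⟨P, ⟨hα, hb, hr, hcrit, hn, (le_max_left _ _).trans_lt hP'.1,
    ((le_max_right _ _).trans_lt hP'.1).le, hP'.2⟩, hP⟩

/-- An auxiliary exponent between `r` and `p`, for the proof of uniqueness. -/
theorem exists_isAuxExponent_le (hα : 0 < α) (hb : 0 < b) (hr : 1 < r)
    (hcrit : n * b / (2 * α) ≤ r) (hn : 0 < n) (hrp : r < p) (hbp : b + 1 ≤ p) :
    ∃ P, IsAuxExponent n α b r P ∧ P ≤ p := by
  rcases lt_or_ge p (r * (b + 1)) with h | h
  · exact ⟨p, ⟨hα, hb, hr, hcrit, hn, hrp, hbp, h⟩, le_rfl⟩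
  · obtain ⟨P, hP, hP'⟩ := exists_between
      (show max r (b + 1) < r * (b + 1) from max_lt (by nlinarith) (by nlinarith))
    exact ⟨P, ⟨hα, hb, hr, hcrit, hn, (le_max_left _ _).trans_lt hP,
      ((le_max_right _ _).trans_lt hP).le, hP'⟩, hP'.le.trans h⟩

end Exponents

/-! ### Local existence and global existence for small data -/

section LocalExistence
variable {n : ℕ} {α b r p P : ℝ} [Fact (1 ≤ ENNReal.ofReal P)]
  [Fact (1 ≤ ENNReal.ofReal p)] [Fact (1 ≤ ENNReal.ofReal r)]
  [Fact (1 ≤ ENNReal.ofReal (P / (b + 1)))]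

theorem exists_rpow_mul_norm_heatFlow_le_mul (𝕜 : Type*) [RCLike 𝕜] (n : ℕ) (hα : 0 < α)
    (hrp : r ≤ p) : ∃ A, 0 ≤ A ∧ ∀ (φ : LpReal 𝕜 n r) (t : ℝ), 0 < t →
      t ^ heatDecay n α r p * ‖heatFlow 𝕜 n α r p t φ‖ ≤ A * ‖φ‖ := by
  obtain ⟨A, hS⟩ := exists_isSmoothingFamily_heatFlow 𝕜 n hα hrp
  refine ⟨A, hS.nonneg, fun φ t ht => ?_⟩
  refine rpow_mul_norm_le ht (((heatFlow 𝕜 n α r p t).le_of_opNorm_le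
    (hS.norm_le t ht) φ).trans (le_of_eq ?_))
  ring

/-- Local existence, with an existence time in terms of the norm of the data. -/
theorem exists_isYSolution_of_rpow_mul_norm_le (𝕜 : Type*) [RCLike 𝕜] (μ : ℝ)
    (h : IsAuxExponent n α b r P) (hrp : r < p) (hγ : heatDecay n α (P / (b + 1)) p < 1)
    {q : ℝ≥0∞} (hq : (q⁻¹).toReal = heatDecay n α r p) :
    ∃ c : ℝ, 0 < c ∧ ∀ (φ : LpReal 𝕜 n r) (T : ℝ), 0 < T →
      T ^ (1 - n * b / (2 * α) / r) * ‖φ‖ ^ b ≤ c →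
      ∃ u, IsYSolution α b μ q (ENNReal.ofReal p) φ (T : EReal) u ∧
        ∀ ψ : LpReal 𝕜 n p, ψ =ᵐ[volume] φ → ∃ w : ℝ → LpReal 𝕜 n p,
          MemCb (timeInterval (T : EReal)) w ∧
            ∀ t ∈ timeInterval (T : EReal), w t =ᵐ[volume] u t := by
  obtain ⟨A, K, -, hK, hex⟩ := exists_isYSolution_of_small 𝕜 μ h hrp hγ hq
  obtain ⟨A₁, hA₁, hlin⟩ := exists_rpow_mul_norm_heatFlow_le_mul 𝕜 n h.α_pos h.lt.le
  refine ⟨1 / (K * (2 * A₁) ^ b + 1), by positivity, fun φ T hT hφ => ?_⟩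
  rw [le_div_iff₀ (by positivity)] at hφ
  -- With `R = 2A₁‖φ‖` the linear part is at most `R/2`, and the smallness condition becomes `K
  -- (2A₁)^b T^θ ‖φ‖^b ≤ 1`. The `+ 1` in the denominator of `c` guards against a zero constant.
  have key := hex φ T (T ^ (1 - n * b / (2 * α) / r)) (2 * A₁ * ‖φ‖)
    (by exact_mod_cast hT) (by positivity) (by positivity) ?_ ?_ ?_
  · obtain ⟨u, hu, -, -, hψ⟩ := key
    exact ⟨u, hu, fun ψ hψφ => hψ ψ hψφ (EReal.coe_ne_top _)⟩
  · rw [Real.mul_rpow (by positivity) (norm_nonneg _)]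
    have : 0 ≤ T ^ (1 - n * b / (2 * α) / r) * ‖φ‖ ^ b := by positivity
    nlinarith
  · intro t ht
    exact Real.rpow_le_rpow ht.1.le (EReal.coe_lt_coe_iff.1 ht.2).le h.theta_nonneg
  · intro t ht
    refine (hlin φ t ht.1).trans (le_of_eq ?_)
    ring

theorem exists_isYSolution_of_norm_le (𝕜 : Type*) [RCLike 𝕜] (μ : ℝ)
    (h : IsAuxExponent n α b r P) (hr : n * b / (2 * α) < r) (hrp : r < p)
    (hγ : heatDecay n α (P / (b + 1)) p < 1)
    {q : ℝ≥0∞} (hq : (q⁻¹).toReal = heatDecay n α r p) (M : ℝ) :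
    ∃ T : ℝ, 0 < T ∧ ∀ φ : LpReal 𝕜 n r, ‖φ‖ ≤ M →
      ∃ u, IsYSolution α b μ q (ENNReal.ofReal p) φ (T : EReal) u := by
  obtain ⟨c, hc, hex⟩ := exists_isYSolution_of_rpow_mul_norm_le 𝕜 μ h hrp hγ hq
  have hb := h.b_pos
  have hθ : 0 < 1 - n * b / (2 * α) / r := sub_pos.2 ((div_lt_one h.r_pos).2 hr)
  -- `T` solves `T^θ (|M|^b + 1) = c`, which is possible since `θ > 0` in the subcritical case.
  have hT : 0 < (c / (|M| ^ b + 1)) ^ (1 - n * b / (2 * α) / r)⁻¹ := by positivity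
  refine ⟨_, hT, fun φ hφ => ?_⟩
  obtain ⟨u, hu, -⟩ := hex φ _ hT (by
    rw [← Real.rpow_mul (by positivity), inv_mul_cancel₀ hθ.ne', Real.rpow_one, div_mul_eq_mul_div,
      div_le_iff₀ (by positivity)]
    have : ‖φ‖ ^ b ≤ |M| ^ b := by
      gcongr
      exact hφ.trans (le_abs_self M)
    gcongr
    linarith)
  exact ⟨u, hu⟩

/-- Here `θ = 0` and `Λ = 1`, so `R` is fixed in advance and `T` is taken so short that `t^e ‖S(t)φ‖
≤ R/2`. The rate of this decay is not controlled by `‖φ‖`, hence a time depending on `φ`. -/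
theorem exists_isYSolution_critical (𝕜 : Type*) [RCLike 𝕜] (μ : ℝ) (h : IsAuxExponent n α b r P)
    (hr : r = n * b / (2 * α)) (hrp : r < p) (hγ : heatDecay n α (P / (b + 1)) p < 1)
    {q : ℝ≥0∞} (hq : (q⁻¹).toReal = heatDecay n α r p) (φ : LpReal 𝕜 n r) :
    ∃ T : ℝ, 0 < T ∧ ∃ u, IsYSolution α b μ q (ENNReal.ofReal p) φ (T : EReal) u := by
  obtain ⟨A, K, -, hK, hex⟩ := exists_isYSolution_of_small 𝕜 μ h hrp hγ hq
  have hb := h.b_pos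
  set R : ℝ := (1 / (K + 1)) ^ b⁻¹ with hR_def
  have hR : 0 < R := by positivity
  have hRb : R ^ b = 1 / (K + 1) := by
    rw [hR_def, ← Real.rpow_mul (by positivity), inv_mul_cancel₀ hb.ne', Real.rpow_one]
  have h2 := (tendsto_rpow_mul_norm_heatFlow h.α_pos h.lt.le (h.heatDecay_pos h.lt)
    φ).eventually_lt_const (half_pos hR)
  rw [eventually_nhdsWithin_iff, Metric.eventually_nhds_iff] at h2
  obtain ⟨T, hT, hT'⟩ := h2
  refine ⟨T, hT, ?_⟩
  have key := hex φ T 1 R (by exact_mod_cast hT) zero_le_one hR.le ?_ ?_ ?_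
  · obtain ⟨u, hu, -⟩ := key
    exact ⟨u, hu⟩
  · rw [hRb, mul_one, mul_one_div, div_le_one (by positivity)]
    linarith
  · intro t ht
    rw [← hr, div_self h.r_pos.ne', sub_self, Real.rpow_zero]
  · intro t ht
    have h3 : dist t 0 < T := by
      rw [Real.dist_eq, sub_zero, abs_of_pos ht.1]
      exact EReal.coe_lt_coe_iff.1 ht.2
    exact (hT' h3 ht.1).le

theorem exists_global_isYSolution (𝕜 : Type*) [RCLike 𝕜] (μ : ℝ) (h : IsAuxExponent n α b r P)
    (hr : r = n * b / (2 * α)) (hrp : r < p) (hγ : heatDecay n α (P / (b + 1)) p < 1)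
    {q : ℝ≥0∞} (hq : (q⁻¹).toReal = heatDecay n α r p) {ε : ℝ} (hε : 0 < ε) :
    ∃ δ : ℝ, 0 < δ ∧ ∀ φ : LpReal 𝕜 n r, ‖φ‖ ≤ δ →
      ∃ u, IsYSolution α b μ q (ENNReal.ofReal p) φ ⊤ u ∧
        (∀ t : ℝ, 0 ≤ t → ‖u t‖ ≤ ε) ∧
        (∀ t : ℝ, 0 < t →
          ENNReal.ofReal (t ^ (q⁻¹).toReal) * eLpNorm (u t) (ENNReal.ofReal p) volume
            ≤ ENNReal.ofReal ε) := by
  obtain ⟨A, K, hA, hK, hex⟩ := exists_isYSolution_of_small 𝕜 μ h hrp hγ hq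
  obtain ⟨A₁, hA₁, hlin⟩ := exists_rpow_mul_norm_heatFlow_le_mul 𝕜 n h.α_pos h.lt.le
  have hb := h.b_pos
  -- The first term gives the contraction and `R^b ≤ 1`; the second gives `A R^{b+1} ≤ A R ≤ ε/2`.
  -- In `δ`, one bound makes `A‖φ‖ ≤ ε/2` and the other keeps the linear part below `R/2` at all
  -- times.
  set R : ℝ := min ((1 / (K + 1)) ^ b⁻¹) (ε / (2 * A)) with hR_def
  have hR : 0 < R := by positivity
  have hRb : R ^ b ≤ 1 / (K + 1) := by
    refine (Real.rpow_le_rpow hR.le (min_le_left _ _) hb.le).trans (le_of_eq ?_)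
    rw [← Real.rpow_mul (by positivity), inv_mul_cancel₀ hb.ne', Real.rpow_one]
  have hKR : (K + 1) * R ^ b ≤ 1 := by
    rw [le_div_iff₀ (by positivity)] at hRb
    linarith
  have hRb0 : 0 ≤ R ^ b := by positivity
  have hRb1 : R ^ b ≤ 1 := by nlinarith
  have hRε : A * R ≤ ε / 2 := by
    have h1 : R ≤ ε / (2 * A) := min_le_right _ _
    rw [le_div_iff₀ (by positivity)] at h1
    linarith
  refine ⟨min (ε / (2 * A)) (R / (2 * (A₁ + 1))), by positivity, fun φ hφ => ?_⟩
  have hφ1 : A * ‖φ‖ ≤ ε / 2 := by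
    have h1 := hφ.trans (min_le_left _ _)
    rw [le_div_iff₀ (by positivity)] at h1
    linarith
  have hφ2 : A₁ * ‖φ‖ ≤ R / 2 := by
    have h1 := hφ.trans (min_le_right _ _)
    rw [le_div_iff₀ (by positivity)] at h1
    nlinarith [norm_nonneg φ]
  have hAε : A * (‖φ‖ + 1 * R ^ b * R) ≤ ε := by
    have h1 : R ^ b * R ≤ 1 * R := by gcongr
    have h2 : A * (R ^ b * R) ≤ A * R := by
      rw [one_mul] at h1
      gcongr
    linarith
  have key := hex φ ⊤ 1 R EReal.zero_lt_top zero_le_one hR.le ?_ ?_ ?_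
  · obtain ⟨u, hu, hur, hup, -⟩ := key
    refine ⟨u, hu, fun t ht => (hur t ⟨ht, EReal.coe_lt_top t⟩).trans hAε, fun t ht => ?_⟩
    exact (hup t ⟨ht, EReal.coe_lt_top t⟩).trans (ENNReal.ofReal_le_ofReal hAε)
  · linarith
  · intro t ht
    rw [← hr, div_self h.r_pos.ne', sub_self, Real.rpow_zero]
  · intro t ht
    exact (hlin φ t ht.1).trans hφ2

end LocalExistence

/-! ### Uniqueness for the abstract Duhamel equation -/

section Uniqueness

/-- A bounded quantity whose upper bounds can always be halved: iterate. It takes the place of a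
Grönwall argument with singular kernel. -/
theorem nonpos_of_forall_le_half {ι : Type*} {s : Set ι} {f : ι → ℝ} {M : ℝ} (hM : 0 ≤ M)
    (hfM : ∀ i ∈ s, f i ≤ M)
    (h : ∀ X, 0 ≤ X → (∀ i ∈ s, f i ≤ X) → ∀ i ∈ s, f i ≤ X / 2) : ∀ i ∈ s, f i ≤ 0 := by
  have h1 : ∀ k : ℕ, ∀ i ∈ s, f i ≤ M * (1 / 2) ^ k := by
    intro k
    induction k with
    | zero => simpa using hfM
    | succ k ih =>
      intro i hi
      refine (h _ (by positivity) ih i hi).trans (le_of_eq ?_)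
      rw [pow_succ]; ring
  intro i hi
  have h2 : Tendsto (fun k : ℕ => M * (1 / 2 : ℝ) ^ k) atTop (𝓝 (M * 0)) :=
    (tendsto_pow_atTop_nhds_zero_of_lt_one (by norm_num) (by norm_num)).const_mul M
  rw [mul_zero] at h2
  exact ge_of_tendsto' h2 fun k => h1 k i hi

variable {X Z : Type*} [NormedAddCommGroup X] [NormedSpace ℝ X] [NormedAddCommGroup Z]
  [NormedSpace ℝ Z] {S : ℝ → Z →L[ℝ] X} {A γ κ b e : ℝ} {N : X → Z}

theorem duhamel_eq_of_eq_zero {F : ℝ → Z} {s t : ℝ} (hs : 0 ≤ s) (hst : s ≤ t)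
    (hF : ∀ τ ∈ Ioc 0 s, F τ = 0) : duhamel S F t = duhamel S (fun τ => F (τ + s)) (t - s) := by
  have h1 : duhamel S F t = ∫ τ in s..t, S (t - τ) (F τ) := by
    rw [duhamel, intervalIntegral.integral_of_le (hs.trans hst),
      intervalIntegral.integral_of_le hst]
    refine setIntegral_eq_of_subset_of_forall_sdiff_eq_zero (μ := volume)
      (f := fun τ => S (t - τ) (F τ)) measurableSet_Ioc (Ioc_subset_Ioc_left hs) fun τ hτ => ?_
    have h2 : τ ≤ s := not_lt.1 fun h => hτ.2 ⟨h, hτ.1.2⟩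
    rw [hF τ ⟨hτ.1.1, h2⟩, map_zero]
  rw [h1, duhamel]
  have h3 := intervalIntegral.integral_comp_add_right (a := 0) (b := t - s)
    (fun τ => S (t - τ) (F τ)) s
  rw [zero_add, sub_add_cancel] at h3
  rw [← h3]
  refine intervalIntegral.integral_congr fun τ _ => ?_
  simp only [sub_sub, add_comm s τ]

/-- Near `0` the weighted norms are small, so the Lipschitz constant of the Duhamel map is at most
`1/2`. Beyond some `δ` both curves are bounded by a constant `M₁` without weight; equality up to `s`
then extends to `s + l`, with `l` depending on `M₁` but not on `s`, so every time is reached in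
finitely many steps. -/
theorem eqOn_of_duhamel (hS : IsSmoothingFamily S A γ) (hγ : γ < 1)
    (hN : IsPowerLipschitz N κ b) (hb : 0 < b) (he : 0 ≤ e) (hδ : (b + 1) * e < 1)
    (hθ : 0 ≤ 1 - γ - b * e) {J : Set ℝ} (hJ0 : J ⊆ Ioi 0) (hJ : ∀ t ∈ J, Ioo 0 t ⊆ J)
    {M : ℝ} (hM : 0 ≤ M) {W V : ℝ → X} (hW : ∀ t ∈ J, t ^ e * ‖W t‖ ≤ M)
    (hV : ∀ t ∈ J, t ^ e * ‖V t‖ ≤ M)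
    (hsmall : ∀ η, 0 < η → ∃ δ, 0 < δ ∧ ∀ t ∈ J, t < δ → t ^ e * ‖W t‖ ≤ η ∧ t ^ e * ‖V t‖ ≤ η)
    (hD : ∀ t ∈ J, W t - V t = duhamel S (fun τ => N (W τ) - N (V τ)) t) :
    EqOn W V J := by
  have hA := hS.nonneg
  have hκ := hN.nonneg
  set β := betaConst γ ((b + 1) * e)
  have hβ : 0 ≤ β := betaConst_nonneg _ _
  have hβ' : 0 ≤ betaConst γ 0 := betaConst_nonneg _ _
  have hJ' : ∀ t ∈ J, ∀ s, 0 < s → s ≤ t → s ∈ J := fun t ht s hs hst =>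
    hst.eq_or_lt.elim (fun h => h ▸ ht) fun h => hJ t ht ⟨hs, h⟩
  -- times close to zero
  obtain ⟨δ, hδ0, hδz⟩ : ∃ δ, 0 < δ ∧ ∀ t ∈ J, t ≤ δ → W t - V t = 0 := by
    set η : ℝ := (1 / (4 * A * κ * β + 1)) ^ b⁻¹ with hη_def
    have hη : 0 < η := by positivity
    have hηb : η ^ b = 1 / (4 * A * κ * β + 1) := by
      rw [hη_def, ← Real.rpow_mul (by positivity), inv_mul_cancel₀ hb.ne', Real.rpow_one]
    have hη1 : 4 * A * κ * β * η ^ b ≤ 1 := by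
      rw [hηb, mul_one_div, div_le_one (by positivity)]
      linarith
    obtain ⟨δ, hδ0, hδη⟩ := hsmall η hη
    -- `δ/2` keeps the closed condition `t ≤ δ/2` inside `t < δ`; the `1` makes the remaining
    -- nonnegative power of `t` at most `1`.
    refine ⟨min (δ / 2) 1, by positivity, ?_⟩
    have key := nonpos_of_forall_le_half (s := J ∩ Iic (min (δ / 2) 1))
      (f := fun t => t ^ e * ‖W t - V t‖) (M := M + M) (by positivity) ?_ ?_
    · intro t ht htδ
      have h1 := key t ⟨ht, htδ⟩
      have h2 : 0 < t := hJ0 ht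
      have h3 : 0 < t ^ e := by positivity
      have h4 : ‖W t - V t‖ ≤ 0 := by
        by_contra! h5
        exact absurd h1 (not_le.2 (mul_pos h3 h5))
      exact norm_le_zero_iff.1 h4
    · intro t ht
      have h2 : 0 < t := hJ0 ht.1
      calc t ^ e * ‖W t - V t‖ ≤ t ^ e * (‖W t‖ + ‖V t‖) := by
            gcongr
            exact norm_sub_le _ _
        _ ≤ M + M := by
            rw [mul_add]
            exact add_le_add (hW t ht.1) (hV t ht.1)
    · intro Y hY hYb t ht
      have h0 : 0 < t := hJ0 ht.1
      have hF : ∀ τ ∈ Ioo 0 t, ‖N (W τ) - N (V τ)‖ ≤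
          2 * κ * η ^ b * Y * τ ^ (-((b + 1) * e)) := by
        intro τ hτ
        have hτ0 := hτ.1
        have hτJ := hJ t ht.1 hτ
        have hτδ : τ ≤ min (δ / 2) 1 := hτ.2.le.trans ht.2
        obtain ⟨h1, h2⟩ := hδη τ hτJ
          ((hτδ.trans (min_le_left _ _)).trans_lt (half_lt_self hδ0))
        have hw := norm_le_mul_rpow_neg hτ0 h1
        have hv := norm_le_mul_rpow_neg hτ0 h2
        have hwv := norm_le_mul_rpow_neg hτ0 (hYb τ ⟨hτJ, hτδ⟩)
        calc ‖N (W τ) - N (V τ)‖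
            ≤ κ * (‖W τ‖ ^ b + ‖V τ‖ ^ b) * ‖W τ - V τ‖ := hN.norm_sub_le _ _
          _ ≤ κ * ((η * τ ^ (-e)) ^ b + (η * τ ^ (-e)) ^ b) * (Y * τ ^ (-e)) := by gcongr
          _ = 2 * κ * η ^ b * Y * ((τ ^ (-e)) ^ b * τ ^ (-e)) := by
              rw [Real.mul_rpow hη.le (by positivity)]; ring
          _ = _ := by
              rw [← Real.rpow_mul hτ0.le, ← Real.rpow_add hτ0]
              congr 2
              ring
      have h1 := hS.norm_duhamel_le hγ hδ le_rfl h0 (by positivity) hF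
      rw [← hD t ht.1] at h1
      have h2 : t ^ (1 - γ - b * e) ≤ 1 :=
        Real.rpow_le_one h0.le (ht.2.trans (min_le_right _ _)) hθ
      calc t ^ e * ‖W t - V t‖
          ≤ t ^ e * (A * (2 * κ * η ^ b * Y) * β * t ^ (1 - γ - (b + 1) * e)) := by gcongr
        _ = A * (2 * κ * η ^ b * Y) * β * (t ^ e * t ^ (1 - γ - (b + 1) * e)) := by ring
        _ = A * (2 * κ * η ^ b * Y) * β * t ^ (1 - γ - b * e) := by
            rw [← Real.rpow_add h0]
            congr 2
            ring
        _ ≤ A * (2 * κ * η ^ b * Y) * β * 1 := by gcongr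
        _ = 4 * A * κ * β * η ^ b * Y / 2 := by ring
        _ ≤ 1 * Y / 2 := by gcongr
        _ = Y / 2 := by ring
  -- propagation to later times
  set M₁ := M * δ ^ (-e) with hM₁
  have hM₁0 : 0 ≤ M₁ := by positivity
  have hbound : ∀ (U : ℝ → X), (∀ t ∈ J, t ^ e * ‖U t‖ ≤ M) → ∀ t ∈ J, δ ≤ t → ‖U t‖ ≤ M₁ := by
    intro U hU t ht htδ
    refine (norm_le_mul_rpow_neg (hJ0 ht) (hU t ht)).trans ?_
    rw [hM₁]
    gcongr M * ?_
    exact Real.rpow_le_rpow_of_nonpos hδ0 htδ (by linarith)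
  clear_value M₁
  set c := 4 * A * κ * betaConst γ 0 * M₁ ^ b with hc
  have hc0 : 0 ≤ c := by positivity
  have hγ' : 0 < 1 - γ := sub_pos.2 hγ
  -- Step length for which the Duhamel integral over `[s, s + l]` halves any bound: `c l^{1-γ} ≤ 1`.
  set l : ℝ := (1 / (c + 1)) ^ (1 - γ)⁻¹ with hl_def
  have hl : 0 < l := by positivity
  have hlc : l ^ (1 - γ) = 1 / (c + 1) := by
    rw [hl_def, ← Real.rpow_mul (by positivity), inv_mul_cancel₀ hγ'.ne', Real.rpow_one]
  have hcl : c * l ^ (1 - γ) ≤ 1 := by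
    rw [hlc, mul_one_div, div_le_one (by positivity)]
    linarith
  have step : ∀ s, δ ≤ s → (∀ t ∈ J, t ≤ s → W t - V t = 0) →
      ∀ t ∈ J, t ≤ s + l → W t - V t = 0 := by
    intro s hs hsz
    have hzero : ∀ t ∈ J, ∀ τ, 0 < τ → τ ≤ t → τ ≤ s → N (W τ) - N (V τ) = 0 := by
      intro t ht τ hτ hτt hτs
      rw [sub_eq_zero.1 (hsz τ (hJ' t ht τ hτ hτt) hτs), sub_self]
    have key := nonpos_of_forall_le_half (s := J ∩ Iic (s + l))
      (f := fun t => ‖W t - V t‖) (M := M₁ + M₁) (by positivity) ?_ ?_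
    · exact fun t ht htl => norm_le_zero_iff.1 (key t ⟨ht, htl⟩)
    · intro t ht
      rcases le_total t s with h | h
      · simp only [hsz t ht.1 h, norm_zero]
        positivity
      · exact (norm_sub_le _ _).trans (add_le_add (hbound W hW t ht.1 (hs.trans h))
          (hbound V hV t ht.1 (hs.trans h)))
    · intro Y hY hYb t ht
      rcases le_or_gt t s with h | h
      · simp only [hsz t ht.1 h, norm_zero]
        positivity
      have hF : ∀ τ ∈ Ioo 0 (t - s), ‖N (W (τ + s)) - N (V (τ + s))‖ ≤
          2 * κ * M₁ ^ b * Y * τ ^ (-(0 : ℝ)) := by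
        intro τ hτ
        have hτJ : τ + s ∈ J := hJ t ht.1 ⟨by linarith [hτ.1], by linarith [hτ.2]⟩
        have h1 : δ ≤ τ + s := by linarith [hτ.1]
        have hτl : τ + s ≤ s + l := by
          have := ht.2
          simp only [mem_Iic] at this
          linarith [hτ.2]
        have hw := hbound W hW _ hτJ h1
        have hv := hbound V hV _ hτJ h1
        have hwv := hYb _ ⟨hτJ, hτl⟩
        rw [neg_zero, Real.rpow_zero, mul_one]
        calc ‖N (W (τ + s)) - N (V (τ + s))‖
            ≤ κ * (‖W (τ + s)‖ ^ b + ‖V (τ + s)‖ ^ b) * ‖W (τ + s) - V (τ + s)‖ :=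
              hN.norm_sub_le _ _
          _ ≤ κ * (M₁ ^ b + M₁ ^ b) * Y := by gcongr
          _ = _ := by ring
      have h1 := hS.norm_duhamel_le hγ zero_lt_one le_rfl (sub_pos.2 h) (by positivity) hF
      rw [← duhamel_eq_of_eq_zero (F := fun τ => N (W τ) - N (V τ)) (hδ0.le.trans hs) h.le
        (fun τ hτ => hzero t ht.1 τ hτ.1 (hτ.2.trans h.le) hτ.2), ← hD t ht.1, sub_zero] at h1
      have h2 : t - s ≤ l := by
        have := ht.2
        simp only [mem_Iic] at this
        linarith
      calc ‖W t - V t‖ ≤ A * (2 * κ * M₁ ^ b * Y) * betaConst γ 0 * (t - s) ^ (1 - γ) := h1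
        _ ≤ A * (2 * κ * M₁ ^ b * Y) * betaConst γ 0 * l ^ (1 - γ) := by
            have := sub_pos.2 h
            gcongr
        _ = c * l ^ (1 - γ) * Y / 2 := by rw [hc]; ring
        _ ≤ 1 * Y / 2 := by gcongr
        _ = Y / 2 := by ring
  have hall : ∀ k : ℕ, ∀ t ∈ J, t ≤ δ + k * l → W t - V t = 0 := by
    intro k
    induction k with
    | zero => simpa using hδz
    | succ k ih =>
      intro t ht htk
      refine step (δ + k * l) (by linarith [mul_nonneg k.cast_nonneg hl.le]) ih t ht ?_
      push_cast at htk
      linarith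
  intro t ht
  obtain ⟨k, hk⟩ := exists_nat_ge (t / l)
  rw [div_le_iff₀ hl] at hk
  exact sub_eq_zero.1 (hall k t ht (by linarith))

end Uniqueness

/-! ### Structure and uniqueness of solutions in the class `Y` -/

section YSolution
variable {𝕜 : Type*} [RCLike 𝕜] {n : ℕ} {α b r p P μ : ℝ}
theorem norm_le_interpolate (hr : 0 < r) (hrP : r ≤ P) (hPp : P ≤ p) (hrp : r < p)
    {f : LpReal 𝕜 n P} {g : LpReal 𝕜 n r} {k : LpReal 𝕜 n p} (hfg : f =ᵐ[volume] g)
    (hfk : f =ᵐ[volume] k) :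
    ‖f‖ ≤ ‖g‖ ^ (1 - (r⁻¹ - P⁻¹) / (r⁻¹ - p⁻¹)) * ‖k‖ ^ ((r⁻¹ - P⁻¹) / (r⁻¹ - p⁻¹)) := by
  have h1 := eLpNorm_le_interpolate hr hrP hPp hrp (Lp.aestronglyMeasurable f)
  have h3 : 0 < r⁻¹ - p⁻¹ := sub_pos.2 (inv_strictAnti₀ hr hrp)
  have hP : 0 < P := hr.trans_le hrP
  have h4 : P⁻¹ ≤ r⁻¹ := by gcongr
  have h5 : p⁻¹ ≤ P⁻¹ := by gcongr
  have hl0 : 0 ≤ (r⁻¹ - P⁻¹) / (r⁻¹ - p⁻¹) := div_nonneg (sub_nonneg.2 h4) h3.le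
  have hl1 : 0 ≤ 1 - (r⁻¹ - P⁻¹) / (r⁻¹ - p⁻¹) :=
    sub_nonneg.2 ((div_le_one h3).2 (by linarith))
  rw [Lp.norm_def, Lp.norm_def, Lp.norm_def, ENNReal.toReal_rpow, ENNReal.toReal_rpow,
    ← ENNReal.toReal_mul, ← eLpNorm_congr_ae hfg, ← eLpNorm_congr_ae hfk]
  refine ENNReal.toReal_mono (ENNReal.mul_ne_top ?_ ?_) h1
  · refine ENNReal.rpow_ne_top_of_nonneg hl1 ?_
    rw [eLpNorm_congr_ae hfg]
    exact Lp.eLpNorm_ne_top g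
  · refine ENNReal.rpow_ne_top_of_nonneg hl0 ?_
    rw [eLpNorm_congr_ae hfk]
    exact Lp.eLpNorm_ne_top k

variable [Fact (1 ≤ ENNReal.ofReal P)] [Fact (1 ≤ ENNReal.ofReal p)]
  [Fact (1 ≤ ENNReal.ofReal r)] [Fact (1 ≤ ENNReal.ofReal (P / (b + 1)))]

/-- For `r < P ≤ p`, interpolation between the bounded `L^r` norm and the weighted `L^p` norm puts
an arbitrary solution in the weighted `L^P` class, including the vanishing at `0`. Hence it obeys
the same equation as the fixed points constructed for existence. -/
theorem IsYSolution.exists_forcing (h : IsAuxExponent n α b r P) (hPp : P ≤ p) {q : ℝ≥0∞}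
    (hq : (q⁻¹).toReal = heatDecay n α r p) {φ : LpReal 𝕜 n r} {T : EReal}
    {u : ℝ → LpReal 𝕜 n r} (hu : IsYSolution α b μ q (ENNReal.ofReal p) φ T u) :
    ∃ (F : ℝ → LpReal 𝕜 n (P / (b + 1))) (B M : ℝ), IsForcing α b r P T F B ∧ 0 ≤ M ∧
      (∀ t ∈ posTimes T, t ^ heatDecay n α r P * ‖mildCurve α P φ F t‖ ≤ M) ∧
      (∀ t ∈ posTimes T, F t = powerOp μ b _ (mildCurve α P φ F t)) ∧
      ∀ t ∈ timeInterval T, u t = mildCurve α r φ F t := by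
  classical
  obtain ⟨⟨⟨hucont, M₁, hM₁⟩, w, hwu, ⟨hwcont, M₂, hM₂⟩, hwlim⟩, hmild⟩ := hu
  rw [hq] at hM₂ hwlim
  rw [timeInterval_inter_Ioi] at hwcont
  have hb := h.b_pos
  have hrp : r < p := h.lt.trans_le hPp
  set l := (r⁻¹ - P⁻¹) / (r⁻¹ - p⁻¹) with hl_def
  have h3 : 0 < r⁻¹ - p⁻¹ := sub_pos.2 (inv_strictAnti₀ h.r_pos hrp)
  have h4 : 0 < r⁻¹ - P⁻¹ := sub_pos.2 (inv_strictAnti₀ h.r_pos h.lt)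
  have hP := h.pos
  have h5 : p⁻¹ ≤ P⁻¹ := by gcongr
  have hl0 : 0 < l := div_pos h4 h3
  have hl1 : 0 ≤ 1 - l := sub_nonneg.2 ((div_le_one h3).2 (by linarith))
  -- The weights interpolate exactly: the `L^p` weight raised to the power `l` is the `L^P` weight.
  have hel : heatDecay n α r P = heatDecay n α r p * l := by
    rw [heatDecay, heatDecay, hl_def, mul_assoc, mul_div_cancel₀ _ h3.ne']
  have he : 0 < heatDecay n α r P := h.heatDecay_pos h.lt
  have hJI : ∀ t ∈ posTimes T, t ∈ timeInterval T := fun t ht => posTimes_subset_timeInterval T ht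
  have hwu' : ∀ t ∈ posTimes T, w t =ᵐ[volume] u t := fun t ht => hwu t (hJI t ht) ht.1
  have hmem : ∀ t ∈ posTimes T, MemLp (u t) (ENNReal.ofReal P) volume := fun t ht =>
    (Lp.memLp (u t)).interpolate h.r_pos h.lt.le hPp
      ((memLp_congr_ae (hwu' t ht)).1 (Lp.memLp (w t)))
  let U : ℝ → LpReal 𝕜 n P := fun t =>
    if ht : MemLp (u t) (ENNReal.ofReal P) volume then ht.toLp else 0
  have hUu : ∀ t ∈ posTimes T, U t =ᵐ[volume] u t := fun t ht => by
    simp only [U, dif_pos (hmem t ht)]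
    exact (hmem t ht).coeFn_toLp
  have hUsub : ∀ t ∈ posTimes T, ∀ s ∈ posTimes T,
      ‖U t - U s‖ ≤ ‖u t - u s‖ ^ (1 - l) * ‖w t - w s‖ ^ l := by
    intro t ht s hs
    refine norm_le_interpolate h.r_pos h.lt.le hPp hrp ?_ ?_
    · exact (Lp.coeFn_sub _ _).trans
        (((hUu t ht).sub (hUu s hs)).trans (Lp.coeFn_sub _ _).symm)
    · exact (Lp.coeFn_sub _ _).trans ((((hUu t ht).trans (hwu' t ht).symm).sub
        ((hUu s hs).trans (hwu' s hs).symm)).trans (Lp.coeFn_sub _ _).symm)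
  have hUle : ∀ t ∈ posTimes T,
      t ^ heatDecay n α r P * ‖U t‖ ≤ M₁ ^ (1 - l) * (t ^ heatDecay n α r p * ‖w t‖) ^ l := by
    intro t ht
    have ht0 : 0 < t := ht.1
    have h6 := norm_le_interpolate h.r_pos h.lt.le hPp hrp (hUu t ht)
      ((hUu t ht).trans (hwu' t ht).symm)
    rw [Real.mul_rpow (by positivity) (norm_nonneg _), ← Real.rpow_mul ht0.le, ← hel,
      mul_left_comm]
    gcongr
    refine h6.trans ?_
    gcongr
    exact hM₁ t (hJI t ht)
  have hUcont : ContinuousOn U (posTimes T) := by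
    intro s hs
    rw [ContinuousWithinAt, tendsto_iff_norm_sub_tendsto_zero]
    have h6 : Tendsto (fun t => ‖u t - u s‖) (𝓝[posTimes T] s) (𝓝 0) :=
      tendsto_iff_norm_sub_tendsto_zero.1
        ((hucont s (hJI s hs)).mono (posTimes_subset_timeInterval T))
    have h7 : Tendsto (fun t => ‖w t - w s‖) (𝓝[posTimes T] s) (𝓝 0) :=
      tendsto_iff_norm_sub_tendsto_zero.1 (hwcont s hs)
    -- The factor from `L^p` tends to `0` because `l > 0`. When `P = p` the other exponent `1 - l`
    -- is `0`, which does no harm.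
    have h8 := (h6.rpow_const (p := 1 - l) (Or.inr hl1)).mul (h7.rpow_const (p := l) (Or.inr hl0.le))
    rw [Real.zero_rpow hl0.ne', mul_zero] at h8
    refine squeeze_zero' (Eventually.of_forall fun t => norm_nonneg _) ?_ h8
    filter_upwards [self_mem_nhdsWithin] with t ht using hUsub t ht s hs
  have hN := isPowerLipschitz_powerOp (𝕜 := 𝕜)
    (ν := (volume : Measure (EuclideanSpace ℝ (Fin n)))) μ hb h.le
  set κ := |μ| * (b + 2) with hκ_def
  have hκ : 0 ≤ κ := hN.nonneg
  have hM₁0 : ∀ t ∈ posTimes T, 0 ≤ M₁ := fun t ht => (norm_nonneg _).trans (hM₁ t (hJI t ht))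
  set M := |M₁| ^ (1 - l) * |M₂| ^ l with hM_def
  have hM : 0 ≤ M := by positivity
  have hUM : ∀ t ∈ posTimes T, t ^ heatDecay n α r P * ‖U t‖ ≤ M := by
    intro t ht
    have ht0 : 0 < t := ht.1
    refine (hUle t ht).trans ?_
    have := hM₁0 t ht
    have h6 := (hM₂ t (hJI t ht) ht.1).trans (le_abs_self _)
    rw [hM_def]
    gcongr
    exact le_abs_self _
  have hUsmall : ∀ η, 0 < η → ∃ δ, 0 < δ ∧ ∀ t ∈ posTimes T, t < δ →
      t ^ heatDecay n α r P * ‖U t‖ ≤ η := by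
    intro η hη
    have h6 := (hwlim.rpow_const (p := l) (Or.inr hl0.le)).const_mul (M₁ ^ (1 - l))
    rw [Real.zero_rpow hl0.ne', mul_zero] at h6
    have h7 := h6.eventually_lt_const hη
    rw [eventually_nhdsWithin_iff, Metric.eventually_nhds_iff] at h7
    obtain ⟨δ, hδ, hδ'⟩ := h7
    refine ⟨δ, hδ, fun t ht htδ => (hUle t ht).trans (hδ' ?_ ht.1).le⟩
    rwa [Real.dist_eq, sub_zero, abs_of_pos ht.1]
  have hNU : ∀ t ∈ posTimes T, ∀ η, 0 ≤ η → t ^ heatDecay n α r P * ‖U t‖ ≤ η →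
      ‖powerOp μ b (ENNReal.ofReal (P / (b + 1))) (U t)‖ ≤
        κ * η ^ b * η * t ^ (-((b + 1) * heatDecay n α r P)) := by
    intro t ht η hη hUη
    rw [show (b + 1) * heatDecay n α r P = b * heatDecay n α r P + heatDecay n α r P by ring]
    exact hN.norm_comp_le hb ht.1 hη hUη hUη
  set F : ℝ → LpReal 𝕜 n (P / (b + 1)) := fun t => powerOp μ b _ (U t) with hF_def
  have hF : IsForcing α b r P T F (κ * M ^ b * M) := by
    refine ⟨by positivity, (hN.continuous hb).comp_continuousOn hUcont, fun τ hτ =>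
      hNU τ hτ M hM (hUM τ hτ), fun η hη => ?_⟩
    set R₁ : ℝ := (η / (κ + 1)) ^ (b + 1)⁻¹ with hR₁
    have hb1 := h.succ_pos
    have hR₁0 : 0 < R₁ := by positivity
    have hR₁η : κ * R₁ ^ b * R₁ ≤ η := by
      have h1 : R₁ ^ b * R₁ = η / (κ + 1) := by
        rw [← Real.rpow_add_one hR₁0.ne', hR₁, ← Real.rpow_mul (by positivity),
          inv_mul_cancel₀ hb1.ne', Real.rpow_one]
      rw [mul_assoc, h1, ← mul_div_assoc, div_le_iff₀ (by positivity)]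
      nlinarith
    obtain ⟨δ, hδ, hδ'⟩ := hUsmall R₁ hR₁0
    refine ⟨δ, hδ, fun τ hτ hτδ => (hNU τ hτ R₁ hR₁0.le (hδ' τ hτ hτδ)).trans ?_⟩
    gcongr
    exact Real.rpow_nonneg (le_of_lt hτ.1) _
  have hFN : ∀ τ ∈ posTimes T, F τ =ᵐ[volume] fun x => powerNonlinearity μ b (u τ x) := by
    intro τ hτ
    refine (coeFn_powerOp ((Lp.memLp _).powerNonlinearity hb hP)).trans ?_
    filter_upwards [hUu τ hτ] with x hx
    rw [hx]
  have hueq : ∀ t ∈ timeInterval T, u t = mildCurve α r φ F t := by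
    intro t ht
    obtain ⟨g, hg, hgint, hug⟩ := hmild.integral_eq t ht
    refine Lp.ext (hug.trans ?_)
    have h6 : ∫ τ in (0 : ℝ)..t, g τ = duhamel (heatFlow 𝕜 n α (P / (b + 1)) r) F t := by
      refine intervalIntegral.integral_congr_ae ?_
      have hne : ∀ᵐ τ : ℝ, τ ≠ t := by simp [ae_iff]
      filter_upwards [hg, hne] with τ hτ hτt hτm
      rw [uIoc_of_le ht.1] at hτm
      have hτI : τ ∈ Ioo 0 t := ⟨hτm.1, lt_of_le_of_ne hτm.2 hτt⟩
      have hτJ : τ ∈ posTimes T := ⟨hτI.1, (EReal.coe_lt_coe_iff.2 hτI.2).trans ht.2⟩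
      refine Lp.ext ((hτ hτI).trans ?_)
      rw [← fracHeatSemigroup_congr (sub_pos.2 hτI.2) (hFN τ hτJ)]
      exact (coeFn_heatFlow h.α_pos h.div_lt.le (sub_pos.2 hτI.2) (F τ)).symm
    rw [h6]
    refine EventuallyEq.trans ?_ (Lp.coeFn_add _ _).symm
    filter_upwards [coeFn_heatOp_self h.α_pos ENNReal.ofReal_ne_top ht.1 φ] with x hx
    rw [Pi.add_apply, hx]
  have hUeq : ∀ t ∈ posTimes T, U t = mildCurve α P φ F t := by
    intro t ht
    refine Lp.ext ((hUu t ht).trans ?_)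
    rw [hueq t (hJI t ht)]
    exact hF.mildCurve_ae_eq h (ae_eq_refl φ) le_rfl h.decay_r_lt h.lt.le h.lt.le
      h.decay_self_lt ht
  refine ⟨F, _, M, hF, hM, fun t ht => ?_, fun t ht => ?_, hueq⟩
  · rw [← hUeq t ht]
    exact hUM t ht
  · rw [← hUeq t ht]

/-- Subtracting the two representations in `L^P` cancels the linear part and leaves the difference
equation of `eqOn_of_duhamel`; equality in `L^P` is then carried back to `L^r`. -/
theorem IsYSolution.eqOn (h : IsAuxExponent n α b r P) (hPp : P ≤ p) {q : ℝ≥0∞}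
    (hq : (q⁻¹).toReal = heatDecay n α r p) {φ : LpReal 𝕜 n r} {T : EReal}
    {u v : ℝ → LpReal 𝕜 n r} (hu : IsYSolution α b μ q (ENNReal.ofReal p) φ T u)
    (hv : IsYSolution α b μ q (ENNReal.ofReal p) φ T v) : EqOn u v (timeInterval T) := by
  obtain ⟨F, B, M, hF, hM, hFM, hFN, hFu⟩ := hu.exists_forcing h hPp hq
  obtain ⟨G, B', M', hG, hM', hGM, hGN, hGv⟩ := hv.exists_forcing h hPp hq
  have hm : P / (b + 1) ≤ P := (h.div_lt.trans h.lt).le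
  obtain ⟨A, hS⟩ := exists_isSmoothingFamily_heatFlow 𝕜 n h.α_pos hm
  have hN := isPowerLipschitz_powerOp (𝕜 := 𝕜)
    (ν := (volume : Measure (EuclideanSpace ℝ (Fin n)))) μ h.b_pos h.le
  have hsmall : ∀ {F : ℝ → LpReal 𝕜 n (P / (b + 1))} {B : ℝ}, IsForcing α b r P T F B → 0 < T →
      ∀ η, 0 < η → ∃ δ, 0 < δ ∧ ∀ t, 0 < t → t < δ →
        t ^ heatDecay n α r P * ‖mildCurve α P φ F t‖ ≤ η := by
    intro F B hF hT η hη
    have h1 := (hF.tendsto_rpow_mul_norm_mildCurve h hT φ h.lt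
      h.decay_self_lt).eventually_lt_const hη
    rw [eventually_nhdsWithin_iff, Metric.eventually_nhds_iff] at h1
    obtain ⟨δ, hδ, hδ'⟩ := h1
    refine ⟨δ, hδ, fun t ht htδ => (hδ' ?_ ht).le⟩
    rwa [Real.dist_eq, sub_zero, abs_of_pos ht]
  have key : EqOn (mildCurve α P φ F) (mildCurve α P φ G) (posTimes T) := by
    intro t ht
    have hT : 0 < T := lt_trans (by exact_mod_cast ht.1) ht.2
    refine eqOn_of_duhamel hS h.decay_self_lt hN h.b_pos (h.heatDecay_pos h.lt).le
      h.succ_mul_heatDecay_lt ?_ (posTimes_subset_Ioi T) (fun t ht => Ioo_subset_posTimes ht)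
      (M := max M M') (le_max_of_le_left hM) (fun t ht => (hFM t ht).trans (le_max_left _ _))
      (fun t ht => (hGM t ht).trans (le_max_right _ _)) (fun η hη => ?_) (fun t ht => ?_) ht
    · rw [heatDecay_exponent_self_eq]
      exact h.theta_nonneg
    · obtain ⟨δ₁, hδ₁, h1⟩ := hsmall hF hT η hη
      obtain ⟨δ₂, hδ₂, h2⟩ := hsmall hG hT η hη
      exact ⟨min δ₁ δ₂, lt_min hδ₁ hδ₂, fun t ht htδ =>
        ⟨h1 t ht.1 (htδ.trans_le (min_le_left _ _)), h2 t ht.1 (htδ.trans_le (min_le_right _ _))⟩⟩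
    · have h1 : mildCurve α P φ F t - mildCurve α P φ G t
          = duhamel (heatFlow 𝕜 n α (P / (b + 1)) P) F t
            - duhamel (heatFlow 𝕜 n α (P / (b + 1)) P) G t := by
        rw [mildCurve, mildCurve, add_sub_add_left_eq_sub]
      rw [h1, duhamel_sub (hF.intervalIntegrable h hm h.decay_self_lt ht)
        (hG.intervalIntegrable h hm h.decay_self_lt ht)]
      refine intervalIntegral.integral_congr_ae (ae_uIoc_of_forall_Ioo ht.1.le fun τ hτ => ?_)
      have hτ := Ioo_subset_posTimes ht hτ
      beta_reduce
      rw [hFN τ hτ, hGN τ hτ]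
  intro t ht
  rcases ht.1.eq_or_lt with h0 | h0
  · rw [hFu t ht, hGv t ht, ← h0, mildCurve_zero h.α_pos, mildCurve_zero h.α_pos]
  · have htJ := mem_posTimes_of_mem ht h0
    rw [hFu t ht, hGv t ht]
    refine Lp.ext ((hF.mildCurve_ae_eq h (ae_eq_refl φ) le_rfl h.decay_r_lt h.lt.le h.lt.le
      h.decay_self_lt htJ).trans ?_)
    rw [key htJ]
    exact hG.mildCurve_ae_eq h (ae_eq_refl φ) h.lt.le h.decay_self_lt le_rfl le_rfl h.decay_r_lt
      htJ

end YSolution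

/-! ### Continuation of solutions and the lower bound near the maximal time -/

section Gluing

/-- The curve that follows `u` up to time `s` and `v` afterwards. -/
noncomputable def glueAt {B : Type*} (s : ℝ) (u v : ℝ → B) (t : ℝ) : B :=
  if t ≤ s then u t else v (t - s)

theorem glueAt_of_le {B : Type*} {s t : ℝ} (u v : ℝ → B) (h : t ≤ s) : glueAt s u v t = u t :=
  if_pos h

theorem glueAt_of_lt {B : Type*} {s t : ℝ} (u v : ℝ → B) (h : s < t) :
    glueAt s u v t = v (t - s) :=
  if_neg (not_le.2 h)

theorem glueAt_of_ge {B : Type*} {s t : ℝ} {u v : ℝ → B} (huv : v 0 = u s) (h : s ≤ t) :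
    glueAt s u v t = v (t - s) := by
  rcases h.eq_or_lt with h | h
  · rw [← h, glueAt_of_le _ _ le_rfl, sub_self, huv]
  · exact glueAt_of_lt _ _ h

theorem continuousOn_glueAt {B : Type*} [TopologicalSpace B] {s : ℝ} {u v : ℝ → B} {I : Set ℝ}
    (huv : v 0 = u s) (hu : ContinuousOn u (I ∩ Iic s))
    (hv : ContinuousOn (fun t => v (t - s)) (I ∩ Ici s)) : ContinuousOn (glueAt s u v) I := by
  have h1 : ContinuousOn (glueAt s u v) (I ∩ Iic s) :=
    hu.congr fun t ht => glueAt_of_le _ _ ht.2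
  have h2 : ContinuousOn (glueAt s u v) (I ∩ Ici s) :=
    hv.congr fun t ht => glueAt_of_ge huv ht.2
  have h3 : I = (I ∩ Iic s) ∪ (I ∩ Ici s) := by
    rw [← inter_union_distrib_left, Iic_union_Ici, inter_univ]
  intro t ht
  rw [h3]
  refine ContinuousWithinAt.union ?_ ?_
  · by_cases h : t ≤ s
    · exact h1 t ⟨ht, h⟩
    · exact continuousWithinAt_of_notMem_closure fun h' =>
        h (closure_minimal inter_subset_right isClosed_Iic h')
  · by_cases h : s ≤ t
    · exact h2 t ⟨ht, h⟩
    · exact continuousWithinAt_of_notMem_closure fun h' =>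
        h (closure_minimal inter_subset_right isClosed_Ici h')

variable {𝕜 : Type*} [RCLike 𝕜] {n : ℕ} {α b r p μ : ℝ} [Fact (1 ≤ ENNReal.ofReal r)]

theorem IsMildSolution.exists_eq (hα : 0 < α) {φ : LpReal 𝕜 n r} {I : Set ℝ}
    {u : ℝ → LpReal 𝕜 n r} (hu : IsMildSolution α b μ φ I u) {t : ℝ} (ht : t ∈ I) (ht0 : 0 ≤ t) :
    ∃ g : ℝ → LpReal 𝕜 n r,
      (∀ᵐ τ : ℝ, τ ∈ Ioo 0 t →
        g τ =ᵐ[volume] fracHeatSemigroup α (t - τ) (fun x => powerNonlinearity μ b (u τ x))) ∧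
      IntervalIntegrable g volume 0 t ∧
      u t = heatFlow 𝕜 n α r r t φ + ∫ τ in (0 : ℝ)..t, g τ := by
  obtain ⟨g, hg, hgi, hug⟩ := hu.integral_eq t ht
  refine ⟨g, hg, hgi, Lp.ext (hug.trans (EventuallyEq.trans ?_ (Lp.coeFn_add _ _).symm))⟩
  filter_upwards [coeFn_heatOp_self hα ENNReal.ofReal_ne_top ht0 φ] with x hx
  rw [Pi.add_apply, hx]

theorem IsMildSolution.apply_zero (hα : 0 < α) {φ : LpReal 𝕜 n r} {I : Set ℝ}
    {u : ℝ → LpReal 𝕜 n r} (hu : IsMildSolution α b μ φ I u) (h0 : 0 ∈ I) : u 0 = φ := by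
  obtain ⟨g, -, -, h⟩ := hu.exists_eq hα h0 le_rfl
  rw [h, intervalIntegral.integral_same, add_zero, heatFlow, heatOp_zero hα ENNReal.ofReal_ne_top]

/-- Apply `S(t-s)` to the Duhamel formula for `u(s)`: the law `S(t-s) S(s-τ) = S(t-τ)` gives the
part of the integral over `[0, s]`, and the formula for `v`, shifted in time, gives the rest. On the
forcing the law is available since the forcing lies in some `L^m`. -/
theorem IsMildSolution.glue (hα : 0 < α) {φ : LpReal 𝕜 n r} {s T T' : ℝ} (hs : 0 < s)
    (hsT : s < T) {u v : ℝ → LpReal 𝕜 n r}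
    (hu : IsMildSolution α b μ φ (timeInterval (T : EReal)) u)
    (hv : IsMildSolution α b μ (u s) (timeInterval (T' : EReal)) v) :
    IsMildSolution α b μ φ (timeInterval ((s + T' : ℝ) : EReal)) (glueAt s u v) := by
  simp only [timeInterval, EReal.coe_lt_coe_iff] at hu hv ⊢
  refine ⟨fun τ hτ hτ0 => ?_, fun t ht => ?_⟩
  · rcases le_or_gt τ s with h | h
    · rw [glueAt_of_le _ _ h]
      exact hu.forcing_memLp τ ⟨hτ.1, h.trans_lt hsT⟩ hτ0
    · rw [glueAt_of_lt _ _ h]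
      exact hv.forcing_memLp _ ⟨by linarith, by linarith [hτ.2]⟩ (by linarith)
  rcases le_or_gt t s with hts | hts
  · obtain ⟨g, hg, hgi, hug⟩ := hu.integral_eq t ⟨ht.1, hts.trans_lt hsT⟩
    refine ⟨g, ?_, hgi, ?_⟩
    · filter_upwards [hg] with τ hτ hτt
      rw [glueAt_of_le _ _ (hτt.2.le.trans hts)]
      exact hτ hτt
    · rw [glueAt_of_le _ _ hts]
      exact hug
  have hσ : 0 < t - s := sub_pos.2 hts
  obtain ⟨g, hg, hgi, hug⟩ := hu.exists_eq hα (t := s) ⟨hs.le, hsT⟩ hs.le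
  obtain ⟨k, hk, hki, hvk⟩ := hv.exists_eq hα (t := t - s) ⟨hσ.le, by linarith [ht.2]⟩ hσ.le
  set L := heatFlow 𝕜 n α r r (t - s)
  let f : ℝ → LpReal 𝕜 n r := fun τ => if τ ≤ s then L (g τ) else k (τ - s)
  have hf1 : EqOn (fun τ => L (g τ)) f (uIoo 0 s) := fun τ hτ => by
    rw [uIoo_of_le hs.le] at hτ
    exact (if_pos hτ.2.le).symm
  have hf2 : EqOn (fun τ => k (τ - s)) f (uIoo s t) := fun τ hτ => by
    rw [uIoo_of_le hts.le] at hτ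
    exact (if_neg (not_le.2 hτ.1)).symm
  have hfi1 : IntervalIntegrable f volume 0 s :=
    (show IntervalIntegrable (fun τ => L (g τ)) volume 0 s from
      ⟨L.integrable_comp hgi.1, L.integrable_comp hgi.2⟩).congr_uIoo hf1
  have hki' : IntervalIntegrable (fun τ => k (τ - s)) volume s t := by
    have := hki.comp_sub_right s
    rwa [zero_add, sub_add_cancel] at this
  have hfi2 : IntervalIntegrable f volume s t := hki'.congr_uIoo hf2
  refine ⟨f, ?_, hfi1.trans hfi2, ?_⟩
  · have hne : ∀ᵐ τ : ℝ, τ ≠ s := by simp [ae_iff]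
    have hk' := (measurePreserving_sub_right (volume : Measure ℝ) s).quasiMeasurePreserving.ae hk
    filter_upwards [hne, hg, hk'] with τ hτs hgτ hkτ hτ
    rcases lt_or_gt_of_ne hτs with h | h
    · have h1 : f τ = L (g τ) := if_pos h.le
      obtain ⟨m, hm, hmem⟩ := hu.forcing_memLp τ ⟨hτ.1.le, h.trans hsT⟩ hτ.1
      rw [h1, glueAt_of_le _ _ h.le]
      refine (coeFn_heatFlow hα le_rfl hσ (g τ)).trans ?_
      rw [fracHeatSemigroup_congr hσ (hgτ ⟨hτ.1, h⟩),
        fracHeatSemigroup_fracHeatSemigroup hα (sub_pos.2 h) hσ hm hmem, sub_add_sub_cancel]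
    · have h1 : f τ = k (τ - s) := if_neg (not_le.2 h)
      rw [h1, glueAt_of_lt _ _ h]
      have h2 := hkτ ⟨sub_pos.2 h, by linarith [hτ.2]⟩
      rwa [sub_sub_sub_cancel_right] at h2
  · have h1 : ∫ τ in (0 : ℝ)..t, f τ = L (∫ τ in (0 : ℝ)..s, g τ)
        + ∫ τ in (0 : ℝ)..(t - s), k τ := by
      rw [← intervalIntegral.integral_add_adjacent_intervals hfi1 hfi2,
        ← L.intervalIntegral_comp_comm hgi]
      congr 1
      · refine intervalIntegral.integral_congr_ae (ae_uIoc_of_forall_Ioo hs.le fun τ hτ => ?_)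
        exact if_pos hτ.2.le
      · have h2 := intervalIntegral.integral_comp_sub_right (a := s) (b := t) k s
        rw [sub_self] at h2
        rw [← h2]
        refine intervalIntegral.integral_congr_ae (ae_uIoc_of_forall_Ioo hts.le fun τ hτ => ?_)
        exact if_neg (not_le.2 hτ.1)
    have h2 : glueAt s u v t = heatFlow 𝕜 n α r r t φ + ∫ τ in (0 : ℝ)..t, f τ := by
      rw [glueAt_of_lt _ _ hts, hvk, hug, map_add, heatFlow_heatFlow hα le_rfl le_rfl hσ hs,
        sub_add_cancel, h1, add_assoc]
    rw [h2]
    refine (Lp.coeFn_add _ _).trans ?_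
    filter_upwards [coeFn_heatOp_self hα ENNReal.ofReal_ne_top ht.1 φ] with x hx
    rw [Pi.add_apply, hx]

variable [Fact (1 ≤ ENNReal.ofReal p)]

/-- Membership of `v` in `Y` alone would allow an `L^p` singularity at its initial time, that is, at
`s`. The curve `w`, bounded and continuous in `L^p` down to time `0`, excludes it. -/
theorem IsYSolution.glue (hα : 0 < α) {q : ℝ≥0∞} {φ : LpReal 𝕜 n r} {s T T' : ℝ} (hs : 0 < s)
    (hsT : s < T) (hT' : 0 < T') {u v : ℝ → LpReal 𝕜 n r} {w : ℝ → LpReal 𝕜 n p}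
    (hu : IsYSolution α b μ q (ENNReal.ofReal p) φ (T : EReal) u)
    (hv : IsYSolution α b μ q (ENNReal.ofReal p) (u s) (T' : EReal) v)
    (hw : MemCb (timeInterval (T' : EReal)) w)
    (hwv : ∀ t ∈ timeInterval (T' : EReal), w t =ᵐ[volume] v t) :
    IsYSolution α b μ q (ENNReal.ofReal p) φ ((s + T' : ℝ) : EReal) (glueAt s u v) := by
  have hv0 : v 0 = u s := hv.2.apply_zero hα ⟨le_rfl, by exact_mod_cast hT'⟩
  refine ⟨?_, hu.2.glue hα hs hsT hv.2⟩
  obtain ⟨⟨⟨hucont, M₁, hM₁⟩, w₁, hw₁u, ⟨hw₁cont, M₂, hM₂⟩, hw₁lim⟩, -⟩ := hu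
  obtain ⟨⟨⟨hvcont, M₃, hM₃⟩, -⟩, -⟩ := hv
  obtain ⟨hwcont, M₄, hM₄⟩ := hw
  simp only [timeInterval, EReal.coe_lt_coe_iff] at *
  have hshift : MapsTo (fun t : ℝ => t - s) ({t : ℝ | 0 ≤ t ∧ t < s + T'} ∩ Ici s)
      {t : ℝ | 0 ≤ t ∧ t < T'} := fun t ht => ⟨sub_nonneg.2 ht.2, by linarith [ht.1.2]⟩
  have hshiftc : ContinuousOn (fun t : ℝ => t - s) ({t : ℝ | 0 ≤ t ∧ t < s + T'} ∩ Ici s) := by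
    fun_prop
  have hw0 : w 0 = w₁ s := Lp.ext ((hwv 0 ⟨le_rfl, hT'⟩).trans (by
    rw [hv0]
    exact (hw₁u s ⟨hs.le, hsT⟩ hs).symm))
  refine ⟨⟨?_, max M₁ M₃, fun t ht => ?_⟩, glueAt s w₁ w, fun t ht ht0 => ?_, ⟨?_,
    max M₂ ((s + T') ^ (q⁻¹).toReal * M₄), fun t ht ht0 => ?_⟩, ?_⟩
  · exact continuousOn_glueAt hv0 (hucont.mono fun t ht => ⟨ht.1.1, ht.2.trans_lt hsT⟩)
      (hvcont.comp hshiftc hshift)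
  · rcases le_or_gt t s with h | h
    · rw [glueAt_of_le _ _ h]
      exact (hM₁ t ⟨ht.1, h.trans_lt hsT⟩).trans (le_max_left _ _)
    · rw [glueAt_of_lt _ _ h]
      exact (hM₃ _ (hshift ⟨ht, h.le⟩)).trans (le_max_right _ _)
  · rcases le_or_gt t s with h | h
    · rw [glueAt_of_le _ _ h, glueAt_of_le _ _ h]
      exact hw₁u t ⟨ht.1, h.trans_lt hsT⟩ ht0
    · rw [glueAt_of_lt _ _ h, glueAt_of_lt _ _ h]
      exact hwv _ (hshift ⟨ht, h.le⟩)
  · exact continuousOn_glueAt hw0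
      (hw₁cont.mono fun t ht => ⟨⟨ht.1.1.1, ht.2.trans_lt hsT⟩, ht.1.2⟩)
      ((hwcont.comp hshiftc hshift).mono fun t ht => ⟨ht.1.1, ht.2⟩)
  · rcases le_or_gt t s with h | h
    · rw [glueAt_of_le _ _ h]
      exact (hM₂ t ⟨ht.1, h.trans_lt hsT⟩ ht0).trans (le_max_left _ _)
    · rw [glueAt_of_lt _ _ h]
      refine le_max_of_le_right ?_
      have h1 := hM₄ _ (hshift ⟨ht, h.le⟩)
      have h2 := ht.2.le
      gcongr
  · refine hw₁lim.congr' ?_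
    filter_upwards [Ioo_mem_nhdsGT hs] with t ht
    rw [glueAt_of_le _ _ ht.2.le]

variable {P : ℝ} [Fact (1 ≤ ENNReal.ofReal P)] [Fact (1 ≤ ENNReal.ofReal (P / (b + 1)))]

/-- The norm blows up at least at the rate given by scaling at the end of a finite maximal existence
interval. -/
theorem exists_le_norm_of_isMaximalYSolution (𝕜 : Type*) [RCLike 𝕜] (μ : ℝ)
    (h : IsAuxExponent n α b r P) (hrp : r < p) (hγ : heatDecay n α (P / (b + 1)) p < 1)
    {q : ℝ≥0∞} (hq : (q⁻¹).toReal = heatDecay n α r p) :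
    ∃ C : ℝ, 0 < C ∧ ∀ (φ : LpReal 𝕜 n r) (Tmax : ℝ) (u : ℝ → LpReal 𝕜 n r),
      IsMaximalYSolution α b μ q (ENNReal.ofReal p) φ Tmax u → ∀ s : ℝ, 0 ≤ s → s < Tmax →
        C / (Tmax - s) ^ (1 / b - (n : ℝ) / (2 * r * α)) ≤ ‖u s‖ := by
  obtain ⟨c, hc, hex⟩ := exists_isYSolution_of_rpow_mul_norm_le 𝕜 μ h hrp hγ hq
  have hb := h.b_pos
  have hα := h.α_pos
  have hr := h.r_pos
  set θ := 1 - n * b / (2 * α) / r with hθ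
  have hexp : 1 / b - (n : ℝ) / (2 * r * α) = θ * b⁻¹ := by
    rw [hθ]; field_simp
  -- Chosen so that the opposite inequality gives `(2(Tmax - s))^θ ‖u s‖^b ≤ c`, the condition for
  -- existence during `2(Tmax - s)`. The factor `2` carries the continuation strictly beyond `Tmax`.
  refine ⟨(c / 2 ^ θ) ^ b⁻¹, by positivity, fun φ Tmax u hu s hs hsT => ?_⟩
  obtain ⟨hTmax, hsol, hmax⟩ := hu
  by_contra! hlt
  rw [hexp] at hlt
  have hD : 0 < Tmax - s := sub_pos.2 hsT
  have hT' : 0 < 2 * (Tmax - s) := by positivity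
  have hsmall : (2 * (Tmax - s)) ^ θ * ‖u s‖ ^ b ≤ c := by
    calc (2 * (Tmax - s)) ^ θ * ‖u s‖ ^ b
        ≤ (2 * (Tmax - s)) ^ θ * ((c / 2 ^ θ) ^ b⁻¹ / (Tmax - s) ^ (θ * b⁻¹)) ^ b := by gcongr
      _ = c := by
          rw [Real.div_rpow (by positivity) (by positivity), ← Real.rpow_mul (by positivity),
            ← Real.rpow_mul (by positivity), mul_assoc, inv_mul_cancel₀ hb.ne', mul_one,
            Real.rpow_one, Real.mul_rpow zero_le_two hD.le]
          field_simp
  obtain ⟨v, hv, hψ⟩ := hex (u s) _ hT' hsmall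
  obtain ⟨T, hT1, hT2⟩ := exists_between hsT
  have huT := hsol T (hs.trans_lt hT1) hT2
  -- At `s = 0` the new solution starts from `φ` and contradicts maximality directly. Gluing is
  -- confined to `s > 0`, where `u s` is known to lie in `L^p`.
  rcases hs.eq_or_lt with h0 | h0
  · subst h0
    rw [huT.2.apply_zero hα ⟨le_rfl, by exact_mod_cast hT1⟩] at hv
    exact hmax _ (by linarith) ⟨v, hv⟩
  · obtain ⟨⟨-, w, hwu, -⟩, -⟩ := id huT
    obtain ⟨w', hw', hw'v⟩ := hψ (w s) (hwu s ⟨hs, by exact_mod_cast hT1⟩ h0)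
    exact hmax _ (by linarith) ⟨_, huT.glue hα h0 hT1 hT' hv hw' hw'v⟩

end Gluing

/-! ### The theorem -/

theorem theorem4p2 {𝕜 : Type*} [RCLike 𝕜] (n : ℕ) (α b μ : ℝ) (q : ℝ≥0∞) (p r : ℝ)
    [Fact (1 ≤ ENNReal.ofReal p)] [Fact (1 ≤ ENNReal.ofReal r)]
    (hα : 0 < α) (hb : 0 < b) (hμ : μ = 1 ∨ μ = -1)
    (hr₀ : 1 < (n : ℝ) * b / (2 * α)) (hr : (n : ℝ) * b / (2 * α) ≤ r)
    (hadm : IsGenAdmissible n α q p r) (hrp : r < p) :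
    -- (i) local existence, with a time that depends only on the norm of the data if `r > r₀`
    ((n : ℝ) * b / (2 * α) < r → ∀ M : ℝ, ∃ T : ℝ, 0 < T ∧
      ∀ φ : Lp 𝕜 (ENNReal.ofReal r) (volume : Measure (EuclideanSpace ℝ (Fin n))), ‖φ‖ ≤ M →
        ∃ u, IsYSolution α b μ q (ENNReal.ofReal p) φ (T : EReal) u) ∧
    -- (i) local existence, with a time that depends on the data itself if `r = r₀`
    (r = (n : ℝ) * b / (2 * α) →
      ∀ φ : Lp 𝕜 (ENNReal.ofReal r) (volume : Measure (EuclideanSpace ℝ (Fin n))),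
        ∃ T : ℝ, 0 < T ∧ ∃ u, IsYSolution α b μ q (ENNReal.ofReal p) φ (T : EReal) u) ∧
    -- uniqueness in `Y([0, T))`, for every finite or infinite `T`
    (b + 1 ≤ p →
      ∀ (φ : Lp 𝕜 (ENNReal.ofReal r) (volume : Measure (EuclideanSpace ℝ (Fin n)))) (T : EReal)
        (u v : ℝ → Lp 𝕜 (ENNReal.ofReal r) (volume : Measure (EuclideanSpace ℝ (Fin n)))),
        IsYSolution α b μ q (ENNReal.ofReal p) φ T u →
        IsYSolution α b μ q (ENNReal.ofReal p) φ T v →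
        ∀ t ∈ timeInterval T, u t = v t) ∧
    -- (ii) global existence of a small solution for small data if `r = r₀`
    (r = (n : ℝ) * b / (2 * α) → ∀ ε : ℝ, 0 < ε → ∃ δ : ℝ, 0 < δ ∧
      ∀ φ : Lp 𝕜 (ENNReal.ofReal r) (volume : Measure (EuclideanSpace ℝ (Fin n))), ‖φ‖ ≤ δ →
        ∃ u, IsYSolution α b μ q (ENNReal.ofReal p) φ ⊤ u ∧
          (∀ t : ℝ, 0 ≤ t → ‖u t‖ ≤ ε) ∧
          (∀ t : ℝ, 0 < t →
            ENNReal.ofReal (t ^ (q⁻¹).toReal) * eLpNorm (u t) (ENNReal.ofReal p) volume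
              ≤ ENNReal.ofReal ε)) ∧
    -- (iii) lower bound on the norm up to the end of a finite maximal existence interval
    ((n : ℝ) * b / (2 * α) < r → ∃ C : ℝ, 0 < C ∧
      ∀ (φ : Lp 𝕜 (ENNReal.ofReal r) (volume : Measure (EuclideanSpace ℝ (Fin n)))) (Tmax : ℝ)
        (u : ℝ → Lp 𝕜 (ENNReal.ofReal r) (volume : Measure (EuclideanSpace ℝ (Fin n)))),
        IsMaximalYSolution α b μ q (ENNReal.ofReal p) φ Tmax u →
        ∀ s : ℝ, 0 ≤ s → s < Tmax →
          C / (Tmax - s) ^ (1 / b - (n : ℝ) / (2 * r * α)) ≤ ‖u s‖) := by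
  have hn : 0 < n := by
    rcases Nat.eq_zero_or_pos n with h | h
    · subst h
      norm_num at hr₀
    · exact h
  have hr1 : 1 < r := hadm.one_lt
  have hq := hadm.toReal_inv hα
  obtain ⟨P, hP, hγ⟩ := exists_isAuxExponent hα hb hr1 hr hn (hadm.heatDecay_lt_one hα hn)
  have := hP.fact_pos
  have := hP.fact_div
  refine ⟨fun hlt M => exists_isYSolution_of_norm_le 𝕜 μ hP hlt hrp hγ hq M,
    fun heq φ => exists_isYSolution_critical 𝕜 μ hP heq hrp hγ hq φ, ?_,
    fun heq ε hε => exists_global_isYSolution 𝕜 μ hP heq hrp hγ hq hε,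
    fun _ => exists_le_norm_of_isMaximalYSolution 𝕜 μ hP hrp hγ hq⟩
  intro hbp φ T u v hu hv
  -- A second auxiliary exponent: existence takes `P` close to `r(b+1)`, possibly above `p`, whereas
  -- interpolating a given solution requires `P' ≤ p`.
  obtain ⟨P', hP', hP'p⟩ := exists_isAuxExponent_le hα hb hr1 hr hn hrp hbp
  have := hP'.fact_pos
  have := hP'.fact_div
  exact hu.eqOn hP' hP'p hq hv
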